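/- Let $X$ be a complex manifold, $E\to X$ a holomorphic vector bundle of finite rank $m$ with a smooth Hermitian metric, Chern connection $D=D_E$ with curvature $\Theta=D^2$, and let $f$ be a holomorphic section of $E$ with zero set $Z=\{f=0\}$. Over $X\setminus Z$ let $S\subset E$ be the line bundle spanned by $f$, let $Q=E/S$ with the induced (quotient) Hermitian metric and Chern connection $D_Q$, and let $\sigma$ be the section of $E^*$ of minimal norm with $\sigma\cdot f=1$, i.e. $\sigma=\langle\cdot,f\rangle/|f|^2$. Put $\aleph=i/2\pi$ and let $c(D_E)=\det(I+\aleph\Theta)$, $c(D_Q)=\det(I+\aleph\Theta_Q)$ be the total Chern forms. In the exterior algebra bundle $\Lambda(T^*X\oplus E\oplus E^*)$, with a local holomorphic frame $e_1,\dots,e_m$ of $E$ and dual frame $e_1^*,\dots,e_m^*$, identify a form-valued section $\sum_j\xi_j\otimes e_j$ of $E$ with $\sum_j\xi_j\wedge e_j$, similarly for $E^*$, and a form-valued endomorphism $\sum_{j,k} A_{jk}\otimes e_j\otimes e_k^*$ with $\sum_{j,k}A_{jk}\wedge e_j\wedge e_k^*$; let $\tilde\Theta$ and $\tilde I=\sum_j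 e_j\wedge e_j^*$ be the elements so obtained from $\Theta$ and from the identity of $E$. For a section $\omega$ of this bundle write $\omega=\omega'\wedge \tilde I^m/m!+\omega''$, where $\omega'$ is a form on $X$ and $\omega''$ has lower degree in the $e_j,e_k^*$, and put $\int_e\omega=\omega'$. Then the forms $c(D_E)$ on $X$ and $c(D_Q)$, $$a=\int_e \aleph Df\wedge\sigma\wedge e^{\tilde I+\aleph\tilde\Theta}\wedge\sum_{\ell=0}^\infty\frac{(-\aleph Df\wedge\bar\partial\sigma)^\ell}{(\ell+1)!}$$ on $X\setminus Z$ are well defined (independent of the local holomorphic frames), $a$ is smooth on $X\setminus Z$, and $$\bar\partial a=da=c(D_E)-c(D_Q)\quad\text{in } X\setminus Z .$$ -/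

import Mathlib

open scoped Manifold ContDiff Bundle

noncomputable section

namespace PoincareLelong

/-! ## Complex differential forms on a complex manifold -/

section Forms

variable (V : Type*) [NormedAddCommGroup V] [NormedSpace ℂ V]

/-- The algebra of complex-valued real-multilinear alternating forms on the tangent space `V`,
i.e. the exterior algebra over `ℂ` of the complexified cotangent space `Hom_ℝ(V, ℂ)`.
All degrees are allowed at the same time; the product is the wedge product. -/
abbrev FormAlg := ExteriorAlgebra ℂ (V →L[ℝ] ℂ)

/-- (Not necessarily smooth) complex differential forms on a manifold `X` modelled on `V`.
As always in Mathlib, the tangent space at `x` is the model space `V`, the identification being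
the one given by the preferred chart at `x`. -/
abbrev FormField (X : Type*) := X → FormAlg V

variable {V}

/-- Precomposition of covectors with a real-linear map, `α ↦ α ∘ L`. -/
def precomp (L : V →L[ℝ] V) : (V →L[ℝ] ℂ) →ₗ[ℂ] (V →L[ℝ] ℂ) where
  toFun α := α.comp L
  map_add' _ _ := rfl
  map_smul' _ _ := rfl

/-- Multiplication by `i` on the tangent space, as a real-linear map. -/
def mulI : V →L[ℝ] V := (Complex.I • ContinuousLinearMap.id ℂ V).restrictScalars ℝ

/-- The projection of a covector to its `(1,0)`-part (its complex-linear part). -/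
def proj10 : (V →L[ℝ] ℂ) →ₗ[ℂ] (V →L[ℝ] ℂ) :=
  (1 / 2 : ℂ) • (LinearMap.id - Complex.I • precomp mulI)

/-- The projection of a covector to its `(0,1)`-part (its conjugate-linear part). -/
def proj01 : (V →L[ℝ] ℂ) →ₗ[ℂ] (V →L[ℝ] ℂ) :=
  (1 / 2 : ℂ) • (LinearMap.id + Complex.I • precomp mulI)

variable [FiniteDimensional ℂ V]

instance finiteCovectors : Module.Finite ℂ (V →L[ℝ] ℂ) :=
  Module.Finite.of_restrictScalars_finite ℝ ℂ (V →L[ℝ] ℂ)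

/-- A basis of the finite-dimensional algebra of forms at a point; it only serves to
differentiate functions with values in that algebra. -/
def formBasis : Module.Basis (Finset (Fin (Module.finrank ℂ (V →L[ℝ] ℂ)))) ℂ (FormAlg V) :=
  (Module.finBasis ℂ (V →L[ℝ] ℂ)).ExteriorAlgebra

/-- The derivative of `W : V → FormAlg V` at `y` in the direction `v`, taken coefficientwise. -/
def dirDeriv (W : V → FormAlg V) (y v : V) : FormAlg V :=
  ∑ s, (fderiv ℝ (fun y' => formBasis.repr (W y') s) y v) • (formBasis s : FormAlg V)

/-- The `i`-th real coordinate function on `V`, as a complex-valued covector `dx_i`. -/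
def coordCovector (i : Fin (Module.finrank ℝ V)) : V →L[ℝ] ℂ :=
  Complex.ofRealCLM.comp (LinearMap.toContinuousLinearMap ((Module.finBasis ℝ V).coord i))

/-- The operator `W ↦ ∑ i, P(dx_i) ∧ ∂W/∂x_i` on forms on the vector space `V`.
For `P = id`, the `(1,0)`-projection, the `(0,1)`-projection this is `d`, `∂`, `∂̄`. -/
def flatD (P : (V →L[ℝ] ℂ) →ₗ[ℂ] (V →L[ℝ] ℂ)) (W : V → FormAlg V) (y : V) : FormAlg V :=
  ∑ i, ExteriorAlgebra.ι ℂ (P (coordCovector i)) * dirDeriv W y (Module.finBasis ℝ V i)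

variable {X : Type*} [TopologicalSpace X] [ChartedSpace V X]

/-- The expression of a form in the preferred chart at `p`: its pullback under the inverse of that
chart, a form on the image of the chart in `V`. -/
def localRep (η : FormField V X) (p : X) (y : V) : FormAlg V :=
  ExteriorAlgebra.map
    (precomp (V := V) (mfderiv 𝓘(ℝ, V) 𝓘(ℝ, V) (extChartAt 𝓘(ℝ, V) p).symm y))
    (η ((extChartAt 𝓘(ℝ, V) p).symm y))

/-- The operators `d`, `∂`, `∂̄` on forms on `X` (depending on the projection `P`), computed at `p`
in the preferred chart at `p`. -/
def formD (P : (V →L[ℝ] ℂ) →ₗ[ℂ] (V →L[ℝ] ℂ)) (η : FormField V X) : FormField V X :=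
  fun p => flatD P (localRep η p) (extChartAt 𝓘(ℝ, V) p p)

/-- The exterior derivative `d`. -/
def extd (η : FormField V X) : FormField V X := formD LinearMap.id η

/-- The operator `∂`. -/
def del (η : FormField V X) : FormField V X := formD proj10 η

/-- The operator `∂̄`. -/
def delbar (η : FormField V X) : FormField V X := formD proj01 η

/-- A form is smooth at `p` if its coefficients in the chart at `p` are. -/
def IsSmoothAt (η : FormField V X) (p : X) : Prop :=
  ∀ l : Module.Dual ℂ (FormAlg V),
    ContDiffAt ℝ ∞ (fun y => l (localRep η p y)) (extChartAt 𝓘(ℝ, V) p p)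

/-- A function, regarded as a form of degree zero. -/
def fn (g : X → ℂ) : FormField V X := fun x => algebraMap ℂ (FormAlg V) (g x)

/-! ## Chern connection, curvature and Chern form in a holomorphic frame -/

/-- The constant `i / 2π`. -/
def aleph : ℂ := Complex.I / (2 * (Real.pi : ℂ))

/-- The matrix `θ = G⁻¹ ∂G` of `(1,0)`-forms of the Chern connection in a holomorphic frame `e`
with Gram matrix `G k j = ⟨e_j, e_k⟩`: the Chern connection is `D e_j = ∑ i, θ i j ⊗ e_i`, i.e.
`D (∑ ξ_j e_j) = ∑ i, (dξ_i + ∑ j, θ i j ξ_j) e_i`. This `θ` is the unique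
matrix of `(1,0)`-forms such that `D` is compatible with the metric. -/
def connForm {r : ℕ} (G : X → Matrix (Fin r) (Fin r) ℂ) (i j : Fin r) : FormField V X :=
  fun x => ∑ l, ((G x)⁻¹ i l) • del (fn fun y => G y l j) x

/-- The matrix `Θ = dθ + θ ∧ θ` of the curvature `D²`. -/
def curvForm {r : ℕ} (G : X → Matrix (Fin r) (Fin r) ℂ) (i j : Fin r) : FormField V X :=
  extd (connForm G i j) + ∑ l, connForm G i l * connForm G l j

/-- The total Chern form `det (I + (i/2π) Θ)` in a holomorphic frame with Gram matrix `G`. The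
determinant is given by the Leibniz formula; its entries have even degree, hence commute. -/
def localChernForm {r : ℕ} (G : X → Matrix (Fin r) (Fin r) ℂ) : FormField V X :=
  fun x => ∑ τ : Equiv.Perm (Fin r), (Equiv.Perm.sign τ : ℤ) •
    (List.ofFn fun i => (if τ i = i then (1 : FormAlg V) else 0) +
      aleph • curvForm G (τ i) i x).prod

end Forms

/-! ## The exterior algebra of `T*X ⊕ E ⊕ E*` and the integral `∫_e` -/

section Berezin

variable (V : Type*) [NormedAddCommGroup V] [NormedSpace ℂ V] (m : ℕ)

/-- The fibre of `Λ(T*X ⊕ E ⊕ E*)`, where `E` and `E*` are trivialized by a frame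
`e_1, …, e_m` and its dual frame. -/
abbrev BigAlg := ExteriorAlgebra ℂ ((V →L[ℝ] ℂ) × (Fin m → ℂ) × (Fin m → ℂ))

variable {V m}

/-- The inclusion of the forms `Λ(T*X)` in `Λ(T*X ⊕ E ⊕ E*)`. -/
def incl : FormAlg V →ₐ[ℂ] BigAlg V m :=
  ExteriorAlgebra.map (LinearMap.inl ℂ (V →L[ℝ] ℂ) ((Fin m → ℂ) × (Fin m → ℂ)))

/-- The generator `e_j`. -/
def gen (j : Fin m) : BigAlg V m := ExteriorAlgebra.ι ℂ (0, Pi.single j 1, 0)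

/-- The generator `e_j^*`. -/
def genDual (j : Fin m) : BigAlg V m := ExteriorAlgebra.ι ℂ (0, 0, Pi.single j 1)

/-- The element `Ĩ = ∑ e_j ∧ e_j^*` corresponding to the identity of `E`. -/
def idTilde : BigAlg V m := ∑ j, gen j * genDual j

/-- Contraction with the covector that reads off the coefficient of `e_j`. -/
def contractGen (j : Fin m) : BigAlg V m →ₗ[ℂ] BigAlg V m :=
  CliffordAlgebra.contractLeft (Q := (0 : QuadraticForm ℂ _))
    (LinearMap.proj j ∘ₗ LinearMap.fst ℂ _ _ ∘ₗ LinearMap.snd ℂ (V →L[ℝ] ℂ) _)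

/-- Contraction with the covector that reads off the coefficient of `e_j^*`. -/
def contractGenDual (j : Fin m) : BigAlg V m →ₗ[ℂ] BigAlg V m :=
  CliffordAlgebra.contractLeft (Q := (0 : QuadraticForm ℂ _))
    (LinearMap.proj j ∘ₗ LinearMap.snd ℂ _ _ ∘ₗ LinearMap.snd ℂ (V →L[ℝ] ℂ) _)

/-- The integral `∫_e`: if `ω = ω' ∧ e_1 ∧ e_1^* ∧ ⋯ ∧ e_m ∧ e_m^* + ω''`, where `ω'` is a form and
`ω''` has lower degree in the `e_j, e_j^*`, then `∫_e ω = ω'`. It is obtained by contracting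
successively with all `e_j` and `e_j^*`, and then dropping the remaining terms (there are none)
which contain some `e_j` or `e_j^*`. -/
def berezin : BigAlg V m →ₗ[ℂ] FormAlg V :=
  (ExteriorAlgebra.map (LinearMap.fst ℂ (V →L[ℝ] ℂ) ((Fin m → ℂ) × (Fin m → ℂ)))).toLinearMap ∘ₗ
    ((List.finRange m).map fun j => contractGenDual j * contractGen j).prod

/-- The series `∑_{ℓ ≥ 0} x^ℓ / (ℓ + s)!` for nilpotent `x` (a finite sum); `s = 0` is the
exponential `e^x`. -/
def expSeries (s : ℕ) (x : BigAlg V m) : BigAlg V m :=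
  ∑ᶠ l : ℕ, ((Nat.factorial (l + s) : ℂ)⁻¹) • x ^ l

end Berezin

/-! ## Holomorphic Hermitian vector bundles -/

section Bundles

variable {V : Type*} [NormedAddCommGroup V] [NormedSpace ℂ V]
  {X : Type*} [TopologicalSpace X] [ChartedSpace V X]
  {F : Type*} [NormedAddCommGroup F] [NormedSpace ℂ F]
  {E : X → Type*} [TopologicalSpace (Bundle.TotalSpace F E)]
  [∀ x, AddCommGroup (E x)] [∀ x, Module ℂ (E x)] [∀ x, TopologicalSpace (E x)]
  [FiberBundle F E]

variable (F) in
/-- Holomorphic sections on the set `U`; `ω` means complex analytic. -/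
def IsHolomorphicOn (s : ∀ x, E x) (U : Set X) : Prop :=
  ContMDiffOn 𝓘(ℂ, V) (𝓘(ℂ, V).prod 𝓘(ℂ, F)) ω (fun x => Bundle.TotalSpace.mk' F x (s x)) U

variable (V F E) in
/-- A smooth Hermitian metric on the holomorphic vector bundle `E`. It is conjugate-linear in the
first and linear in the second slot: `inner x u v` is `⟨v, u⟩`. Smooth means that
`⟨s, t⟩` is smooth for all local holomorphic sections `s`, `t`. -/
structure HermitianMetric where
  inner : ∀ x, E x →ₗ⋆[ℂ] E x →ₗ[ℂ] ℂ
  conj_symm : ∀ x u v, starRingEnd ℂ (inner x u v) = inner x v u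
  pos : ∀ x u, u ≠ 0 → 0 < (inner x u u).re
  smooth : ∀ (U : Set X) (s t : ∀ x, E x), IsOpen U →
    IsHolomorphicOn (V := V) F s U → IsHolomorphicOn (V := V) F t U →
    ContMDiffOn 𝓘(ℝ, V) 𝓘(ℝ, ℂ) ∞ (fun x => inner x (s x) (t x)) U

/-- The Gram matrix of a frame, `G k j = ⟨e_j, e_k⟩`. -/
def gram (h : HermitianMetric V F E) {m : ℕ} (e : Fin m → ∀ x, E x) (x : X) :
    Matrix (Fin m) (Fin m) ℂ :=
  Matrix.of fun k j => h.inner x (e k x) (e j x)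

/-- The section `σ = f^* / |f|²` of `E*` over the complement of the zero set of `f`. -/
def dualSection (h : HermitianMetric V F E) (f : ∀ x, E x) (x : X) : E x →ₗ[ℂ] ℂ :=
  (h.inner x (f x) (f x))⁻¹ • h.inner x (f x)

theorem HermitianMetric.im_self (h : HermitianMetric V F E) (x : X) (u : E x) :
    (h.inner x u u).im = 0 :=
  Complex.conj_eq_iff_im.mp (h.conj_symm x u u)

theorem HermitianMetric.self_ne_zero (h : HermitianMetric V F E) {x : X} {u : E x} (hu : u ≠ 0) :
    h.inner x u u ≠ 0 := fun h0 => by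
  have := h.pos x u hu
  rw [h0] at this
  simp at this

/-- `σ · f = 1` where `f` does not vanish. -/
theorem dualSection_self (h : HermitianMetric V F E) (f : ∀ x, E x) {x : X} (hx : f x ≠ 0) :
    dualSection h f x (f x) = 1 := by
  simp [dualSection, inv_mul_cancel₀ (h.self_ne_zero hx)]

/-- `σ` has minimal norm among all `τ` with `τ · f = 1`. -/
theorem dualSection_minimal (h : HermitianMetric V F E) (f : ∀ x, E x) {x : X} (hx : f x ≠ 0)
    (τ : E x →ₗ[ℂ] ℂ) (hτ : τ (f x) = 1) (C : ℝ)
    (hC : ∀ ξ, ‖τ ξ‖ ^ 2 ≤ C * (h.inner x ξ ξ).re) (ξ : E x) :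
    ‖dualSection h f x ξ‖ ^ 2 ≤ C * (h.inner x ξ ξ).re := by
  set n : ℝ := (h.inner x (f x) (f x)).re with hn
  have hn0 : 0 < n := h.pos x _ hx
  have hff : h.inner x (f x) (f x) = (n : ℂ) :=
    Complex.ext (by simp [hn]) (by simp [h.im_self])
  set t : ℂ := h.inner x (f x) ξ with ht
  have htf : h.inner x ξ (f x) = starRingEnd ℂ t := (h.conj_symm x (f x) ξ).symm
  have hnn : ∀ u, 0 ≤ (h.inner x u u).re := fun u => by
    by_cases hu : u = 0
    · simp [hu]
    · exact (h.pos x u hu).le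
  have key : h.inner x ((n : ℂ) • ξ - t • f x) ((n : ℂ) • ξ - t • f x) =
      (n : ℂ) * (n * h.inner x ξ ξ - (starRingEnd ℂ t) * t) := by
    simp only [map_sub, LinearMap.sub_apply, map_smulₛₗ, LinearMap.smul_apply, smul_eq_mul, hff,
      htf, ← ht, Complex.conj_ofReal, RingHom.id_apply]
    ring
  have h1 := hnn ((n : ℂ) • ξ - t • f x)
  rw [key, mul_comm (starRingEnd ℂ t), Complex.mul_conj, Complex.normSq_eq_norm_sq] at h1
  have h2 : 0 ≤ n * (n * (h.inner x ξ ξ).re - ‖t‖ ^ 2) := by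
    simpa [Complex.mul_re, ← Complex.ofReal_pow] using h1
  have h3 : ‖t‖ ^ 2 ≤ n * (h.inner x ξ ξ).re := by
    have := nonneg_of_mul_nonneg_right h2 hn0
    linarith
  have h4 : 1 ≤ C * n := by simpa [hτ] using hC (f x)
  have h5 : ‖dualSection h f x ξ‖ ^ 2 = ‖t‖ ^ 2 / n ^ 2 := by
    simp [dualSection, hff, ← ht, mul_pow, div_eq_inv_mul]
  rw [h5, div_le_iff₀ (by positivity)]
  nlinarith [mul_nonneg (sub_nonneg.mpr h4) (mul_nonneg hn0.le (hnn ξ))]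

/-! ### The quotient bundle `Q = E / S` -/

/-- The fibre at `x` of `Q = E / S`, where `S` is spanned by `f`. -/
abbrev QuotFiber (f : ∀ x, E x) (x : X) : Type _ := E x ⧸ Submodule.span ℂ {f x}

/-- The orthogonal projection of `E x` on the orthogonal complement of `f x`. -/
def orthProj (h : HermitianMetric V F E) (f : ∀ x, E x) (x : X) : E x →ₗ[ℂ] E x :=
  LinearMap.id - (dualSection h f x).smulRight (f x)

theorem orthProj_self (h : HermitianMetric V F E) (f : ∀ x, E x) (x : X) :
    orthProj h f x (f x) = 0 := by
  by_cases hx : f x = 0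
  · simp [orthProj, hx]
  · simp [orthProj, dualSection_self h f hx]

/-- The isomorphism of `Q` with the orthogonal complement of `S`. -/
def orthLift (h : HermitianMetric V F E) (f : ∀ x, E x) (x : X) : QuotFiber f x →ₗ[ℂ] E x :=
  (Submodule.span ℂ {f x}).liftQ (orthProj h f x) (by
    rw [Submodule.span_singleton_le_iff_mem]
    exact orthProj_self h f x)

/-- The Gram matrix of a frame of `Q` with respect to the metric induced by the metric of `E`. -/
def quotGram (h : HermitianMetric V F E) (f : ∀ x, E x) {r : ℕ}
    (q : Fin r → ∀ x, QuotFiber f x) (x : X) : Matrix (Fin r) (Fin r) ℂ :=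
  Matrix.of fun k j => h.inner x (orthLift h f x (q k x)) (orthLift h f x (q j x))

variable (V F) in
/-- Holomorphic frames of `Q` over `U`: the sections form a basis at each point, and are locally
the images of holomorphic sections of `E`. -/
structure IsQuotFrameOn (f : ∀ x, E x) {r : ℕ} (q : Fin r → ∀ x, QuotFiber f x)
    (U : Set X) : Prop where
  linearIndependent : ∀ x ∈ U, LinearIndependent ℂ fun i => q i x
  generating : ∀ x ∈ U, ⊤ ≤ Submodule.span ℂ (Set.range fun i => q i x)
  holomorphic : ∀ x ∈ U, ∀ i, ∃ (W : Set X) (s : ∀ x, E x), IsOpen W ∧ x ∈ W ∧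
    IsHolomorphicOn (V := V) F s W ∧ ∀ y ∈ W ∩ U, q i y = Submodule.Quotient.mk (s y)

/-! ### The Chern forms of `E` and `Q` and the form `a` -/

variable [FiniteDimensional ℂ V]

/-- `c` is the Chern form of `E` with its Chern connection: it is given by
`det (I + (i/2π) Θ)` in every local holomorphic frame. -/
def IsChernForm (h : HermitianMetric V F E) (c : FormField V X) : Prop :=
  ∀ (m : ℕ) (U : Set X) (e : Fin m → ∀ x, E x), IsOpen U → IsLocalFrameOn 𝓘(ℂ, V) F ω e U →
    ∀ x ∈ U, c x = localChernForm (gram h e) x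

/-- `c` is the Chern form of `Q = E / S` with its Chern connection, over the complement of the zero
set of `f`: there `Q` has local holomorphic frames, and `c` is given by
`det (I + (i/2π) Θ)` in each of them. -/
def IsQuotChernForm (h : HermitianMetric V F E) (f : ∀ x, E x) (c : FormField V X) : Prop :=
  (∀ x, f x ≠ 0 → ∃ (r : ℕ) (U : Set X) (q : Fin r → ∀ x, QuotFiber f x),
    IsOpen U ∧ x ∈ U ∧ (∀ y ∈ U, f y ≠ 0) ∧ IsQuotFrameOn V F f q U) ∧
  ∀ (r : ℕ) (U : Set X) (q : Fin r → ∀ x, QuotFiber f x), IsOpen U → (∀ y ∈ U, f y ≠ 0) →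
    IsQuotFrameOn V F f q U → ∀ x ∈ U, c x = localChernForm (quotGram h f q) x

section Local

variable (h : HermitianMetric V F E) (f : ∀ x, E x) {m : ℕ} {U : Set X} {e : Fin m → ∀ x, E x}
  (he : IsLocalFrameOn 𝓘(ℂ, V) F ω e U)

/-- The element of `Λ(T*X ⊕ E ⊕ E*)` corresponding to `Df`, in the frame `e`:
`∑ j, (df_j + ∑ k, θ j k f_k) ∧ e_j`, where `f = ∑ f_j e_j`. -/
def covDerivTilde (x : X) : BigAlg V m :=
  ∑ j, incl (extd (fn fun y => he.coeff j y (f y)) x +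
    ∑ k, he.coeff k x (f x) • connForm (gram h e) j k x) * gen j

variable (e) in
/-- The element corresponding to `σ = ∑ σ_k e_k^*`, `σ_k = σ(e_k)`. -/
def sigmaTilde (x : X) : BigAlg V m :=
  ∑ k, dualSection h f x (e k x) • genDual k

variable (e) in
/-- The element corresponding to `∂̄σ = ∑ ∂̄σ_k ∧ e_k^*`. -/
def delbarSigmaTilde (x : X) : BigAlg V m :=
  ∑ k, incl (delbar (fn fun y => dualSection h f y (e k y)) x) * genDual k

variable (e) in
/-- The element `Θ̃ = ∑ Θ j k ∧ e_j ∧ e_k^*` corresponding to the curvature of `E`. -/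
def curvTilde (x : X) : BigAlg V m :=
  ∑ j, ∑ k, incl (curvForm (gram h e) j k x) * gen j * genDual k

/-- The form
`∫_e ℵ Df ∧ σ ∧ exp(Ĩ + ℵ Θ̃) ∧ ∑_{ℓ ≥ 0} (-ℵ Df ∧ ∂̄σ)^ℓ / (ℓ+1)!`, with `ℵ = i/2π`, computed in
the holomorphic frame `e`. -/
def localBerndtssonForm : FormField V X := fun x =>
  berezin ((aleph • covDerivTilde h f he x) * sigmaTilde h f e x *
    expSeries 0 (idTilde + aleph • curvTilde h e x) *
    expSeries 1 (-(aleph • (covDerivTilde h f he x * delbarSigmaTilde h f e x))))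

end Local

/-- `a` is the Berndtsson-type form over the complement of the zero set of `f`: it is given
by the explicit formula in every local holomorphic frame of `E`. -/
def IsBerndtssonForm (h : HermitianMetric V F E) (f : ∀ x, E x) (a : FormField V X) : Prop :=
  ∀ (m : ℕ) (U : Set X) (e : Fin m → ∀ x, E x), IsOpen U →
    ∀ he : IsLocalFrameOn 𝓘(ℂ, V) F ω e U,
      ∀ x ∈ U, f x ≠ 0 → a x = localBerndtssonForm h f he x

end Bundles

end PoincareLelong

end

open scoped Manifold ContDiff Bundle

noncomputable section

namespace PoincareLelong

/-! ## Supercommutative algebras -/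

section Super

/-! The form `a` is a transgression. Let θ be the Chern connection matrix of E in a holomorphic
frame, ξ = Df and η = ∂̄σ, and join D to D' = D - Df⊗σ by the connections with matrices θ_t = θ -
tξσ and curvatures Θ_t. Since σ·f = 1, D'f = 0. In a frame of E whose first element is f, the matrix
of D' thus has vanishing first column, and its remaining block is the Chern connection matrix of Q,
whose Gram matrix is the Schur complement of that of E (`sub_covD_mul_dualSec`). So det(I + ℵΘ_t)
runs from c(D_E) at t = 0 to c(D_Q) at t = 1.

The Bianchi identity and cyclicity of the trace (`chernWeil`) show that the t-derivative of det(I +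
ℵΘ_t) is -d tr(adj(I + ℵΘ_t) ℵξσ). Integration over [0, 1] exhibits c(D_E) - c(D_Q) as d of an
explicit form (`transgression_pencil`). The integrand simplifies: since dσ = η + σθ - σξσ, the
curvature Θ_t equals Θ + tξη up to a column times the row σ, and such a term does not affect σ·adj
(`row_mul_adjugate_add`). Hence Θ_t may be replaced by Θ + tξη (`deriv_berndtsson`).

What results is the Berezin integral in the definition of `a`. Indeed ∫_e exp(Ñ) = det N
(`berezin_exp`), and varying one entry of N gives ∫_e Ã exp(Ñ) = tr(adj N · A). Expanding in t and
integrating turns 1/ℓ! into 1/(ℓ+1)! (`berezin_tilde_mul_expSeries`).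

For ∂̄a = da, the components of `a` have bidegree (p+1, p) and those of the Chern forms (p, p), so
∂a has no counterpart in da = c(D_E) - c(D_Q). Bidegrees are detected by an automorphism `u` acting
as 2^(p-q) (`d_bernd_adapted`).

This much is algebra in a supercommutative algebra with odd derivations, applied to smooth forms on
open subsets of V. On X the operators are defined at each point in the preferred chart there. They
are compared with a fixed chart only on functions and one-forms (`represents_formD_fn`,
`represents_extd`), which suffices to express θ, Θ, Df and ∂̄σ; the derivatives of `a` are then
taken at chart centres. A holomorphic change of frame conjugates all matrices, so determinants and
traces do not change (`IsGauge.chern_eq`, `IsGauge.bernd_eq`). For c(D_Q) independence of the frame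
is a by-product: c(D_E) - da is global, and it agrees with the local Chern form in every frame of Q.
-/

/-- A supercommutative complex algebra, given by its parity automorphism. -/
class SuperCommAlgebra (A : Type*) [Ring A] [Algebra ℂ A] where
  parity : A →ₐ[ℂ] A
  parity_parity : ∀ x, parity (parity x) = x
  even_comm : ∀ x y, parity x = x → x * y = y * x
  odd_anticomm : ∀ x y, parity x = -x → parity y = -y → x * y = -(y * x)

open SuperCommAlgebra

/-! ### The exterior algebra as a supercommutative algebra. -/

section Ext

variable {M : Type*} [AddCommGroup M] [Module ℂ M]

theorem ext_ι_mul (v : M) (x : ExteriorAlgebra ℂ M) :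
    ExteriorAlgebra.ι ℂ v * x = CliffordAlgebra.involute x * ExteriorAlgebra.ι ℂ v := by
  induction x using ExteriorAlgebra.induction with
  | algebraMap r => rw [AlgHom.commutes]; exact (Algebra.commutes r _).symm
  | ι w =>
    rw [show CliffordAlgebra.involute (ExteriorAlgebra.ι ℂ w) = -ExteriorAlgebra.ι ℂ w from
      CliffordAlgebra.involute_ι w, neg_mul]
    exact eq_neg_of_add_eq_zero_left (ExteriorAlgebra.ι_add_mul_swap v w)
  | mul a b ha hb => rw [map_mul, ← mul_assoc, ha, mul_assoc, hb, mul_assoc]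
  | add a b ha hb => rw [mul_add, ha, hb, map_add, add_mul]

instance : SuperCommAlgebra (ExteriorAlgebra ℂ M) where
  parity := CliffordAlgebra.involute
  parity_parity x := CliffordAlgebra.involute_involute x
  even_comm x y hx := by
    induction y using ExteriorAlgebra.induction with
    | algebraMap r => exact (Algebra.commutes r _).symm
    | ι w => rw [ext_ι_mul, hx]
    | mul a b ha hb => rw [← mul_assoc, ha, mul_assoc, hb, mul_assoc]
    | add a b ha hb => rw [mul_add, ha, hb, add_mul]
  odd_anticomm x y hx hy := by
    -- The claim is stated for all `z`, with the sign recorded by the involution, because it is then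
    -- multiplicative in `z`; oddness of `y` is not inherited by its factors.
    have key : ∀ z : ExteriorAlgebra ℂ M, z * x = x * CliffordAlgebra.involute z := fun z => by
      induction z using ExteriorAlgebra.induction with
      | algebraMap r => rw [AlgHom.commutes]; exact Algebra.commutes r _
      | ι w =>
        rw [ext_ι_mul, hx, show CliffordAlgebra.involute (ExteriorAlgebra.ι ℂ w) =
          -ExteriorAlgebra.ι ℂ w from CliffordAlgebra.involute_ι w, neg_mul, mul_neg]
      | mul a b ha hb => rw [map_mul, mul_assoc, hb, ← mul_assoc, ha, mul_assoc]
      | add a b ha hb => rw [add_mul, ha, hb, map_add, mul_add]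
    rw [key y, hy, mul_neg, neg_neg]

theorem parity_ι (v : M) :
    parity (ExteriorAlgebra.ι ℂ v) = -ExteriorAlgebra.ι ℂ v :=
  CliffordAlgebra.involute_ι v

theorem parity_map {N : Type*} [AddCommGroup N] [Module ℂ N] (L : M →ₗ[ℂ] N)
    (x : ExteriorAlgebra ℂ M) :
    ExteriorAlgebra.map L (parity x) = parity (ExteriorAlgebra.map L x) := by
  induction x using ExteriorAlgebra.induction with
  | algebraMap r => simp only [AlgHom.commutes]
  | ι w => simp only [parity_ι, map_neg, ExteriorAlgebra.map_apply_ι]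
  | mul a b ha hb => simp only [map_mul, ha, hb]
  | add a b ha hb => simp only [map_add, ha, hb]

end Ext

variable (A : Type*) [Ring A] [Algebra ℂ A] [SuperCommAlgebra A]

/-- The commutative subalgebra of even elements. -/
def evenSub : Subalgebra ℂ A := AlgHom.equalizer parity (AlgHom.id ℂ A)

instance : CommRing (evenSub A) :=
  { (evenSub A).toRing with
    mul_comm := fun x y => Subtype.ext (even_comm x.1 y.1 x.2) }

variable {A}

theorem parity_coe (x : evenSub A) : parity (x : A) = x := x.2

/-- The projection to the even part. -/
def evenPart : A →ₗ[ℂ] evenSub A where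
  toFun x := ⟨(1 / 2 : ℂ) • (x + parity x), by
    change parity _ = _
    simp [parity_parity, add_comm]⟩
  map_add' x y := Subtype.ext (by simp only [map_add, Subalgebra.coe_add]; module)
  map_smul' c x := Subtype.ext (by
    simp only [map_smul, Subalgebra.coe_smul, RingHom.id_apply]; module)

theorem coe_evenPart {x : A} (hx : parity x = x) : (evenPart x : A) = x := by
  change (1 / 2 : ℂ) • (x + parity x) = x
  rw [hx]; module

theorem evenPart_coe (x : evenSub A) : evenPart (x : A) = x := Subtype.ext (coe_evenPart x.2)

/-- The extension of the parity automorphism to matrices. -/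
abbrev mpar {l n : Type*} (M : Matrix l n A) : Matrix l n A := M.map parity

/-- Matrices with even entries. -/
def MEven {l n : Type*} (M : Matrix l n A) : Prop := M.map parity = M

/-- Matrices with odd entries. -/
def MOdd {l n : Type*} (M : Matrix l n A) : Prop := M.map parity = -M

/-- The even parts of the entries of a matrix. -/
abbrev mev {l n : Type*} (M : Matrix l n A) : Matrix l n (evenSub A) := M.map evenPart

/-- A matrix of even elements as a matrix over `A`. -/
abbrev mco {l n : Type*} (M : Matrix l n (evenSub A)) : Matrix l n A := M.map (↑)

/-! ### Matrices with even or odd entries. -/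

section Mat

variable {l m n o : Type*}

theorem MEven.apply {M : Matrix l n A} (h : MEven M) (i : l) (j : n) :
    parity (M i j) = M i j := congrFun (congrFun h i) j

theorem MOdd.apply {M : Matrix l n A} (h : MOdd M) (i : l) (j : n) :
    parity (M i j) = -M i j := congrFun (congrFun h i) j

theorem mev_apply (M : Matrix l n A) (i : l) (j : n) : mev M i j = evenPart (M i j) := rfl

theorem mco_mev {M : Matrix l n A} (h : MEven M) : mco (mev M) = M := by
  ext i j; exact coe_evenPart (h.apply i j)

theorem mev_mco (M : Matrix l n (evenSub A)) : mev (mco M) = M := by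
  ext1 i j; exact evenPart_coe _

theorem mEven_mco (M : Matrix l n (evenSub A)) : MEven (mco M) := by
  ext i j; exact parity_coe _

theorem mco_injective : Function.Injective (mco : Matrix l n (evenSub A) → Matrix l n A) :=
  fun M N h => by rw [← mev_mco M, h, mev_mco]

theorem mco_mul [Fintype n] (M : Matrix l n (evenSub A)) (N : Matrix n o (evenSub A)) :
    mco (M * N) = mco M * mco N := Matrix.map_mul (f := (evenSub A).subtype)

theorem mco_add (M N : Matrix l n (evenSub A)) : mco (M + N) = mco M + mco N := by
  ext; simp

theorem mco_smul (c : ℂ) (M : Matrix l n (evenSub A)) : mco (c • M) = c • mco M := by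
  ext; simp

theorem mco_one [DecidableEq n] : mco (1 : Matrix n n (evenSub A)) = 1 :=
  Matrix.map_one _ rfl rfl

theorem mev_add (M N : Matrix l n A) : mev (M + N) = mev M + mev N := by
  ext1; simp

theorem mev_sub (M N : Matrix l n A) : mev (M - N) = mev M - mev N := by
  ext1; simp

theorem mev_smul (c : ℂ) (M : Matrix l n A) : mev (c • M) = c • mev M := by
  ext1; simp

theorem mev_one [DecidableEq n] : mev (1 : Matrix n n A) = 1 := by
  rw [← mco_one, mev_mco]

theorem MEven.mul [Fintype n] {M : Matrix l n A} {N : Matrix n o A} (hM : MEven M)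
    (hN : MEven N) : MEven (M * N) := by
  rw [MEven, Matrix.map_mul, hM, hN]

theorem MOdd.mul [Fintype n] {M : Matrix l n A} {N : Matrix n o A} (hM : MOdd M)
    (hN : MOdd N) : MEven (M * N) := by
  rw [MEven, Matrix.map_mul, hM, hN, Matrix.neg_mul, Matrix.mul_neg, neg_neg]

theorem MEven.mul_odd [Fintype n] {M : Matrix l n A} {N : Matrix n o A} (hM : MEven M)
    (hN : MOdd N) : MOdd (M * N) := by
  rw [MOdd, Matrix.map_mul, hM, hN, Matrix.mul_neg]

theorem MOdd.mul_even [Fintype n] {M : Matrix l n A} {N : Matrix n o A} (hM : MOdd M)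
    (hN : MEven N) : MOdd (M * N) := by
  rw [MOdd, Matrix.map_mul, hM, hN, Matrix.neg_mul]

theorem MEven.add {M N : Matrix l n A} (hM : MEven M) (hN : MEven N) : MEven (M + N) := by
  ext i j; simp [hM.apply, hN.apply]

theorem MEven.smul {M : Matrix l n A} (c : ℂ) (hM : MEven M) : MEven (c • M) := by
  ext i j; simp [hM.apply]

theorem MOdd.add {M N : Matrix l n A} (hM : MOdd M) (hN : MOdd N) : MOdd (M + N) := by
  ext i j; simp [hM.apply, hN.apply, add_comm]

theorem MOdd.sub {M N : Matrix l n A} (hM : MOdd M) (hN : MOdd N) : MOdd (M - N) := by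
  ext i j; simp [hM.apply, hN.apply]; abel

theorem MOdd.smul {M : Matrix l n A} (c : ℂ) (hM : MOdd M) : MOdd (c • M) := by
  ext i j; simp [hM.apply]

theorem mEven_one [DecidableEq n] : MEven (1 : Matrix n n A) :=
  Matrix.map_one _ (map_zero _) (map_one _)

theorem mev_mul [Fintype n] {M : Matrix l n A} {N : Matrix n o A} (hM : MEven M)
    (hN : MEven N) : mev (M * N) = mev M * mev N :=
  mco_injective (by rw [mco_mul, mco_mev hM, mco_mev hN, mco_mev (hM.mul hN)])

theorem trace_mul_comm_even [Fintype n] [Fintype l] {M : Matrix l n A} (hM : MEven M)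
    (N : Matrix n l A) : (M * N).trace = (N * M).trace := by
  simp only [Matrix.trace, Matrix.diag, Matrix.mul_apply]
  rw [Finset.sum_comm]
  exact Finset.sum_congr rfl fun i _ => Finset.sum_congr rfl fun j _ =>
    even_comm _ _ (hM.apply _ _)

/-- Each pair of odd entries anticommutes. The resulting sign is the one with which the connection
matrix moves around the trace in `chernWeil`. -/
theorem trace_mul_comm_odd [Fintype n] [Fintype l] {M : Matrix l n A} (hM : MOdd M)
    {N : Matrix n l A} (hN : MOdd N) : (M * N).trace = -(N * M).trace := by
  simp only [Matrix.trace, Matrix.diag, Matrix.mul_apply]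
  rw [Finset.sum_comm, ← Finset.sum_neg_distrib]
  refine Finset.sum_congr rfl fun i _ => ?_
  rw [← Finset.sum_neg_distrib]
  exact Finset.sum_congr rfl fun j _ => odd_anticomm _ _ (hM.apply _ _) (hN.apply _ _)

end Mat

/-! ### Determinants and the algebraic form of the integral `∫_e` -/

variable {n : Type*} [Fintype n] [DecidableEq n]

/-- The determinant of a matrix with even entries. -/
def detE (M : Matrix n n A) : A := ((mev M).det : A)

/-- The total Chern form attached to a curvature matrix. -/
def chern (Θ : Matrix n n A) : A := detE (1 + aleph • Θ)

/-- The integral over `[0, 1]` of a polynomial. -/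
def unitIntegral {R : Type*} [CommRing R] [Algebra ℂ R] : Polynomial R →ₗ[R] R :=
  Polynomial.lsum fun l => ((l + 1 : ℂ)⁻¹) • LinearMap.id

theorem unitIntegral_eq_sum {R : Type*} [CommRing R] [Algebra ℂ R] (p : Polynomial R) {N : ℕ}
    (h : p.natDegree < N) :
    unitIntegral p = ∑ l ∈ Finset.range N, ((l + 1 : ℂ)⁻¹) • p.coeff l := by
  simp only [unitIntegral, Polynomial.lsum_apply]
  rw [Polynomial.sum_over_range' _ _ N h]
  · rfl
  · intro; simp

theorem unitIntegral_C_mul {R : Type*} [CommRing R] [Algebra ℂ R] (r : R) (p : Polynomial R) :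
    unitIntegral (Polynomial.C r * p) = r * unitIntegral p := by
  rw [← Polynomial.smul_eq_C_mul, map_smul, smul_eq_mul]

theorem unitIntegral_map {R R' : Type*} [CommRing R] [Algebra ℂ R] [CommRing R'] [Algebra ℂ R']
    (φ : R →ₐ[ℂ] R') (p : Polynomial R) :
    unitIntegral (p.map (φ : R →+* R')) = φ (unitIntegral p) := by
  rw [unitIntegral_eq_sum p (Nat.lt_succ_self _),
    unitIntegral_eq_sum _ (Nat.lt_succ_of_le (Polynomial.natDegree_map_le))]
  simp

/-- The matrix `N + t B` with polynomial entries. -/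
def pencil {R : Type*} [CommRing R] (N B : Matrix n n R) : Matrix n n (Polynomial R) :=
  N.map Polynomial.C + (Polynomial.X : Polynomial R) • B.map Polynomial.C

/-- The matrix `∫_0^1 adj (N + t B) dt`. -/
def adjIntegral {R : Type*} [CommRing R] [Algebra ℂ R] (N B : Matrix n n R) : Matrix n n R :=
  (pencil N B).adjugate.map unitIntegral

/-- The value `tr (∫_0^1 adj (I + ℵΘ + tℵξη) dt · ℵξσ)` of the Berezin integral defining the
Berndtsson form. -/
def berndtsson (Θ : Matrix n n A) (ξ : Matrix n Unit A) (σ η : Matrix Unit n A) : A :=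
  (mco (adjIntegral (mev (1 + aleph • Θ)) (mev (aleph • (ξ * η)))) * (aleph • (ξ * σ))).trace

/-! ### Naturality -/

section Hom

variable {B : Type*} [Ring B] [Algebra ℂ B] [SuperCommAlgebra B] (φ : A →ₐ[ℂ] B)
  (hφ : ∀ x, φ (parity x) = parity (φ x))

include hφ in
theorem hom_mem_even (x : evenSub A) : φ x ∈ evenSub B := by
  change parity _ = _
  rw [← hφ, parity_coe]; rfl

/-- The map on even parts. -/
def evenMap : evenSub A →ₐ[ℂ] evenSub B :=
  (φ.comp (evenSub A).val).codRestrict (evenSub B) (hom_mem_even φ hφ)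

omit [Fintype n] [DecidableEq n] in
theorem mev_map (M : Matrix n n A) : mev (M.map φ) = (mev M).map (evenMap φ hφ) := by
  ext i j
  change (1 / 2 : ℂ) • (φ (M i j) + parity (φ (M i j))) =
    φ ((1 / 2 : ℂ) • (M i j + parity (M i j)))
  rw [← hφ, map_smul, map_add]

include hφ in
theorem detE_map (M : Matrix n n A) : detE (M.map φ) = φ (detE M) := by
  rw [detE, mev_map φ hφ, detE]
  exact congrArg Subtype.val (AlgHom.map_det (evenMap φ hφ) _).symm

omit [SuperCommAlgebra A] [Fintype n] [SuperCommAlgebra B] in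
theorem one_add_smul_map (c : ℂ) (M : Matrix n n A) :
    (1 + c • M.map φ) = (1 + c • M).map φ := by
  ext i j
  simp [Matrix.one_apply, apply_ite φ]

include hφ in
theorem chern_map (Θ : Matrix n n A) : chern (Θ.map φ) = φ (chern Θ) := by
  rw [chern, one_add_smul_map, detE_map φ hφ, chern]

theorem adjIntegral_map {R R' : Type*} [CommRing R] [Algebra ℂ R] [CommRing R'] [Algebra ℂ R']
    (ψ : R →ₐ[ℂ] R') (N B : Matrix n n R) :
    adjIntegral (N.map ψ) (B.map ψ) = (adjIntegral N B).map ψ := by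
  have h : pencil (N.map ψ) (B.map ψ) = (Polynomial.mapRingHom (ψ : R →+* R')).mapMatrix
      (pencil N B) := by
    ext1 i j
    simp [pencil]
  rw [adjIntegral, h, ← RingHom.map_adjugate]
  ext1 i j
  exact unitIntegral_map ψ _

-- Products, adjugates and the unit integral are polynomial in the entries, so they commute with
-- parity-preserving homomorphisms. This is applied to pullbacks by linear maps, to evaluation at a
-- point, and to the bidegree automorphism `u`.
include hφ in
theorem berndtsson_map (Θ : Matrix n n A) (ξ : Matrix n Unit A) (σ η : Matrix Unit n A) :
    berndtsson (Θ.map φ) (ξ.map φ) (σ.map φ) (η.map φ) = φ (berndtsson Θ ξ σ η) := by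
  have h1 : ∀ (v : Matrix n Unit A) (w : Matrix Unit n A),
      aleph • (v.map φ * w.map φ) = (aleph • (v * w)).map φ := fun v w => by
    rw [← Matrix.map_mul]; ext1; exact (map_smul φ _ _).symm
  rw [berndtsson, one_add_smul_map, h1, h1, mev_map φ hφ, mev_map φ hφ, adjIntegral_map]
  have h2 : ∀ W : Matrix n n (evenSub A), mco (W.map (evenMap φ hφ)) = (mco W).map φ :=
    fun W => rfl
  rw [h2, ← Matrix.map_mul, berndtsson, ← AddMonoidHom.map_trace]

end Hom

/-- The pencil involves ξ and η only through ξη, on which the two factors cancel; a single ξ remains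
in ξσ. This computes the weight of the Berndtsson form under `u`. -/
theorem berndtsson_scale (Θ : Matrix n n A) (ξ : Matrix n Unit A) (σ η : Matrix Unit n A)
    {c c' : ℂ} (h : c * c' = 1) :
    berndtsson Θ (c • ξ) σ (c' • η) = c • berndtsson Θ ξ σ η := by
  have h1 : aleph • (c • ξ * c' • η) = aleph • (ξ * η) := by
    rw [Matrix.smul_mul, Matrix.mul_smul, smul_smul c c', h, one_smul]
  rw [berndtsson, h1, berndtsson, Matrix.smul_mul, smul_comm aleph c, Matrix.mul_smul _ c,
    Matrix.trace_smul]

/-! ### Invariance under conjugation -/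

section Conj

/-- The adjugate reverses products, and the adjugate of an invertible matrix is its determinant
times its inverse; the determinants of `g` and `k` cancel. -/
theorem adjugate_conj {R : Type*} [CommRing R] {g k : Matrix n n R} (h : k * g = 1)
    (N : Matrix n n R) : (k * N * g).adjugate = k * N.adjugate * g := by
  have hg : g.adjugate = g.det • k := by
    have : k * (g * g.adjugate) = g.adjugate := by rw [← mul_assoc, h, one_mul]
    rw [← this, Matrix.mul_adjugate, Matrix.mul_smul, mul_one]
  have hk : k.adjugate = k.det • g := by
    have : (k.adjugate * k) * g = k.adjugate := by rw [mul_assoc, h, mul_one]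
    rw [← this, Matrix.adjugate_mul, Matrix.smul_mul, one_mul]
  have hd : g.det * k.det = 1 := by rw [mul_comm, ← Matrix.det_mul, h, Matrix.det_one]
  rw [Matrix.adjugate_mul_distrib, Matrix.adjugate_mul_distrib, hg, hk, Matrix.smul_mul,
    Matrix.mul_smul, Matrix.mul_smul, smul_smul, hd, one_smul, mul_assoc]

theorem adjIntegral_conj {R : Type*} [CommRing R] [Algebra ℂ R] {g k : Matrix n n R}
    (h : k * g = 1) (N B : Matrix n n R) :
    adjIntegral (k * N * g) (k * B * g) = k * adjIntegral N B * g := by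
  have h1 : pencil (k * N * g) (k * B * g) =
      k.map Polynomial.C * pencil N B * g.map Polynomial.C := by
    simp only [pencil, Matrix.map_mul, Matrix.mul_add, Matrix.add_mul, Matrix.mul_smul,
      Matrix.smul_mul]
  have h2 : k.map Polynomial.C * g.map Polynomial.C = (1 : Matrix n n (Polynomial R)) := by
    rw [← Matrix.map_mul, h, Matrix.map_one _ (map_zero _) (map_one _)]
  rw [adjIntegral, h1, adjugate_conj h2]
  ext1 i j
  simp only [adjIntegral, Matrix.map_apply, Matrix.mul_apply, Finset.sum_mul, map_sum]
  refine Finset.sum_congr rfl fun a _ => Finset.sum_congr rfl fun b _ => ?_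
  rw [mul_assoc, unitIntegral_C_mul, mul_comm _ (Polynomial.C _), unitIntegral_C_mul]
  ring

variable {g k : Matrix n n A} (hg : MEven g) (hk : MEven k) (h : k * g = 1)

include hg hk h

theorem mev_mul_eq_one : mev k * mev g = 1 := by
  rw [← mev_mul hk hg, h, mev_one]

omit [SuperCommAlgebra A] hg hk in
theorem one_add_conj (c : ℂ) (Θ : Matrix n n A) :
    1 + c • (k * Θ * g) = k * (1 + c • Θ) * g := by
  rw [Matrix.mul_add, Matrix.add_mul, Matrix.mul_one, h, Matrix.mul_smul, Matrix.smul_mul]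

theorem chern_conj {Θ : Matrix n n A} (hΘ : MEven Θ) : chern (k * Θ * g) = chern Θ := by
  have hN : MEven (1 + aleph • Θ) := mEven_one.add (hΘ.smul _)
  rw [chern, one_add_conj h, detE, mev_mul (hk.mul hN) hg, mev_mul hk hN, Matrix.det_mul,
    Matrix.det_mul, mul_right_comm, ← Matrix.det_mul, mev_mul_eq_one hg hk h, Matrix.det_one,
    one_mul]
  rfl

theorem berndtsson_conj {Θ : Matrix n n A} (hΘ : MEven Θ) {ξ : Matrix n Unit A} (hξ : MOdd ξ)
    {σ η : Matrix Unit n A} (hη : MOdd η) :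
    berndtsson (k * Θ * g) (k * ξ) (σ * g) (η * g) = berndtsson Θ ξ σ η := by
  have hN : MEven (1 + aleph • Θ) := mEven_one.add (hΘ.smul _)
  have hB : MEven (aleph • (ξ * η)) := (hξ.mul hη).smul _
  have h1 : ∀ w : Matrix Unit n A, aleph • (k * ξ * (w * g)) = k * (aleph • (ξ * w)) * g :=
    fun w => by rw [Matrix.mul_smul, Matrix.smul_mul]; simp only [Matrix.mul_assoc]
  -- One-sided inverses are two-sided over the commutative even subalgebra, and the relation is
  -- carried back to `A`.
  have hgk : g * k = 1 := by
    have := congrArg mco (mul_eq_one_comm.mp (mev_mul_eq_one hg hk h))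
    rwa [mco_mul, mco_mev hg, mco_mev hk, mco_one] at this
  rw [berndtsson, one_add_conj h, h1, h1, mev_mul (hk.mul hN) hg, mev_mul hk hN,
    mev_mul (hk.mul hB) hg, mev_mul hk hB, adjIntegral_conj (mev_mul_eq_one hg hk h), mco_mul,
    mco_mul, mco_mev hg, mco_mev hk, berndtsson]
  set W := mco (adjIntegral (mev (1 + aleph • Θ)) (mev (aleph • (ξ * η))))
  set Y := aleph • (ξ * σ)
  rw [show k * W * g * (k * Y * g) = k * (W * (g * k) * Y * g) by simp only [Matrix.mul_assoc],
    hgk, trace_mul_comm_even hk, Matrix.mul_assoc, hgk, Matrix.mul_one, Matrix.mul_one]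

end Conj

end Super

/-! ## Odd derivations and Chern–Weil theory -/

section DGA

open SuperCommAlgebra

/-- An odd derivation of a supercommutative algebra. -/
structure SuperDeriv (A : Type*) [Ring A] [Algebra ℂ A] [SuperCommAlgebra A] where
  toLin : A →ₗ[ℂ] A
  leibniz : ∀ x y, toLin (x * y) = toLin x * y + parity x * toLin y
  map_parity : ∀ x, toLin (parity x) = -parity (toLin x)

variable {A : Type*} [Ring A] [Algebra ℂ A] [SuperCommAlgebra A]

instance : CoeFun (SuperDeriv A) fun _ => A → A := ⟨fun D => D.toLin⟩

variable (D : SuperDeriv A) {l m n o : Type*}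

/-- Application of an odd derivation to the entries of a matrix. -/
abbrev mD (M : Matrix l n A) : Matrix l n A := M.map D

theorem mD_apply (M : Matrix l n A) (i : l) (j : n) : mD D M i j = D (M i j) := rfl

theorem mD_mul [Fintype n] (M : Matrix l n A) (N : Matrix n o A) :
    mD D (M * N) = mD D M * N + mpar M * mD D N := by
  ext i j
  simp [Matrix.mul_apply, D.leibniz, Finset.sum_add_distrib]

theorem mD_mul_even [Fintype n] {M : Matrix l n A} (hM : MEven M) (N : Matrix n o A) :
    mD D (M * N) = mD D M * N + M * mD D N := by
  rw [mD_mul, mpar, hM]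

theorem mD_mul_odd [Fintype n] {M : Matrix l n A} (hM : MOdd M) (N : Matrix n o A) :
    mD D (M * N) = mD D M * N - M * mD D N := by
  rw [mD_mul, mpar, hM, Matrix.neg_mul, sub_eq_add_neg]

theorem mD_add (M N : Matrix l n A) : mD D (M + N) = mD D M + mD D N := by
  ext; simp

theorem mD_sub (M N : Matrix l n A) : mD D (M - N) = mD D M - mD D N := by
  ext; simp

theorem mD_smul (c : ℂ) (M : Matrix l n A) : mD D (c • M) = c • mD D M := by
  ext; simp

theorem SuperDeriv.map_one : D 1 = 0 := by
  have h := D.leibniz 1 1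
  rw [mul_one, mul_one, _root_.map_one (parity : A →ₐ[ℂ] A), one_mul] at h
  exact left_eq_add.mp h

theorem mD_one [DecidableEq n] : mD D (1 : Matrix n n A) = 0 := by
  ext i j
  by_cases h : i = j <;> simp [h, D.map_one]

variable {D}

theorem MEven.mD {M : Matrix l n A} (hM : MEven M) : MOdd (mD D M) := by
  ext i j
  have := D.map_parity (M i j)
  rw [hM.apply] at this
  exact eq_neg_iff_add_eq_zero.mpr (by rw [add_comm]; exact eq_neg_iff_add_eq_zero.mp this)

theorem MOdd.mD {M : Matrix l n A} (hM : MOdd M) : MEven (mD D M) := by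
  ext i j
  have := D.map_parity (M i j)
  rw [hM.apply, map_neg, neg_inj] at this
  simp [← this]

-- Differentiate `M * N = 1` and multiply by `M` on the right; no sign appears since `M` is even.
variable (D) in
theorem mD_inv [Fintype n] [DecidableEq n] {M N : Matrix n n A} (hM : MEven M)
    (h : M * N = 1) (h' : N * M = 1) :
    mD D M = -(M * mD D N * M) := by
  have h1 := congrArg (PoincareLelong.mD D) h
  rw [mD_one, mD_mul_even D hM] at h1
  have h2 := congrArg (· * M) (eq_neg_of_add_eq_zero_left h1)
  simpa [Matrix.mul_assoc, h'] using h2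

variable (D) in
/-- The restriction of an odd derivation to the even part. -/
def evenDeriv : Derivation ℂ (evenSub A) A :=
  Derivation.mk' (D.toLin ∘ₗ (evenSub A).val.toLinearMap) fun a b => by
    change D ((a : A) * b) = (a : A) * D b + (b : A) * D a
    rw [D.leibniz, parity_coe, even_comm (b : A) _ b.2, add_comm]

/-! ### The derivative of a determinant -/

/-- Jacobi's formula. Values in a module allow both uses: the formal derivative in t, and
`evenDeriv`, which maps the even subalgebra to `A`. -/
theorem derivation_det {S R M : Type*} [CommSemiring S] [CommRing R] [Algebra S R]
    [AddCommGroup M] [Module R M] [Module S M] [Fintype n] [DecidableEq n] (d : Derivation S R M)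
    (N : Matrix n n R) :
    d N.det = ∑ i, ∑ j, N.adjugate i j • d (N j i) := by
  have hprod : ∀ (s : Finset n) (f : n → R),
      d (∏ i ∈ s, f i) = ∑ i ∈ s, (∏ k ∈ s.erase i, f k) • d (f i) := by
    intro s f
    induction s using Finset.induction_on with
    | empty => simp
    | insert a s ha ih =>
      rw [Finset.prod_insert ha, d.leibniz, ih, Finset.sum_insert ha, Finset.erase_insert ha,
        add_comm, Finset.smul_sum]
      refine congrArg _ (Finset.sum_congr rfl fun i hi => ?_)
      have hai : a ≠ i := fun h => ha (h ▸ hi)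
      rw [Finset.erase_insert_of_ne hai, Finset.prod_insert (by simp [ha]), smul_smul]
  -- The adjugate entry is the determinant with row `j` replaced by the `i`-th unit vector; in the
  -- Leibniz term of `τ` only `j = τ i` survives.
  have hadj : ∀ i, ∑ j, N.adjugate i j • d (N j i) = ∑ τ : Equiv.Perm n,
      (Equiv.Perm.sign τ : ℤ) • (∏ k ∈ Finset.univ.erase i, N (τ k) k) • d (N (τ i) i) := by
    intro i
    simp only [Matrix.adjugate_apply, Matrix.det_apply, Finset.sum_smul]
    rw [Finset.sum_comm]
    refine Finset.sum_congr rfl fun τ _ => ?_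
    rw [Finset.sum_eq_single (τ i)]
    · rw [Units.smul_def, smul_assoc, ← Finset.mul_prod_erase _ _ (Finset.mem_univ i)]
      simp only [Matrix.updateRow_self, Pi.single_eq_same, one_mul]
      congr 2
      refine Finset.prod_congr rfl fun k hk => ?_
      rw [Matrix.updateRow_ne (fun h => (Finset.ne_of_mem_erase hk) (τ.injective h))]
    · intro j _ hj
      rw [Finset.prod_eq_zero (Finset.mem_univ (τ.symm j)), smul_zero, zero_smul]
      rw [Equiv.apply_symm_apply, Matrix.updateRow_self, Pi.single_eq_of_ne]
      rintro rfl
      simp at hj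
    · simp
  simp only [hadj]
  rw [Finset.sum_comm, Matrix.det_apply, map_sum]
  refine Finset.sum_congr rfl fun τ _ => ?_
  rw [Units.smul_def, map_zsmul, hprod, Finset.smul_sum]

/-- By Cramer's rule the `j`-th entry of `s * M.adjugate` is the determinant of `M` with row `j`
replaced by `s`. Once `s` is itself a row, adding multiples of `s` to the other rows changes
nothing. -/
theorem row_mul_adjugate_add {R : Type*} [CommRing R] [Fintype n] [DecidableEq n]
    (N : Matrix n n R) (v : Matrix n Unit R) (s : Matrix Unit n R) :
    s * (N + v * s).adjugate = s * N.adjugate := by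
  have key : ∀ (M : Matrix n n R) (j : n),
      (s * M.adjugate) () j = (M.updateRow j (s ())).det := by
    intro M j
    rw [← Matrix.cramer_transpose_apply, Matrix.cramer_eq_adjugate_mulVec,
      ← Matrix.adjugate_transpose, Matrix.mulVec_transpose, Matrix.mul_apply]
    rfl
  ext u j
  rw [key, key]
  refine Matrix.det_eq_of_forall_row_eq_smul_add_const (fun i => if i = j then 0 else v i ()) j
    (by simp) fun i k => ?_
  by_cases h : i = j
  · subst h; simp
  · simp [h, Matrix.mul_apply]

/-- A linear functional turns the hypothesis into a complex polynomial vanishing everywhere.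
Identities known for every complex t can thus be read off coefficient by coefficient in any vector
space. -/
theorem eq_zero_of_forall_sum_pow_smul {M : Type*} [AddCommGroup M] [Module ℂ M] (v : ℕ → M)
    (N : ℕ) (h : ∀ t : ℂ, ∑ k ∈ Finset.range N, t ^ k • v k = 0) : ∀ k < N, v k = 0 := by
  intro k hk
  refine (Module.forall_dual_apply_eq_zero_iff ℂ (v k)).mp fun φ => ?_
  have hp : ∑ i ∈ Finset.range N, Polynomial.C (φ (v i)) * Polynomial.X ^ i = 0 := by
    refine Polynomial.funext fun t => ?_
    have := congrArg φ (h t)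
    simp only [map_sum, map_smul, smul_eq_mul, map_zero] at this
    simp only [Polynomial.eval_finsetSum, Polynomial.eval_mul, Polynomial.eval_C,
      Polynomial.eval_pow, Polynomial.eval_X, Polynomial.eval_zero, ← this]
    exact Finset.sum_congr rfl fun i _ => mul_comm _ _
  have := congrArg (fun p => Polynomial.coeff p k) hp
  simpa [Polynomial.finsetSum_coeff, Polynomial.coeff_C_mul, Polynomial.coeff_X_pow, hk] using this

open Polynomial in
/-- The matrix `N - t K + t² L` with polynomial entries. -/
def quadPencil {R : Type*} [CommRing R] (N K L : Matrix n n R) : Matrix n n R[X] :=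
  N.map C - (X : R[X]) • K.map C + (X ^ 2 : R[X]) • L.map C

-- Apart from `N` and `B`, every term of the quadratic pencil is a column times `s`, so over the
-- polynomial ring `row_mul_adjugate_add` reduces it to the linear pencil N + tB.
open Polynomial in
theorem row_mul_adjugate_quadPencil {R : Type*} [CommRing R] [Algebra ℂ R] [Fintype n]
    [DecidableEq n] (N B : Matrix n n R) (w₁ w₂ : Matrix n Unit R) (s : Matrix Unit n R) :
    s * (quadPencil N (w₁ * s - B) (w₂ * s)).adjugate.map unitIntegral =
      s * adjIntegral N B := by
  have h1 : quadPencil N (w₁ * s - B) (w₂ * s) =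
      pencil N B + ((X ^ 2 : R[X]) • w₂.map C - (X : R[X]) • w₁.map C) * s.map C := by
    ext1 i j
    simp only [quadPencil, pencil, Matrix.map_apply, Matrix.add_apply, Matrix.sub_apply,
      Matrix.smul_apply, Matrix.mul_apply, Finset.univ_unique, Finset.sum_singleton, smul_eq_mul,
      map_sub, map_mul]
    ring
  have h2 : ∀ W : Matrix n n R[X], s * W.map unitIntegral =
      (s.map C * W).map unitIntegral := fun W => by
    ext1 i j
    simp [Matrix.mul_apply, unitIntegral_C_mul]
  rw [h2, h1, row_mul_adjugate_add, ← h2, adjIntegral]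

theorem exists_natDegree_lt {R : Type*} [CommRing R] [Fintype n]
    (W : Matrix n n (Polynomial R)) : ∃ N : ℕ, ∀ i j, (W i j).natDegree < N := by
  refine ⟨(Finset.univ.sup fun i => Finset.univ.sup fun j => (W i j).natDegree) + 1,
    fun i j => Nat.lt_succ_of_le ?_⟩
  have h1 := Finset.le_sup (f := fun j => (W i j).natDegree) (Finset.mem_univ j)
  have h2 := Finset.le_sup (f := fun i => Finset.univ.sup fun j => (W i j).natDegree)
    (Finset.mem_univ i)
  exact h1.trans h2

theorem eval_algebraMap_eq_sum {R : Type*} [CommRing R] [Algebra ℂ R] (t : ℂ) {N : ℕ}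
    {p : Polynomial R} (hp : p.natDegree < N) :
    p.eval (algebraMap ℂ R t) = ∑ k ∈ Finset.range N, t ^ k • p.coeff k := by
  rw [Polynomial.eval_eq_sum_range' hp]
  refine Finset.sum_congr rfl fun k _ => ?_
  rw [← map_pow, mul_comm, ← Algebra.smul_def]

/-- Evaluation at a scalar and integration over the unit interval are both weighted sums of
coefficients; this form serves for both. -/
theorem trace_mco_map [Fintype n] {W : Matrix n n (Polynomial (evenSub A))} {N : ℕ}
    (hW : ∀ i j, (W i j).natDegree < N) (a : Matrix n n A) (c : ℕ → ℂ)
    (φ : Polynomial (evenSub A) → evenSub A)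
    (h : ∀ p : Polynomial (evenSub A), p.natDegree < N →
      φ p = ∑ k ∈ Finset.range N, c k • p.coeff k) :
    (mco (W.map φ) * a).trace =
      ∑ k ∈ Finset.range N, c k • (mco (W.map (Polynomial.coeff · k)) * a).trace := by
  have h1 : W.map φ = ∑ k ∈ Finset.range N, c k • W.map (Polynomial.coeff · k) := by
    ext1 i j
    rw [Matrix.map_apply, h _ (hW i j), Matrix.sum_apply]
    rfl
  rw [h1]
  simp only [← Matrix.trace_smul, ← Matrix.smul_mul, ← mco_smul]
  rw [← Matrix.trace_sum, ← Finset.sum_mul]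
  congr 2
  ext i j
  simp [Matrix.sum_apply]

/-! ### Transgression -/

variable [Fintype n] [DecidableEq n]

variable (D) in
/-- The curvature `dθ + θ ∧ θ`. -/
def curv (θ : Matrix n n A) : Matrix n n A := mD D θ + θ * θ

omit [DecidableEq n] in
theorem MOdd.curv {θ : Matrix n n A} (hθ : MOdd θ) : MEven (curv D θ) := hθ.mD.add (hθ.mul hθ)

variable (hD : ∀ x, D (D x) = 0)

include hD

omit [Fintype n] [DecidableEq n] in
theorem mD_mD (M : Matrix l n A) : mD D (mD D M) = 0 := by
  ext i j; exact hD _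

-- Since d² = 0, dΘ = dθ·θ - θ·dθ, and the cubic terms θ³ cancel in the commutator on the right.
omit [DecidableEq n] in
theorem bianchi {θ : Matrix n n A} (hθ : MOdd θ) :
    mD D (curv D θ) = curv D θ * θ - θ * curv D θ := by
  rw [curv, mD_add, mD_mD hD, mD_mul_odd D hθ]
  noncomm_ring

/-- Write the adjugate of N = I + ℵΘ as det N times N⁻¹. By the Bianchi identity dN and dN⁻¹ are
commutators with θ; so det N is closed, and under the trace d acts on the odd matrix `a` as the
covariant derivative da + θa + aθ. The hypothesis `hu` serves to form N⁻¹. -/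
theorem chernWeil {θ a : Matrix n n A} (hθ : MOdd θ) (ha : MOdd a)
    (hu : IsUnit (mev (1 + aleph • curv D θ)).det) :
    D (mco (mev (1 + aleph • curv D θ)).adjugate * (aleph • a)).trace =
      (mco (mev (1 + aleph • curv D θ)).adjugate *
        (aleph • (mD D a + θ * a + a * θ))).trace := by
  set N := 1 + aleph • curv D θ with hN
  have hNe : MEven N := mEven_one.add (hθ.curv.smul _)
  set P := mco (mev N)⁻¹ with hP
  have hPe : MEven P := mEven_mco _
  have hPN : P * N = 1 := by
    rw [hP, ← mco_mev hNe, mev_mco, ← mco_mul, Matrix.nonsing_inv_mul _ hu, mco_one]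
  have hNP : N * P = 1 := by
    rw [hP, ← mco_mev hNe, mev_mco, ← mco_mul, Matrix.mul_nonsing_inv _ hu, mco_one]
  have hDN : mD D N = N * θ - θ * N := by
    rw [hN, mD_add, mD_one, mD_smul, bianchi hD hθ, add_mul, mul_add, one_mul, mul_one, zero_add,
      smul_mul_assoc, mul_smul_comm, add_sub_add_left_eq_sub, smul_sub]
  have hDP : mD D P = P * θ - θ * P := by
    rw [mD_inv D hPe hPN hNP, hDN, Matrix.mul_sub, Matrix.sub_mul, ← Matrix.mul_assoc P N, hPN,
      Matrix.one_mul, Matrix.mul_assoc P (θ * N), Matrix.mul_assoc θ, hNP, Matrix.mul_one, neg_sub]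
  have hadj : mco (mev N).adjugate = (detE N) • P := by
    have h1 : (mev N).adjugate = (mev N).det • (mev N)⁻¹ := by
      rw [← Matrix.one_mul (mev N)⁻¹, ← Matrix.smul_mul, ← Matrix.adjugate_mul, Matrix.mul_assoc,
        Matrix.mul_nonsing_inv _ hu, Matrix.mul_one]
    rw [h1]
    rfl
  have hDdet : D (detE N) = 0 := by
    have h1 : D (detE N) = (mco (mev N).adjugate * mD D N).trace := by
      rw [show mD D N = mD D (mco (mev N)) by rw [mco_mev hNe]]
      refine (derivation_det (evenDeriv D) (mev N)).trans ?_
      simp only [Matrix.trace, Matrix.diag, Matrix.mul_apply]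
      rfl
    rw [h1, hadj, Matrix.smul_mul, Matrix.trace_smul, hDN, Matrix.mul_sub, Matrix.trace_sub,
      ← Matrix.mul_assoc, hPN, trace_mul_comm_even hPe, Matrix.mul_assoc, hNP, Matrix.one_mul,
      Matrix.mul_one, sub_self, smul_zero]
  have hDtr : ∀ M : Matrix n n A, D M.trace = (mD D M).trace := fun M => by
    simp [Matrix.trace]
  have hdet : parity (detE N) = detE N := parity_coe _
  -- This sign converts the term -θPa coming from dN⁻¹ into +Paθ under the trace.
  have hodd : (θ * (P * a)).trace = -(P * (a * θ)).trace := by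
    rw [trace_mul_comm_odd hθ (hPe.mul_odd ha), Matrix.mul_assoc]
  rw [hadj, Matrix.smul_mul, Matrix.trace_smul, smul_eq_mul, D.leibniz, hDdet, zero_mul, zero_add,
    hdet, Matrix.smul_mul, Matrix.trace_smul, smul_eq_mul, hDtr, mD_mul_even D hPe, hDP, mD_smul,
    Matrix.mul_smul, Matrix.mul_smul, Matrix.mul_smul, ← smul_add, Matrix.trace_smul,
    Matrix.trace_smul, Matrix.sub_mul, Matrix.trace_add, Matrix.trace_sub, Matrix.mul_assoc θ, hodd,
    Matrix.mul_add, Matrix.mul_add, Matrix.trace_add, Matrix.trace_add, Matrix.mul_assoc P θ]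
  congr 2
  abel

/-- The curvature of θ - ta is polynomial in t, and `M` is the corresponding polynomial matrix. For
each complex t, `chernWeil` identifies d tr(adj M(t) ℵa) with minus the t-derivative of det M(t).
Integrating over [0, 1] leaves the values at the endpoints; the integration is carried out on
coefficients. -/
theorem transgression_pencil {θ a : Matrix n n A} (hθ : MOdd θ) (ha : MOdd a)
    (hu : ∀ t : ℂ, IsUnit (mev (1 + aleph • curv D (θ - t • a))).det)
    {M : Matrix n n (Polynomial (evenSub A))}
    (hM : M = quadPencil (mev (1 + aleph • curv D θ))
      (mev (aleph • (mD D a + θ * a + a * θ))) (mev (aleph • (a * a)))) :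
    D (mco (M.adjugate.map unitIntegral) * (aleph • a)).trace =
      chern (curv D θ) - chern (curv D (θ - a)) := by
  set τ : ℂ →+* evenSub A := algebraMap ℂ (evenSub A)
  have hKe : MEven (mD D a + θ * a + a * θ) := (ha.mD.add (hθ.mul ha)).add (ha.mul hθ)
  have hcurv : ∀ t : ℂ, curv D (θ - t • a) =
      curv D θ - t • (mD D a + θ * a + a * θ) + (t ^ 2) • (a * a) := fun t => by
    simp only [curv, mD_sub, mD_smul, Matrix.sub_mul, Matrix.mul_sub, Matrix.smul_mul,
      Matrix.mul_smul, smul_add, smul_sub, pow_two, mul_smul]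
    abel
  have hsm : ∀ (t : ℂ) (x : evenSub A), τ t * x = t • x := fun t x => (Algebra.smul_def t x).symm
  have hMt : ∀ t : ℂ, M.map (Polynomial.eval (τ t)) =
      mev (1 + aleph • curv D (θ - t • a)) := fun t => by
    rw [hM, hcurv, quadPencil]
    ext1 i j
    simp only [Matrix.map_apply, Matrix.add_apply, Matrix.sub_apply, Matrix.smul_apply,
      Polynomial.eval_add, Polynomial.eval_sub, Polynomial.eval_mul, Polynomial.eval_C,
      Polynomial.eval_X, Polynomial.eval_pow, smul_eq_mul, ← map_pow, hsm, map_add, map_sub,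
      map_smul, smul_add, smul_sub, smul_comm aleph]
    abel
  have hadjt : ∀ t : ℂ, M.adjugate.map (Polynomial.eval (τ t)) =
      (mev (1 + aleph • curv D (θ - t • a))).adjugate := fun t => by
    rw [← hMt]
    exact RingHom.map_adjugate (Polynomial.evalRingHom (τ t)) M
  have hdett : ∀ t : ℂ, ((M.det.eval (τ t) : evenSub A) : A) = chern (curv D (θ - t • a)) :=
    fun t => by
      rw [chern, detE, ← hMt]
      exact congrArg Subtype.val (RingHom.map_det (Polynomial.evalRingHom (τ t)) M)
  -- Jacobi's formula in the variable t: the t-derivative of the entries of `M` is -ℵ times the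
  -- covariant derivative of `a` for the connection θ - ta.
  have hder : ∀ t : ℂ, ((M.det.derivative.eval (τ t) : evenSub A) : A) =
      -(mco (mev (1 + aleph • curv D (θ - t • a))).adjugate *
        (aleph • (mD D a + (θ - t • a) * a + a * (θ - t • a)))).trace := fun t => by
    set K := mD D a + (θ - t • a) * a + a * (θ - t • a)
    have hθt : MOdd (θ - t • a) := hθ.sub (ha.smul t)
    have hK : MEven (aleph • K) := ((ha.mD.add (hθt.mul ha)).add (ha.mul hθt)).smul _
    have h1 : ∀ i j, (M i j).derivative.eval (τ t) = -mev (aleph • K) i j := fun i j => by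
      have h2 : K = (mD D a + θ * a + a * θ) - (2 * t) • (a * a) := by
        simp only [K, Matrix.sub_mul, Matrix.mul_sub, Matrix.smul_mul, Matrix.mul_smul, two_mul,
          add_smul]
        abel
      have h3 : (2 : evenSub A) * τ t = τ (2 * t) := by rw [map_mul, map_ofNat]
      rw [hM, h2, smul_sub, mev_sub, quadPencil]
      simp only [Matrix.map_apply, Matrix.add_apply, Matrix.sub_apply, Matrix.smul_apply,
        smul_eq_mul, Polynomial.derivative_add, Polynomial.derivative_sub,
        Polynomial.derivative_mul, Polynomial.derivative_C, Polynomial.derivative_X,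
        Polynomial.derivative_X_pow, Polynomial.eval_add, Polynomial.eval_neg,
        Polynomial.eval_mul, Polynomial.eval_C, Polynomial.eval_X, mul_zero, add_zero, one_mul,
        zero_sub, Nat.cast_ofNat, Nat.add_one_sub_one, pow_one, h3, hsm, map_smul,
        smul_comm aleph]
      abel
    have h4 := congrArg (Polynomial.eval (τ t)) (derivation_det Polynomial.derivative' M)
    simp only [Polynomial.eval_finsetSum, smul_eq_mul, Polynomial.eval_mul] at h4
    have h5 : (M.det.derivative).eval (τ t) = -((mev (1 + aleph • curv D (θ - t • a))).adjugate *
        mev (aleph • K)).trace := by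
      refine h4.trans ?_
      rw [← hadjt]
      simp only [Matrix.trace, Matrix.diag, Matrix.mul_apply, ← Finset.sum_neg_distrib]
      refine Finset.sum_congr rfl fun i _ => Finset.sum_congr rfl fun j _ => ?_
      rw [← mul_neg, ← h1]
      rfl
    rw [h5, ← mco_mev hK, mev_mco, ← mco_mul]
    simp [Matrix.trace]
  have hD1 : ∀ t : ℂ, D (mco (M.adjugate.map (Polynomial.eval (τ t))) * (aleph • a)).trace =
      -((M.det.derivative.eval (τ t) : evenSub A) : A) := fun t => by
    rw [hder, neg_neg, hadjt]
    have h1 := chernWeil hD (hθ.sub (ha.smul t)) ha (hu t)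
    exact h1
  obtain ⟨N, hN1, hN2⟩ : ∃ N : ℕ, (∀ i j, (M.adjugate i j).natDegree < N) ∧
      M.det.natDegree < N := by
    obtain ⟨N, hN⟩ := exists_natDegree_lt M.adjugate
    exact ⟨N + M.det.natDegree + 1, fun i j => by have := hN i j; omega, by omega⟩
  set α : ℕ → A := fun k => (mco (M.adjugate.map (Polynomial.coeff · k)) * (aleph • a)).trace
  have hsum : ∀ (c : ℕ → ℂ) (φ : Polynomial (evenSub A) → evenSub A),
      (∀ p : Polynomial (evenSub A), p.natDegree < N →
        φ p = ∑ k ∈ Finset.range N, c k • p.coeff k) →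
      (mco (M.adjugate.map φ) * (aleph • a)).trace = ∑ k ∈ Finset.range N, c k • α k :=
    trace_mco_map hN1 (aleph • a)
  have hN3 : M.det.derivative.natDegree < N :=
    lt_of_le_of_lt (Polynomial.natDegree_derivative_le _) (lt_of_le_of_lt (Nat.sub_le _ _) hN2)
  -- The identity `hD1` holds for all complex t, hence for each power of t separately.
  have hcoeff : ∀ k < N, D (α k) + ((M.det.derivative.coeff k : evenSub A) : A) = 0 := by
    refine eq_zero_of_forall_sum_pow_smul _ N fun t => ?_
    have h1 := hD1 t
    rw [hsum (fun k => t ^ k) _ (fun p hp => eval_algebraMap_eq_sum t hp), eval_algebraMap_eq_sum t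
      hN3, map_sum] at h1
    simp only [smul_add, Finset.sum_add_distrib]
    rw [← sub_eq_zero.mpr h1]
    simp
  have h01 : chern (curv D θ) - chern (curv D (θ - a)) =
      ((M.det.eval 0 - M.det.eval 1 : evenSub A) : A) := by
    have h0 := hdett 0
    have h1 := hdett 1
    rw [show τ 0 = 0 from map_zero _, zero_smul, sub_zero] at h0
    rw [show τ 1 = 1 from map_one _, one_smul] at h1
    rw [← h0, ← h1]; rfl
  rw [h01, hsum _ _ fun p hp => unitIntegral_eq_sum p hp, map_sum]
  -- The difference of the two endpoint values is the sum of the coefficients of positive degree.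
  -- The factor k + 1 of the formal derivative will cancel the weight 1/(k+1) of the unit integral.
  have h2 : M.det.eval 1 = M.det.eval 0 + ∑ k ∈ Finset.range N, M.det.coeff (k + 1) := by
    rw [Polynomial.eval_eq_sum_range' (Nat.lt_succ_of_lt hN2), Finset.sum_range_succ',
      ← Polynomial.coeff_zero_eq_eval_zero]
    simp [add_comm]
  rw [h2, sub_add_cancel_left, ← Finset.sum_neg_distrib, AddSubmonoidClass.coe_finsetSum]
  refine Finset.sum_congr rfl fun k hk => ?_
  rw [map_smul, eq_neg_of_add_eq_zero_left (hcoeff k (Finset.mem_range.mp hk)),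
    Polynomial.coeff_derivative]
  have h3 : (((k : evenSub A) + 1 : evenSub A) : A) = algebraMap ℂ A (k + 1) := by simp
  have h4 : (k + 1 : ℂ) ≠ 0 := Nat.cast_add_one_ne_zero k
  rw [MulMemClass.coe_mul, h3, ← Algebra.commutes, ← Algebra.smul_def, smul_neg, smul_smul,
    inv_mul_cancel₀ h4, one_smul]
  rfl

variable (D) in
/-- The exterior derivative of the Berndtsson form: the transgression between the Chern form of
the connection `d + θ` and that of `d + θ - ξσ`. -/
theorem deriv_berndtsson {θ : Matrix n n A} (hθ : MOdd θ) {ξ : Matrix n Unit A} (hξ : MOdd ξ)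
    {σ η : Matrix Unit n A} (hσ : MEven σ)
    (hDσ : mD D σ = η + σ * θ - σ * ξ * σ)
    (hu : ∀ t : ℂ, IsUnit (mev (1 + aleph • curv D (θ - t • (ξ * σ)))).det) :
    D (berndtsson (curv D θ) ξ σ η) =
      chern (curv D θ) - chern (curv D (θ - ξ * σ)) := by
  have ha : MOdd (ξ * σ) := hξ.mul_even hσ
  set K := mD D (ξ * σ) + θ * (ξ * σ) + ξ * σ * θ with hK
  set N := mev (1 + aleph • curv D θ)
  set B := mev (aleph • (ξ * η))
  set v1 : Matrix n Unit A := mD D ξ + θ * ξ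
  set v2 : Matrix n Unit A := ξ * (σ * ξ)
  have hv1 : MEven v1 := hξ.mD.add (hθ.mul hξ)
  have hv2 : MEven v2 := hξ.mul (hσ.mul_odd hξ)
  -- Inserting dσ, its term σθ cancels against ξσθ. What remains is -ξη modulo columns times σ.
  have hKeq : K = (v1 + v2) * σ - ξ * η := by
    rw [hK, mD_mul_odd D hξ, hDσ]
    simp only [v1, v2, Matrix.mul_add, Matrix.mul_sub, Matrix.add_mul, Matrix.mul_assoc]
    abel
  have haa : ξ * σ * (ξ * σ) = v2 * σ := by simp only [v2, Matrix.mul_assoc]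
  have h1 : mev (aleph • K) = mev (aleph • (v1 + v2)) * mev σ - B := by
    rw [hKeq, smul_sub, mev_sub, ← Matrix.smul_mul, mev_mul ((hv1.add hv2).smul _) hσ]
  have h2 : mev (aleph • (ξ * σ * (ξ * σ))) = mev (aleph • v2) * mev σ := by
    rw [haa, ← Matrix.smul_mul, mev_mul (hv2.smul _) hσ]
  -- As σ is even, cyclicity moves it in front of the adjugate without a sign, where
  -- `row_mul_adjugate_quadPencil` applies.
  have hrow : ∀ W : Matrix n n (evenSub A),
      (mco W * (ξ * σ)).trace = (mco (mev σ * W) * ξ).trace := fun W => by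
    rw [mco_mul, mco_mev hσ, ← Matrix.mul_assoc, ← trace_mul_comm_even hσ, Matrix.mul_assoc]
  rw [← transgression_pencil hD hθ ha hu rfl, berndtsson, Matrix.mul_smul, Matrix.mul_smul,
    Matrix.trace_smul, Matrix.trace_smul, hrow, hrow, h1, h2, row_mul_adjugate_quadPencil]

end DGA

/-! ## Chern connections in a bigraded algebra -/

section Dolbeault

open SuperCommAlgebra

/-- A supercommutative algebra with operators `d = ∂ + ∂̄`, and with an automorphism `u` acting
as `2 ^ (p - q)` on elements of bidegree `(p, q)`. -/
structure Dolbeault (A : Type*) [Ring A] [Algebra ℂ A] [SuperCommAlgebra A] where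
  d : SuperDeriv A
  del : SuperDeriv A
  delbar : SuperDeriv A
  u : A →ₐ[ℂ] A
  d_eq : ∀ x, d x = del x + delbar x
  d_sq : ∀ x, d (d x) = 0
  del_sq : ∀ x, del (del x) = 0
  u_parity : ∀ x, u (parity x) = parity (u x)
  u_del : ∀ x, u (del x) = (2 : ℂ) • del (u x)
  u_delbar : ∀ x, u (delbar x) = (2⁻¹ : ℂ) • delbar (u x)
  isNilpotent_d : ∀ x, parity x = -x → IsNilpotent (d x)

variable {A : Type*} [Ring A] [Algebra ℂ A] [SuperCommAlgebra A] (𝒟 : Dolbeault A)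
  {l m n o : Type*}

/-- Matrices of functions. -/
structure Dolbeault.IsFun (M : Matrix l n A) : Prop where
  even : MEven M
  map_u : M.map 𝒟.u = M

variable {𝒟}

theorem Dolbeault.IsFun.mul [Fintype n] {M : Matrix l n A} {N : Matrix n o A} (hM : 𝒟.IsFun M)
    (hN : 𝒟.IsFun N) : 𝒟.IsFun (M * N) :=
  ⟨hM.even.mul hN.even, by rw [Matrix.map_mul, hM.map_u, hN.map_u]⟩

theorem Dolbeault.mD_d (M : Matrix l n A) : mD 𝒟.d M = mD 𝒟.del M + mD 𝒟.delbar M := by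
  ext i j; exact 𝒟.d_eq _

theorem Dolbeault.map_u_del (M : Matrix l n A) :
    (mD 𝒟.del M).map 𝒟.u = (2 : ℂ) • mD 𝒟.del (M.map 𝒟.u) := by
  ext i j; exact 𝒟.u_del _

theorem Dolbeault.map_u_delbar (M : Matrix l n A) :
    (mD 𝒟.delbar M).map 𝒟.u = (2⁻¹ : ℂ) • mD 𝒟.delbar (M.map 𝒟.u) := by
  ext i j; exact 𝒟.u_delbar _

variable [Fintype n] [DecidableEq n]

/-- The entries of the curvature are nilpotent: those of dθ by `isNilpotent_d`, and those of θ²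
because a product of two odd elements squares to zero. Modulo the nilradical of the even subalgebra
the determinant is therefore 1. -/
theorem isUnit_det_one_add_curv {θ : Matrix n n A} (hθ : MOdd θ) (c : ℂ) :
    IsUnit (mev (1 + c • curv 𝒟.d θ)).det := by
  have hnil : ∀ x : A, parity x = x → IsNilpotent x → evenPart x ∈ nilradical (evenSub A) :=
    fun x hx ⟨k, hk⟩ => ⟨k, Subtype.ext (by
      rw [SubmonoidClass.coe_pow, coe_evenPart hx, hk]; rfl)⟩
  have hentry : ∀ i j, mev (curv 𝒟.d θ) i j ∈ nilradical (evenSub A) := fun i j => by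
    rw [curv, mev_add, Matrix.add_apply, mev_apply, mev_apply, Matrix.mul_apply,
      map_sum]
    refine add_mem (hnil _ (hθ.mD.apply i j) (𝒟.isNilpotent_d _ (hθ.apply i j)))
      (sum_mem fun k _ => ?_)
    refine hnil _ (by rw [map_mul, hθ.apply, hθ.apply, neg_mul_neg]) ⟨2, ?_⟩
    have h0 : θ i k * θ i k = 0 := by
      have := odd_anticomm _ _ (hθ.apply i k) (hθ.apply i k)
      have h2 : (2 : ℂ) • (θ i k * θ i k) = 0 := by
        rw [two_smul]; exact add_eq_zero_iff_eq_neg.mpr this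
      exact (smul_eq_zero.mp h2).resolve_left two_ne_zero
    rw [pow_two, mul_assoc, ← mul_assoc (θ k j), odd_anticomm _ _ (hθ.apply k j) (hθ.apply i k),
      neg_mul, mul_neg, mul_assoc, ← mul_assoc, h0, zero_mul, neg_zero]
  set I := nilradical (evenSub A)
  have h1 : Ideal.Quotient.mk I ((mev (1 + c • curv 𝒟.d θ)).det - 1) = 0 := by
    rw [map_sub, map_one, RingHom.map_det, mev_add, mev_one, mev_smul]
    have : (Ideal.Quotient.mk I).mapMatrix (1 + c • mev (curv 𝒟.d θ)) = 1 := by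
      rw [map_add, map_one, add_eq_left]
      ext i j
      exact Ideal.Quotient.eq_zero_iff_mem.mpr (Submodule.smul_of_tower_mem I c (hentry i j))
    rw [this, Matrix.det_one, sub_self]
  have h2 : IsNilpotent ((mev (1 + c • curv 𝒟.d θ)).det - 1) :=
    mem_nilradical.mp (Ideal.Quotient.eq_zero_iff_mem.mp h1)
  simpa using h2.isUnit_one_add

/-! ### The Chern connection -/

variable (𝒟) in
/-- The connection matrix `G⁻¹ ∂G`. -/
def conn (G Gi : Matrix n n A) : Matrix n n A := Gi * mD 𝒟.del G

/-- A Gram matrix with its inverse. -/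
structure IsGram (𝒟 : Dolbeault A) (G Gi : Matrix n n A) : Prop where
  isFun : 𝒟.IsFun G
  isFun_inv : 𝒟.IsFun Gi
  mul_inv : G * Gi = 1
  inv_mul : Gi * G = 1

variable {G Gi : Matrix n n A}

theorem IsGram.conn_odd (h : IsGram 𝒟 G Gi) : MOdd (conn 𝒟 G Gi) :=
  h.isFun_inv.even.mul_odd h.isFun.even.mD

/-- The (2,0)-part vanishes: differentiating G⁻¹ in θ = G⁻¹∂G gives ∂θ = -θ∧θ. -/
theorem IsGram.curv_eq (h : IsGram 𝒟 G Gi) :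
    curv 𝒟.d (conn 𝒟 G Gi) = mD 𝒟.delbar (conn 𝒟 G Gi) := by
  have h1 : mD 𝒟.del (conn 𝒟 G Gi) = -(conn 𝒟 G Gi * conn 𝒟 G Gi) := by
    rw [conn, mD_mul_even _ h.isFun_inv.even, mD_mD 𝒟.del_sq,
      mD_inv 𝒟.del h.isFun_inv.even h.inv_mul h.mul_inv]
    simp [Matrix.mul_assoc]
  rw [curv, 𝒟.mD_d, h1]
  abel

theorem IsGram.map_u_conn (h : IsGram 𝒟 G Gi) :
    (conn 𝒟 G Gi).map 𝒟.u = (2 : ℂ) • conn 𝒟 G Gi := by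
  rw [conn, Matrix.map_mul, 𝒟.map_u_del, h.isFun.map_u, h.isFun_inv.map_u, Matrix.mul_smul]

theorem IsGram.map_u_curv (h : IsGram 𝒟 G Gi) :
    (curv 𝒟.d (conn 𝒟 G Gi)).map 𝒟.u = curv 𝒟.d (conn 𝒟 G Gi) := by
  rw [h.curv_eq, 𝒟.map_u_delbar, h.map_u_conn, mD_smul, smul_smul]
  norm_num

theorem IsGram.u_chern (h : IsGram 𝒟 G Gi) :
    𝒟.u (chern (curv 𝒟.d (conn 𝒟 G Gi))) = chern (curv 𝒟.d (conn 𝒟 G Gi)) := by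
  rw [← chern_map 𝒟.u 𝒟.u_parity, h.map_u_curv]

/-! ### Change of holomorphic frame -/

variable (𝒟) in
/-- A holomorphic change of frame `g` with inverse `k`, and the conjugate transposes. -/
structure IsGauge (g k gb kb : Matrix n n A) : Prop where
  even : MEven g
  even_inv : MEven k
  even_conj : MEven gb
  mul_inv : g * k = 1
  inv_mul : k * g = 1
  conj_mul : kb * gb = 1
  delbar_eq : mD 𝒟.delbar g = 0
  del_conj : mD 𝒟.del gb = 0

variable {g k gb kb : Matrix n n A}

/-- The conjugate factor is annihilated by ∂ and so cancels against its inverse. For the holomorphic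
factor ∂g = dg, which leaves the usual gauge transformation law. -/
theorem IsGauge.conn_eq (hg : IsGauge 𝒟 g k gb kb) (h : IsGram 𝒟 G Gi) :
    conn 𝒟 (gb * G * g) (k * Gi * kb) = k * conn 𝒟 G Gi * g + k * mD 𝒟.d g := by
  have h1 : mD 𝒟.del (gb * G * g) = gb * (mD 𝒟.del G * g + G * mD 𝒟.d g) := by
    rw [mD_mul_even _ (hg.even_conj.mul h.isFun.even), mD_mul_even _ hg.even_conj, hg.del_conj,
      𝒟.mD_d, hg.delbar_eq, Matrix.zero_mul, zero_add, add_zero, Matrix.mul_add, Matrix.mul_assoc,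
      Matrix.mul_assoc]
  rw [conn, h1, Matrix.mul_assoc (k * Gi), ← Matrix.mul_assoc kb, hg.conj_mul, Matrix.one_mul,
    Matrix.mul_add, conn]
  simp only [Matrix.mul_assoc]
  rw [← Matrix.mul_assoc Gi G, h.inv_mul, Matrix.one_mul]

theorem IsGauge.curv_eq (hg : IsGauge 𝒟 g k gb kb) {θ : Matrix n n A} (hθ : MOdd θ) :
    curv 𝒟.d (k * θ * g + k * mD 𝒟.d g) = k * curv 𝒟.d θ * g := by
  have hk : mD 𝒟.d k = -(k * mD 𝒟.d g * k) := mD_inv 𝒟.d hg.even_inv hg.inv_mul hg.mul_inv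
  have h1 : ∀ x : Matrix n n A, g * (k * x) = x := fun x => by
    rw [← Matrix.mul_assoc, hg.mul_inv, Matrix.one_mul]
  simp only [curv, mD_add]
  rw [mD_mul_odd _ (hg.even_inv.mul_odd hθ), mD_mul_even _ hg.even_inv, mD_mul_even _ hg.even_inv,
    mD_mD 𝒟.d_sq, hk]
  simp only [Matrix.mul_add, Matrix.add_mul, Matrix.mul_assoc, Matrix.neg_mul, h1,
    Matrix.mul_zero]
  abel

theorem IsGauge.chern_eq (hg : IsGauge 𝒟 g k gb kb) (h : IsGram 𝒟 G Gi) :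
    chern (curv 𝒟.d (conn 𝒟 (gb * G * g) (k * Gi * kb))) = chern (curv 𝒟.d (conn 𝒟 G Gi)) := by
  rw [hg.conn_eq h, hg.curv_eq h.conn_odd, chern_conj hg.even hg.even_inv hg.inv_mul
    h.conn_odd.curv]

/-! ### Sections -/

/-- A holomorphic section `f` with conjugate transpose `fb`, where `s` is the inverse of
`|f|²`. -/
structure IsSection (𝒟 : Dolbeault A) (G : Matrix n n A) (f : Matrix n Unit A)
    (fb : Matrix Unit n A) (s : Matrix Unit Unit A) : Prop where
  isFun : 𝒟.IsFun f
  isFun_conj : 𝒟.IsFun fb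
  isFun_inv : 𝒟.IsFun s
  delbar_eq : mD 𝒟.delbar f = 0
  del_conj : mD 𝒟.del fb = 0
  inv_mul : s * (fb * G * f) = 1
  mul_inv : (fb * G * f) * s = 1

variable (𝒟) in
/-- The covariant derivative `Df`. -/
def covD (G Gi : Matrix n n A) (f : Matrix n Unit A) : Matrix n Unit A :=
  mD 𝒟.d f + conn 𝒟 G Gi * f

/-- The dual section `σ = f^* / |f|²`. -/
def dualSec (G : Matrix n n A) (fb : Matrix Unit n A) (s : Matrix Unit Unit A) :
    Matrix Unit n A := s * (fb * G)

variable {f : Matrix n Unit A} {fb : Matrix Unit n A} {s : Matrix Unit Unit A}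

theorem covD_odd (h : IsGram 𝒟 G Gi) (hf : IsSection 𝒟 G f fb s) : MOdd (covD 𝒟 G Gi f) :=
  hf.isFun.even.mD.add (h.conn_odd.mul_even hf.isFun.even)

theorem dualSec_isFun (h : IsGram 𝒟 G Gi) (hf : IsSection 𝒟 G f fb s) :
    𝒟.IsFun (dualSec G fb s) := hf.isFun_inv.mul (hf.isFun_conj.mul h.isFun)

omit [DecidableEq n] in
theorem dualSec_mul_self (hf : IsSection 𝒟 G f fb s) : dualSec G fb s * f = 1 := by
  rw [dualSec, Matrix.mul_assoc, hf.inv_mul]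

/-- Write σ = |f|⁻² f*G. Since ∂f* = 0, ∂(f*G) = f*Gθ and ∂|f|² = f*G·Df; the derivative of |f|⁻²
supplies the quadratic term. -/
theorem del_dualSec (h : IsGram 𝒟 G Gi) (hf : IsSection 𝒟 G f fb s) :
    mD 𝒟.del (dualSec G fb s) = dualSec G fb s * conn 𝒟 G Gi -
      dualSec G fb s * covD 𝒟 G Gi f * dualSec G fb s := by
  have h1 : mD 𝒟.del (fb * G) = fb * G * conn 𝒟 G Gi := by
    rw [mD_mul_even _ hf.isFun_conj.even, hf.del_conj, Matrix.zero_mul, zero_add, conn,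
      ← Matrix.mul_assoc, Matrix.mul_assoc fb, h.mul_inv, Matrix.mul_one]
  have h2 : mD 𝒟.del (fb * G * f) = fb * G * covD 𝒟 G Gi f := by
    rw [mD_mul_even _ (hf.isFun_conj.mul h.isFun).even, h1, covD, 𝒟.mD_d, hf.delbar_eq, add_zero,
      Matrix.mul_add, Matrix.mul_assoc, add_comm]
  rw [dualSec, mD_mul_even _ hf.isFun_inv.even, h1,
    mD_inv 𝒟.del hf.isFun_inv.even hf.inv_mul hf.mul_inv, h2]
  simp only [Matrix.mul_assoc, Matrix.neg_mul]
  abel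

variable (𝒟) in
/-- The Berndtsson form of a section. -/
def bernd (G Gi : Matrix n n A) (f : Matrix n Unit A) (fb : Matrix Unit n A)
    (s : Matrix Unit Unit A) : A :=
  berndtsson (curv 𝒟.d (conn 𝒟 G Gi)) (covD 𝒟 G Gi f) (dualSec G fb s)
    (mD 𝒟.delbar (dualSec G fb s))

theorem d_bernd (h : IsGram 𝒟 G Gi) (hf : IsSection 𝒟 G f fb s) :
    𝒟.d (bernd 𝒟 G Gi f fb s) = chern (curv 𝒟.d (conn 𝒟 G Gi)) -
      chern (curv 𝒟.d (conn 𝒟 G Gi - covD 𝒟 G Gi f * dualSec G fb s)) := by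
  have ho := (covD_odd h hf).mul_even (dualSec_isFun h hf).even
  refine deriv_berndtsson 𝒟.d 𝒟.d_sq h.conn_odd (covD_odd h hf) (dualSec_isFun h hf).even ?_
    fun t => isUnit_det_one_add_curv (h.conn_odd.sub (ho.smul t)) _
  rw [𝒟.mD_d, del_dualSec h hf]
  abel

/-- All ingredients are tensorial: Df is multiplied by `k` on the left, and σ by `g` on the right.
The same holds for ∂̄σ because ∂̄g = 0. -/
theorem IsGauge.bernd_eq (hg : IsGauge 𝒟 g k gb kb) (h : IsGram 𝒟 G Gi)
    (hf : IsSection 𝒟 G f fb s) :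
    bernd 𝒟 (gb * G * g) (k * Gi * kb) (k * f) (fb * kb) s = bernd 𝒟 G Gi f fb s := by
  have h1 : covD 𝒟 (gb * G * g) (k * Gi * kb) (k * f) = k * covD 𝒟 G Gi f := by
    rw [covD, hg.conn_eq h, mD_mul_even _ hg.even_inv,
      mD_inv 𝒟.d hg.even_inv hg.inv_mul hg.mul_inv, covD]
    simp only [Matrix.mul_add, Matrix.add_mul, Matrix.mul_assoc, Matrix.neg_mul]
    rw [← Matrix.mul_assoc g k f, hg.mul_inv, Matrix.one_mul]
    abel
  have h2 : dualSec (gb * G * g) (fb * kb) s = dualSec G fb s * g := by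
    simp only [dualSec, Matrix.mul_assoc]
    rw [← Matrix.mul_assoc kb, hg.conj_mul, Matrix.one_mul]
  have h3 : mD 𝒟.delbar (dualSec G fb s * g) = mD 𝒟.delbar (dualSec G fb s) * g := by
    rw [mD_mul_even _ (dualSec_isFun h hf).even, hg.delbar_eq, Matrix.mul_zero, add_zero]
  rw [bernd, hg.conn_eq h, hg.curv_eq h.conn_odd, h1, h2, h3,
    berndtsson_conj hg.even hg.even_inv hg.inv_mul h.conn_odd.curv (covD_odd h hf)
      (dualSec_isFun h hf).even.mD, bernd]

/-- Since ∂̄f = 0, Df has type (1,0) and weight 2. The form ∂̄σ has weight 1/2, and the curvature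
and σ have weight 1, so `berndtsson_scale` applies. -/
theorem u_bernd (h : IsGram 𝒟 G Gi) (hf : IsSection 𝒟 G f fb s) :
    𝒟.u (bernd 𝒟 G Gi f fb s) = (2 : ℂ) • bernd 𝒟 G Gi f fb s := by
  have h1 : (covD 𝒟 G Gi f).map 𝒟.u = (2 : ℂ) • covD 𝒟 G Gi f := by
    rw [covD, 𝒟.mD_d, hf.delbar_eq, add_zero, Matrix.map_add _ (map_add _), 𝒟.map_u_del,
      hf.isFun.map_u, Matrix.map_mul, h.map_u_conn, hf.isFun.map_u, Matrix.smul_mul, smul_add]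
  rw [bernd, ← berndtsson_map 𝒟.u 𝒟.u_parity, h.map_u_curv, h1, 𝒟.map_u_delbar,
    (dualSec_isFun h hf).map_u, berndtsson_scale _ _ _ _ (by norm_num)]

/-! ### Frames whose first element is the section -/

section Adapted

variable {r : ℕ}

theorem detE_of_first_column {M : Matrix (Fin (r + 1)) (Fin (r + 1)) A} (h0 : M 0 0 = 1)
    (h : ∀ i : Fin r, M i.succ 0 = 0) : detE M = detE (M.submatrix Fin.succ Fin.succ) := by
  have h1 : mev M 0 0 = 1 := by
    rw [mev_apply, h0]; exact evenPart_coe 1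
  rw [detE, Matrix.det_succ_column_zero, Fin.sum_univ_succ, Finset.sum_eq_zero]
  · simp only [h1, Fin.val_zero, pow_zero, one_mul, add_zero]
    rfl
  · intro i _
    simp [h i]

/-- When the first frame element is parallel, the connection is block triangular, and the lower
block of its curvature is the curvature of the lower block. -/
theorem chern_of_first_column {θ : Matrix (Fin (r + 1)) (Fin (r + 1)) A}
    (h : ∀ i, θ i 0 = 0) :
    chern (curv 𝒟.d θ) = chern (curv 𝒟.d (θ.submatrix Fin.succ Fin.succ)) := by
  have h1 : ∀ i, curv 𝒟.d θ i 0 = 0 := fun i => by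
    simp [curv, Matrix.mul_apply, h]
  rw [chern, detE_of_first_column (by simp [h1]) (by simp [h1]), chern]
  congr 1
  ext i j
  simp [curv, Matrix.mul_apply, Fin.sum_univ_succ, h, Matrix.one_apply]

variable {G Gi : Matrix (Fin (r + 1)) (Fin (r + 1)) A} {f : Matrix (Fin (r + 1)) Unit A}
  {fb : Matrix Unit (Fin (r + 1)) A} {s : Matrix Unit Unit A} {Hi : Matrix (Fin r) (Fin r) A}

/-- The Schur complement, which is the Gram matrix of the quotient. -/
def schur (G : Matrix (Fin (r + 1)) (Fin (r + 1)) A) (σ : Matrix Unit (Fin (r + 1)) A) :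
    Matrix (Fin r) (Fin r) A :=
  Matrix.of fun i j => G i.succ j.succ - G i.succ 0 * σ () j.succ

/-- Let T = G - Gfσ and θ' = θ - Df·σ. As f is constant in this frame, Df = θf and ∂T = Tθ'. The
first column of T vanishes because σ_0 = 1, so the equation restricts to the lower blocks as ∂H =
Hθ'', with H the Schur complement; thus θ'' = H⁻¹∂H. -/
theorem sub_covD_mul_dualSec (h : IsGram 𝒟 G Gi) (hf : IsSection 𝒟 G f fb s)
    (hf0 : ∀ i u, f i u = if i = 0 then 1 else 0) (hH : Hi * schur G (dualSec G fb s) = 1) :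
    (∀ i, (conn 𝒟 G Gi - covD 𝒟 G Gi f * dualSec G fb s) i 0 = 0) ∧
    (conn 𝒟 G Gi - covD 𝒟 G Gi f * dualSec G fb s).submatrix Fin.succ Fin.succ =
      conn 𝒟 (schur G (dualSec G fb s)) Hi := by
  set σ := dualSec G fb s with hσ
  set θ := conn 𝒟 G Gi with hθ
  have hmul : ∀ M : Matrix (Fin (r + 1)) (Fin (r + 1)) A, ∀ i u, (M * f) i u = M i 0 := by
    intro M i u
    simp [Matrix.mul_apply, hf0]
  have hdf : ∀ D : SuperDeriv A, mD D f = 0 := fun D => by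
    ext i u
    rw [mD_apply, hf0]
    split_ifs <;> simp [D.map_one]
  have hξ : covD 𝒟 G Gi f = θ * f := by rw [covD, hdf, zero_add]
  have hσ0 : σ () 0 = 1 := by
    have := congrFun (congrFun (dualSec_mul_self hf) ()) ()
    simpa [Matrix.mul_apply, hf0] using this
  set θ' := θ - covD 𝒟 G Gi f * σ with hθ'
  set T := G - G * f * σ with hT
  have hpT : mD 𝒟.del T = T * θ' := by
    have hGθ : mD 𝒟.del G = G * θ := by
      rw [hθ, conn, ← Matrix.mul_assoc, h.mul_inv, Matrix.one_mul]
    rw [hT, mD_sub, mD_mul_even _ (h.isFun.even.mul hf.isFun.even), mD_mul_even _ h.isFun.even,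
      hdf, Matrix.mul_zero, add_zero, del_dualSec h hf, hGθ, hθ', hξ]
    simp only [Matrix.sub_mul, Matrix.mul_sub, Matrix.mul_assoc, ← hσ, ← hθ]
    abel
  have hT0 : ∀ i, T i 0 = 0 := fun i => by
    simp [hT, Matrix.mul_apply, hf0, hσ0]
  have hTs : ∀ i j : Fin r, T i.succ j.succ = schur G σ i j := fun i j => by
    simp [hT, Matrix.mul_apply, hf0, schur]
  refine ⟨fun i => ?_, ?_⟩
  · rw [hθ', hξ]
    simp [Matrix.mul_apply, hf0, hσ0]
  · have h1 : mD 𝒟.del (schur G σ) = schur G σ * θ'.submatrix Fin.succ Fin.succ := by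
      ext i j
      rw [mD_apply, ← hTs]
      have := congrFun (congrFun hpT i.succ) j.succ
      rw [mD_apply] at this
      rw [this, Matrix.mul_apply, Matrix.mul_apply, Fin.sum_univ_succ, hT0, zero_mul, zero_add]
      simp [hTs]
    rw [conn, h1, ← Matrix.mul_assoc, hH, Matrix.one_mul]

theorem d_bernd_adapted (h : IsGram 𝒟 G Gi) (hf : IsSection 𝒟 G f fb s)
    (hf0 : ∀ i u, f i u = if i = 0 then 1 else 0)
    (hH : IsGram 𝒟 (schur G (dualSec G fb s)) Hi) :
    𝒟.d (bernd 𝒟 G Gi f fb s) = chern (curv 𝒟.d (conn 𝒟 G Gi)) -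
        chern (curv 𝒟.d (conn 𝒟 (schur G (dualSec G fb s)) Hi)) ∧
      𝒟.delbar (bernd 𝒟 G Gi f fb s) = 𝒟.d (bernd 𝒟 G Gi f fb s) := by
  obtain ⟨h1, h2⟩ := sub_covD_mul_dualSec h hf hf0 hH.inv_mul
  have h3 : 𝒟.d (bernd 𝒟 G Gi f fb s) = chern (curv 𝒟.d (conn 𝒟 G Gi)) -
      chern (curv 𝒟.d (conn 𝒟 (schur G (dualSec G fb s)) Hi)) := by
    rw [d_bernd h hf, chern_of_first_column h1, h2]
  refine ⟨h3, ?_⟩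
  -- Under `u` the Chern forms are fixed, while ∂a is multiplied by 2·2 and ∂̄a by 2⁻¹·2. Hence 4∂a
  -- + ∂̄a = ∂a + ∂̄a, which forces ∂a = 0.
  have h4 := congrArg 𝒟.u h3
  rw [map_sub, h.u_chern, hH.u_chern, ← h3, 𝒟.d_eq, map_add, 𝒟.u_del, 𝒟.u_delbar, u_bernd h hf,
    map_smul, map_smul, smul_smul, smul_smul] at h4
  norm_num at h4
  rw [← sub_eq_zero] at h4
  have h5 : (3 : ℂ) • 𝒟.del (bernd 𝒟 G Gi f fb s) = 0 := by
    rw [← h4]; module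
  rw [𝒟.d_eq, (smul_eq_zero.mp h5).resolve_left (by norm_num), zero_add]

end Adapted

end Dolbeault

/-! ## Smooth forms on an open subset of the model space -/

section Flat

open SuperCommAlgebra TopologicalSpace

variable {V : Type*} [NormedAddCommGroup V] [NormedSpace ℂ V] [FiniteDimensional ℂ V]

/-- An auxiliary norm on the algebra of forms. -/
@[reducible] def formNormedAddCommGroup : NormedAddCommGroup (FormAlg V) :=
  NormedAddCommGroup.induced (FormAlg V)
    (Finset (Fin (Module.finrank ℂ (V →L[ℝ] ℂ))) → ℂ)
    (formBasis (V := V)).equivFun.toLinearMap (formBasis (V := V)).equivFun.injective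

attribute [local instance] formNormedAddCommGroup

/-- The algebra of forms as a normed space. -/
@[reducible] def formNormedSpace : NormedSpace ℂ (FormAlg V) :=
  NormedSpace.induced ℂ (FormAlg V)
    (Finset (Fin (Module.finrank ℂ (V →L[ℝ] ℂ))) → ℂ)
    (formBasis (V := V)).equivFun.toLinearMap

attribute [local instance] formNormedSpace

instance : FiniteDimensional ℂ (FormAlg V) := Module.Finite.of_basis formBasis

/-- Linear maps on the algebra of forms are continuous. -/
def formCLM {E : Type*} [NormedAddCommGroup E] [NormedSpace ℂ E] (T : FormAlg V →ₗ[ℂ] E) :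
    FormAlg V →L[ℝ] E :=
  (LinearMap.toContinuousLinearMap T).restrictScalars ℝ

/-- The wedge product as a continuous bilinear map. -/
def formMul : FormAlg V →L[ℂ] FormAlg V →L[ℂ] FormAlg V :=
  LinearMap.toContinuousLinearMap
    ((LinearMap.toContinuousLinearMap : (FormAlg V →ₗ[ℂ] FormAlg V) ≃ₗ[ℂ] _).toLinearMap ∘ₗ
      LinearMap.mul ℂ (FormAlg V))

theorem formMul_apply (x y : FormAlg V) : formMul x y = x * y := rfl

theorem contDiffOn_formMul {E : Type*} [NormedAddCommGroup E] [NormedSpace ℝ E]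
    {f g : E → FormAlg V} {s : Set E} {n : ℕ∞ω} (hf : ContDiffOn ℝ n f s)
    (hg : ContDiffOn ℝ n g s) : ContDiffOn ℝ n (fun x => f x * g x) s :=
  ((formMul (V := V)).isBoundedBilinearMap.contDiff.restrict_scalars ℝ).comp_contDiffOn
    (hf.prodMk hg)

theorem hasFDerivAt_formMul {E : Type*} [NormedAddCommGroup E] [NormedSpace ℝ E]
    {f g : E → FormAlg V} {x : E} (hf : DifferentiableAt ℝ f x)
    (hg : DifferentiableAt ℝ g x) (v : E) :
    fderiv ℝ (fun x => f x * g x) x v = fderiv ℝ f x v * g x + f x * fderiv ℝ g x v := by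
  have h := (((formMul (V := V)).isBoundedBilinearMap.hasFDerivAt (f x, g x)).restrictScalars
    ℝ).comp x (hf.hasFDerivAt.prodMk hg.hasFDerivAt)
  rw [show (fun x => f x * g x) = (fun p : FormAlg V × FormAlg V => formMul p.1 p.2) ∘
    fun x => (f x, g x) from rfl, h.fderiv]
  simp [formMul_apply, add_comm]

theorem dirDeriv_eq {W : V → FormAlg V} {y : V} (hW : DifferentiableAt ℝ W y) (v : V) :
    dirDeriv W y v = fderiv ℝ W y v := by
  rw [← formBasis.sum_repr (fderiv ℝ W y v), dirDeriv]
  refine Finset.sum_congr rfl fun s _ => ?_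
  have h := ((formCLM (formBasis.coord s)).hasFDerivAt (x := W y)).comp y hW.hasFDerivAt
  congr 1
  exact congrArg (fun L => L v) h.fderiv

theorem flatD_congr (P : (V →L[ℝ] ℂ) →ₗ[ℂ] (V →L[ℝ] ℂ)) {W U : V → FormAlg V} {y : V}
    (h : W =ᶠ[nhds y] U) : flatD P W y = flatD P U y := by
  simp only [flatD, dirDeriv]
  refine Finset.sum_congr rfl fun i _ => congrArg _ (Finset.sum_congr rfl fun s _ => ?_)
  have : (fun y' => formBasis.repr (W y') s) =ᶠ[nhds y] fun y' => formBasis.repr (U y') s :=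
    h.mono fun z hz => by simp only [hz]
  rw [this.fderiv_eq]

theorem flatD_eq (P : (V →L[ℝ] ℂ) →ₗ[ℂ] (V →L[ℝ] ℂ)) {W : V → FormAlg V} {y : V}
    (hW : DifferentiableAt ℝ W y) :
    flatD P W y = ∑ i, ExteriorAlgebra.ι ℂ (P (coordCovector i)) *
      fderiv ℝ W y (Module.finBasis ℝ V i) := by
  simp only [flatD, dirDeriv_eq hW]

variable (Ω : Opens V)

/-- The algebra of smooth forms on an open subset of the model space. -/
def smoothForms : Subalgebra ℂ (Ω → FormAlg V) where
  carrier := {w | ∃ W : V → FormAlg V, ContDiffOn ℝ ∞ W Ω ∧ ∀ y : Ω, W y = w y}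
  mul_mem' := by
    rintro a b ⟨W, hW, hW'⟩ ⟨U, hU, hU'⟩
    exact ⟨_, contDiffOn_formMul hW hU, fun y => by simp [hW', hU']⟩
  add_mem' := by
    rintro a b ⟨W, hW, hW'⟩ ⟨U, hU, hU'⟩
    exact ⟨_, hW.add hU, fun y => by simp [hW', hU']⟩
  algebraMap_mem' c := ⟨fun _ => algebraMap ℂ _ c, contDiffOn_const, fun _ => rfl⟩

/-- Smooth forms on an open subset of the model space. -/
def SmoothForm : Type _ := ↥(smoothForms Ω)

instance : Ring (SmoothForm Ω) := inferInstanceAs (Ring ↥(smoothForms Ω))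

instance : Algebra ℂ (SmoothForm Ω) := inferInstanceAs (Algebra ℂ ↥(smoothForms Ω))

variable {Ω}

/-- Evaluation at a point. -/
def ev (y : Ω) : SmoothForm Ω →ₐ[ℂ] FormAlg V :=
  (Pi.evalAlgHom ℂ (fun _ : Ω => FormAlg V) y).comp (smoothForms Ω).val

theorem SmoothForm.ext {a b : SmoothForm Ω} (h : ∀ y, ev y a = ev y b) : a = b :=
  Subtype.ext (funext h)

/-- An extension of a form on an open set to a function on the model space. -/
def rep (a : SmoothForm Ω) : V → FormAlg V := Classical.choose a.2

theorem contDiffOn_rep (a : SmoothForm Ω) : ContDiffOn ℝ ∞ (rep a) Ω :=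
  (Classical.choose_spec a.2).1

theorem rep_apply (a : SmoothForm Ω) (y : Ω) : rep a y = ev y a :=
  (Classical.choose_spec a.2).2 y

theorem contDiffAt_rep (a : SmoothForm Ω) (y : Ω) : ContDiffAt ℝ ∞ (rep a) y :=
  (contDiffOn_rep a).contDiffAt (Ω.isOpen.mem_nhds y.2)

theorem differentiableAt_rep (a : SmoothForm Ω) (y : Ω) : DifferentiableAt ℝ (rep a) y :=
  (contDiffAt_rep a y).differentiableAt (by simp)

/-- Extensions of the same form agree on the open set Ω, hence near each of its points. So the
choice made in `rep` does not affect derivatives there. -/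
theorem eventuallyEq_rep (a : SmoothForm Ω) {W : V → FormAlg V} (hW : ∀ z : Ω, W z = ev z a)
    (y : Ω) : W =ᶠ[nhds (y : V)] rep a :=
  Filter.eventually_of_mem (Ω.isOpen.mem_nhds y.2) fun z hz =>
    (hW ⟨z, hz⟩).trans (rep_apply a ⟨z, hz⟩).symm

/-- Bundling of smooth functions with values in the algebra of forms. -/
def mkForm (W : V → FormAlg V) (hW : ContDiffOn ℝ ∞ W Ω) : SmoothForm Ω :=
  (⟨fun y => W y, W, hW, fun _ => rfl⟩ : smoothForms Ω)

theorem ev_mkForm (W : V → FormAlg V) (hW : ContDiffOn ℝ ∞ W Ω) (y : Ω) :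
    ev y (mkForm W hW) = W y := rfl

/-- Constant forms. -/
def constForm : FormAlg V →ₐ[ℂ] SmoothForm Ω where
  toFun c := mkForm (fun _ => c) contDiffOn_const
  map_one' := rfl
  map_mul' _ _ := rfl
  map_zero' := rfl
  map_add' _ _ := rfl
  commutes' _ := rfl

theorem ev_constForm (c : FormAlg V) (y : Ω) : ev y (constForm c) = c := rfl

theorem contDiffOn_formMap (T : FormAlg V →ₐ[ℂ] FormAlg V) {W : V → FormAlg V}
    (hW : ContDiffOn ℝ ∞ W Ω) : ContDiffOn ℝ ∞ (fun y => T (W y)) Ω :=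
  (formCLM T.toLinearMap).contDiff.comp_contDiffOn hW

/-- Pointwise application of an endomorphism of the algebra of forms. -/
def pointwise (T : FormAlg V →ₐ[ℂ] FormAlg V) : SmoothForm Ω →ₐ[ℂ] SmoothForm Ω where
  toFun a := mkForm (fun y => T (rep a y)) (contDiffOn_formMap T (contDiffOn_rep a))
  map_one' := SmoothForm.ext fun y => by rw [ev_mkForm, rep_apply, map_one, map_one]
  map_mul' a b := SmoothForm.ext fun y => by
    simp only [ev_mkForm, rep_apply, map_mul]
  map_zero' := SmoothForm.ext fun y => by rw [ev_mkForm, rep_apply, map_zero, map_zero]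
  map_add' a b := SmoothForm.ext fun y => by
    simp only [ev_mkForm, rep_apply, map_add]
  commutes' c := SmoothForm.ext fun y => by
    rw [ev_mkForm, rep_apply, AlgHom.commutes, AlgHom.commutes]

theorem ev_pointwise (T : FormAlg V →ₐ[ℂ] FormAlg V) (a : SmoothForm Ω) (y : Ω) :
    ev y (pointwise T a) = T (ev y a) := congrArg T (rep_apply a y)

instance : SuperCommAlgebra (SmoothForm Ω) where
  parity := pointwise parity
  parity_parity a := SmoothForm.ext fun y => by
    rw [ev_pointwise, ev_pointwise, parity_parity]
  even_comm a b h := SmoothForm.ext fun y => by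
    rw [map_mul, map_mul, even_comm]
    rw [← ev_pointwise, h]
  odd_anticomm a b h h' := SmoothForm.ext fun y => by
    rw [map_mul, map_neg, map_mul, odd_anticomm]
    · rw [← ev_pointwise, h, map_neg]
    · rw [← ev_pointwise, h', map_neg]

theorem ev_parity (a : SmoothForm Ω) (y : Ω) : ev y (parity a) = parity (ev y a) :=
  ev_pointwise _ _ _

/-- The partial derivative in a direction. -/
def pderiv (v : V) : SmoothForm Ω →ₗ[ℂ] SmoothForm Ω where
  toFun a := mkForm (fun y => fderiv ℝ (rep a) y v)
    (((contDiffOn_rep a).fderiv_of_isOpen Ω.isOpen (by simp)).clm_apply contDiffOn_const)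
  map_add' a b := SmoothForm.ext fun y => by
    have h : rep (a + b) =ᶠ[nhds (y : V)] fun z => rep a z + rep b z :=
      (eventuallyEq_rep (a + b) (fun z => by rw [rep_apply, rep_apply, map_add]) y).symm
    rw [map_add, ev_mkForm, ev_mkForm, ev_mkForm, h.fderiv_eq,
      fderiv_fun_add (differentiableAt_rep a y) (differentiableAt_rep b y)]
    rfl
  map_smul' c a := SmoothForm.ext fun y => by
    have h : rep (c • a) =ᶠ[nhds (y : V)] fun z => c • rep a z :=
      (eventuallyEq_rep (c • a) (fun z => by rw [rep_apply, map_smul]) y).symm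
    rw [map_smul, ev_mkForm, ev_mkForm, h.fderiv_eq,
      fderiv_fun_const_smul (differentiableAt_rep a y)]
    rfl

theorem ev_pderiv (v : V) (a : SmoothForm Ω) {W : V → FormAlg V} (hW : ∀ z : Ω, W z = ev z a)
    (y : Ω) : ev y (pderiv v a) = fderiv ℝ W y v := by
  rw [(eventuallyEq_rep a hW y).fderiv_eq]
  rfl

theorem pderiv_mul (v : V) (a b : SmoothForm Ω) :
    pderiv v (a * b) = pderiv v a * b + a * pderiv v b :=
  SmoothForm.ext fun y => by
    rw [ev_pderiv v (a * b) (W := fun z => rep a z * rep b z)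
      (fun z => by rw [rep_apply, rep_apply, map_mul]), hasFDerivAt_formMul
      (differentiableAt_rep a y) (differentiableAt_rep b y), map_add, map_mul, map_mul,
      rep_apply, rep_apply]
    rfl

theorem pderiv_pointwise (v : V) (T : FormAlg V →ₐ[ℂ] FormAlg V) (a : SmoothForm Ω) :
    pderiv v (pointwise T a) = pointwise T (pderiv v a) :=
  SmoothForm.ext fun y => by
    rw [ev_pderiv v (pointwise T a) (W := fun z => T (rep a z))
      (fun z => by rw [rep_apply, ev_pointwise]), ev_pointwise]
    exact congrArg (fun L => L v) ((formCLM T.toLinearMap).hasFDerivAt.comp (y : V)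
      (differentiableAt_rep a y).hasFDerivAt).fderiv

theorem pderiv_comm (v w : V) (a : SmoothForm Ω) :
    pderiv v (pderiv w a) = pderiv w (pderiv v a) :=
  SmoothForm.ext fun y => by
    have hd : DifferentiableAt ℝ (fderiv ℝ (rep a)) y :=
      ((contDiffAt_rep a y).fderiv_right (m := 1) (by norm_cast)).differentiableAt
        one_ne_zero
    have h : ∀ v w : V, ev y (pderiv v (pderiv w a)) =
        fderiv ℝ (fderiv ℝ (rep a)) y v w := fun v w => by
      rw [ev_pderiv v (pderiv w a) (W := fun z => fderiv ℝ (rep a) z w) (fun z => rfl),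
        fderiv_clm_apply hd (differentiableAt_const w)]
      simp
    rw [h, h]
    exact (contDiffAt_rep a y).isSymmSndFDerivAt (by
      rw [minSmoothness_of_isRCLikeNormedField]; norm_cast) v w

/-- The operator `flatD P` on smooth forms. -/
def flatDeriv (P : (V →L[ℝ] ℂ) →ₗ[ℂ] (V →L[ℝ] ℂ)) : SuperDeriv (SmoothForm Ω) where
  toLin := ∑ i, (LinearMap.mulLeft ℂ (constForm (ExteriorAlgebra.ι ℂ (P (coordCovector i))))) ∘ₗ
    pderiv (Module.finBasis ℝ V i)
  leibniz a b := by
    simp only [LinearMap.sum_apply, LinearMap.comp_apply, LinearMap.mulLeft_apply, pderiv_mul,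
      mul_add, Finset.sum_add_distrib, Finset.sum_mul, Finset.mul_sum, mul_assoc]
    congr 1
    refine Finset.sum_congr rfl fun i _ => ?_
    rw [← mul_assoc, ← mul_assoc]
    congr 1
    exact SmoothForm.ext fun y => by
      rw [map_mul, map_mul, ev_parity]; exact ext_ι_mul _ _
  map_parity a := by
    simp only [LinearMap.sum_apply, LinearMap.comp_apply, LinearMap.mulLeft_apply, map_sum,
      map_mul, ← Finset.sum_neg_distrib]
    refine Finset.sum_congr rfl fun i _ => ?_
    rw [show parity (constForm (Ω := Ω) (ExteriorAlgebra.ι ℂ (P (coordCovector i)))) =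
      -constForm (ExteriorAlgebra.ι ℂ (P (coordCovector i))) from
        SmoothForm.ext fun y => by
          rw [ev_parity, map_neg]; exact parity_ι _, neg_mul, neg_neg]
    exact congrArg _ (pderiv_pointwise _ _ _)

theorem flatDeriv_apply (P : (V →L[ℝ] ℂ) →ₗ[ℂ] (V →L[ℝ] ℂ)) (a : SmoothForm Ω) :
    flatDeriv P a = ∑ i, constForm (ExteriorAlgebra.ι ℂ (P (coordCovector i))) *
      pderiv (Module.finBasis ℝ V i) a := by
  simp [flatDeriv]

theorem ev_flatDeriv (P : (V →L[ℝ] ℂ) →ₗ[ℂ] (V →L[ℝ] ℂ)) (a : SmoothForm Ω)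
    {W : V → FormAlg V} (hW : ∀ z : Ω, W z = ev z a) (y : Ω) :
    ev y (flatDeriv P a) = flatD P W y := by
  rw [flatD_congr P (eventuallyEq_rep a hW y), flatD_eq P (differentiableAt_rep a y),
    flatDeriv_apply, map_sum]
  refine Finset.sum_congr rfl fun i _ => ?_
  rw [map_mul, ev_constForm, ev_pderiv _ a (rep_apply a)]

/-- Second partial derivatives are symmetric and the wedge of the constant covectors P(dx_i),
P(dx_j) is antisymmetric, so the double sum equals its negative. No property of `P` enters. -/
theorem flatDeriv_sq (P : (V →L[ℝ] ℂ) →ₗ[ℂ] (V →L[ℝ] ℂ)) (a : SmoothForm Ω) :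
    flatDeriv P (flatDeriv P a) = 0 := by
  have hc : ∀ (v : V) (c : FormAlg V) (b : SmoothForm Ω),
      pderiv v (constForm c * b) = constForm c * pderiv v b := fun v c b => by
    rw [pderiv_mul, show pderiv v (constForm (Ω := Ω) c) = 0 from SmoothForm.ext fun y => by
      rw [ev_pderiv v (constForm c) (W := fun _ => c) (fun _ => rfl)]; simp, zero_mul, zero_add]
  set S := flatDeriv P (flatDeriv P a) with hS
  have h1 : S = ∑ i, ∑ j, constForm (ExteriorAlgebra.ι ℂ (P (coordCovector i)) *
      ExteriorAlgebra.ι ℂ (P (coordCovector j))) *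
      pderiv (Module.finBasis ℝ V i) (pderiv (Module.finBasis ℝ V j) a) := by
    rw [hS, flatDeriv_apply]
    refine Finset.sum_congr rfl fun i _ => ?_
    rw [flatDeriv_apply, map_sum, Finset.mul_sum]
    refine Finset.sum_congr rfl fun j _ => ?_
    rw [hc, ← mul_assoc, ← map_mul]
  have h2 : S = -S := by
    conv_rhs => rw [h1, Finset.sum_comm]
    rw [h1, ← Finset.sum_neg_distrib]
    refine Finset.sum_congr rfl fun i _ => ?_
    rw [← Finset.sum_neg_distrib]
    refine Finset.sum_congr rfl fun j _ => ?_
    rw [pderiv_comm, ← neg_mul, ← map_neg,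
      eq_neg_of_add_eq_zero_left (ExteriorAlgebra.ι_add_mul_swap (P (coordCovector i)) _)]
  have h3 : (2 : ℂ) • S = 0 := by
    rw [two_smul]; exact add_eq_zero_iff_eq_neg.mpr h2
  exact (smul_eq_zero.mp h3).resolve_left two_ne_zero

omit [FiniteDimensional ℂ V] in
theorem proj10_add_proj01 : (proj10 : (V →L[ℝ] ℂ) →ₗ[ℂ] (V →L[ℝ] ℂ)) + proj01 = LinearMap.id := by
  simp only [proj10, proj01]
  module

omit [FiniteDimensional ℂ V] in
theorem precomp_mulI_sq :
    (precomp mulI : (V →L[ℝ] ℂ) →ₗ[ℂ] (V →L[ℝ] ℂ)) ∘ₗ precomp mulI = -LinearMap.id := by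
  ext α v
  have : (Complex.I • (Complex.I • v)) = -v := by
    rw [smul_smul, Complex.I_mul_I, neg_one_smul]
  simp [precomp, mulI, this]

/-- The automorphism of the covectors with eigenvalues `2` and `1/2` on the `(1,0)`- and the
`(0,1)`-covectors. -/
def bigradeCovector : (V →L[ℝ] ℂ) →ₗ[ℂ] (V →L[ℝ] ℂ) := (2 : ℂ) • proj10 + (2⁻¹ : ℂ) • proj01

omit [FiniteDimensional ℂ V] in
theorem precomp_mulI_mulI (α : V →L[ℝ] ℂ) : precomp mulI (precomp mulI α) = -α :=
  LinearMap.congr_fun precomp_mulI_sq α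

omit [FiniteDimensional ℂ V] in
theorem bigradeCovector_proj10 (α : V →L[ℝ] ℂ) :
    bigradeCovector (proj10 α) = (2 : ℂ) • proj10 α := by
  simp only [bigradeCovector, proj10, proj01, LinearMap.add_apply, LinearMap.smul_apply,
    LinearMap.sub_apply, LinearMap.id_apply, map_smul, map_sub, precomp_mulI_mulI]
  match_scalars <;> ring_nf
  simp
  norm_num

omit [FiniteDimensional ℂ V] in
theorem bigradeCovector_proj01 (α : V →L[ℝ] ℂ) :
    bigradeCovector (proj01 α) = (2⁻¹ : ℂ) • proj01 α := by
  simp only [bigradeCovector, proj10, proj01, LinearMap.add_apply, LinearMap.smul_apply,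
    LinearMap.sub_apply, LinearMap.id_apply, map_smul, map_add, precomp_mulI_mulI]
  match_scalars <;> ring_nf
  simp
  norm_num

/-- The automorphism has constant coefficients and so commutes with partial derivatives; only the
factors P(dx_i) contribute the eigenvalue `c`. -/
theorem pointwise_flatDeriv (P : (V →L[ℝ] ℂ) →ₗ[ℂ] (V →L[ℝ] ℂ)) (c : ℂ)
    (hP : ∀ α, bigradeCovector (P α) = c • P α) (a : SmoothForm Ω) :
    pointwise (ExteriorAlgebra.map bigradeCovector) (flatDeriv P a) =
      c • flatDeriv P (pointwise (ExteriorAlgebra.map bigradeCovector) a) := by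
  rw [flatDeriv_apply, flatDeriv_apply, map_sum, Finset.smul_sum]
  refine Finset.sum_congr rfl fun i _ => ?_
  rw [map_mul, pderiv_pointwise, ← smul_mul_assoc]
  congr 1
  refine SmoothForm.ext fun y => ?_
  rw [ev_pointwise, ev_constForm, ExteriorAlgebra.map_apply_ι, hP, map_smul, map_smul,
    ev_constForm]

/-- Each summand is a product of a constant covector and an odd form, so it squares to zero; the
summands are even and commute. -/
theorem flatDeriv_isNilpotent (P : (V →L[ℝ] ℂ) →ₗ[ℂ] (V →L[ℝ] ℂ)) (a : SmoothForm Ω)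
    (ha : parity a = -a) : IsNilpotent (flatDeriv P a) := by
  rw [flatDeriv_apply]
  have hι : ∀ i, parity (constForm (Ω := Ω) (ExteriorAlgebra.ι ℂ (P (coordCovector i)))) =
      -constForm (ExteriorAlgebra.ι ℂ (P (coordCovector i))) := fun i =>
    SmoothForm.ext fun y => by
          rw [ev_parity, map_neg]; exact parity_ι _
  have hp : ∀ i, parity (pderiv (Module.finBasis ℝ V i) a) =
      -pderiv (Module.finBasis ℝ V i) a := fun i => by
    rw [← map_neg, ← ha]; exact (pderiv_pointwise _ _ _).symm
  refine Commute.isNilpotent_sum (fun i _ => ⟨2, ?_⟩) fun i j _ _ => ?_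
  · have h0 : constForm (Ω := Ω) (ExteriorAlgebra.ι ℂ (P (coordCovector i))) *
        constForm (ExteriorAlgebra.ι ℂ (P (coordCovector i))) = 0 := by
      rw [← map_mul, ExteriorAlgebra.ι_sq_zero, map_zero]
    rw [pow_two, odd_anticomm _ _ (hι i) (hp i), neg_mul_neg, mul_assoc,
      ← mul_assoc (constForm _) (pderiv _ _), odd_anticomm _ _ (hι i) (hp i), neg_mul, mul_neg,
      mul_assoc, h0, mul_zero, mul_zero, neg_zero]
  · exact even_comm _ _ (by rw [map_mul, hι, hp, neg_mul_neg])

variable (Ω) in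
/-- The algebra of smooth forms with its operators `d`, `∂`, `∂̄`. -/
def dolbeault : Dolbeault (SmoothForm Ω) where
  d := flatDeriv LinearMap.id
  del := flatDeriv proj10
  delbar := flatDeriv proj01
  u := pointwise (ExteriorAlgebra.map bigradeCovector)
  d_eq a := by
    rw [← proj10_add_proj01]
    simp only [flatDeriv_apply, LinearMap.add_apply, map_add, add_mul, Finset.sum_add_distrib]
  d_sq := flatDeriv_sq _
  del_sq := flatDeriv_sq _
  u_parity a := SmoothForm.ext fun y => by
    rw [ev_pointwise, ev_parity, ev_parity, ev_pointwise]; exact parity_map _ _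
  u_del := pointwise_flatDeriv _ _ bigradeCovector_proj10
  u_delbar := pointwise_flatDeriv _ _ bigradeCovector_proj01
  isNilpotent_d := flatDeriv_isNilpotent _

/-- Smooth functions as forms of degree zero. -/
def funForm (g : V → ℂ) (hg : ContDiffOn ℝ ∞ g Ω) : SmoothForm Ω :=
  mkForm (fun y => algebraMap ℂ (FormAlg V) (g y))
    ((LinearMap.toContinuousLinearMap
      (Algebra.linearMap ℂ (FormAlg V))).restrictScalars ℝ |>.contDiff.comp_contDiffOn hg)

theorem sum_coordCovector (α : V →L[ℝ] ℂ) :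
    ∑ i, α (Module.finBasis ℝ V i) • coordCovector i = α := by
  ext v
  conv_rhs => rw [← (Module.finBasis ℝ V).sum_repr v, map_sum]
  simp [coordCovector, mul_comm]

theorem flatD_fun (P : (V →L[ℝ] ℂ) →ₗ[ℂ] (V →L[ℝ] ℂ)) {g : V → ℂ} {y : V}
    (hg : DifferentiableAt ℝ g y) :
    flatD P (fun z => algebraMap ℂ (FormAlg V) (g z)) y =
      ExteriorAlgebra.ι ℂ (P (fderiv ℝ g y)) := by
  have h := (((LinearMap.toContinuousLinearMap
      (Algebra.linearMap ℂ (FormAlg V))).restrictScalars ℝ).hasFDerivAt (x := g y)).comp y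
    hg.hasFDerivAt
  have h' : HasFDerivAt (fun z => algebraMap ℂ (FormAlg V) (g z)) _ y := h
  rw [flatD_eq P h'.differentiableAt]
  conv_rhs => rw [← sum_coordCovector (fderiv ℝ g y), map_sum, map_sum]
  refine Finset.sum_congr rfl fun i _ => ?_
  rw [h'.fderiv, map_smul, map_smul]
  exact ((Algebra.commutes (R := ℂ) (A := FormAlg V) _ _).symm.trans
    (Algebra.smul_def (R := ℂ) (A := FormAlg V) _ _).symm)

end Flat

/-! ## Evaluation of the Berezin integral -/

section BerezinEval

open SuperCommAlgebra

/-- Contraction is an odd derivation. The rule for a product with a single vector on the left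
propagates by induction on `x`. -/
theorem contractLeft_mul {M : Type*} [AddCommGroup M] [Module ℂ M] (d : Module.Dual ℂ M)
    (x y : ExteriorAlgebra ℂ M) :
    CliffordAlgebra.contractLeft (Q := (0 : QuadraticForm ℂ M)) d (x * y) =
      CliffordAlgebra.contractLeft (Q := (0 : QuadraticForm ℂ M)) d x * y +
        parity x * CliffordAlgebra.contractLeft (Q := (0 : QuadraticForm ℂ M)) d y := by
  induction x using ExteriorAlgebra.induction generalizing y with
  | algebraMap r =>
    rw [AlgHom.commutes]
    refine (CliffordAlgebra.contractLeft_algebraMap_mul _ r y).trans ?_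
    rw [CliffordAlgebra.contractLeft_algebraMap, zero_mul, zero_add]
  | ι w =>
    refine (CliffordAlgebra.contractLeft_ι_mul d w y).trans ?_
    rw [parity_ι, neg_mul, ← sub_eq_add_neg]
    congr 1
    refine (Algebra.smul_def _ _).trans ?_
    exact congrArg (· * y) (CliffordAlgebra.contractLeft_ι _ d w).symm
  | mul a b ha hb => rw [mul_assoc, ha, hb, ha, map_mul]; noncomm_ring
  | add a b ha hb => rw [add_mul, map_add, ha, hb, map_add, map_add]; noncomm_ring

variable {V : Type*} [NormedAddCommGroup V] [NormedSpace ℂ V] {m : ℕ}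

theorem contractGen_mul (j : Fin m) (x y : BigAlg V m) :
    contractGen j (x * y) = contractGen j x * y + parity x * contractGen j y :=
  contractLeft_mul _ x y

theorem contractGenDual_mul (j : Fin m) (x y : BigAlg V m) :
    contractGenDual j (x * y) = contractGenDual j x * y + parity x * contractGenDual j y :=
  contractLeft_mul _ x y

theorem contractGen_gen (i j : Fin m) :
    contractGen i (gen (V := V) j) = if i = j then 1 else 0 := by
  refine (CliffordAlgebra.contractLeft_ι _ _ _).trans ?_
  by_cases h : i = j
  · subst h; simp
  · simp [h]

theorem contractGen_genDual (i j : Fin m) : contractGen i (genDual (V := V) j) = 0 := by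
  refine (CliffordAlgebra.contractLeft_ι _ _ _).trans ?_
  simp

theorem contractGenDual_genDual (i j : Fin m) :
    contractGenDual i (genDual (V := V) j) = if i = j then 1 else 0 := by
  refine (CliffordAlgebra.contractLeft_ι _ _ _).trans ?_
  by_cases h : i = j
  · subst h; simp
  · simp [h]

theorem contractGenDual_gen (i j : Fin m) : contractGenDual i (gen (V := V) j) = 0 := by
  refine (CliffordAlgebra.contractLeft_ι _ _ _).trans ?_
  simp

theorem incl_ι (α : V →L[ℝ] ℂ) :
    incl (m := m) (ExteriorAlgebra.ι ℂ α) = ExteriorAlgebra.ι ℂ (α, 0, 0) :=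
  ExteriorAlgebra.map_apply_ι _ _

theorem contractGen_incl (j : Fin m) (a : FormAlg V) : contractGen j (incl a) = 0 := by
  induction a using ExteriorAlgebra.induction with
  | algebraMap r => rw [AlgHom.commutes]; exact CliffordAlgebra.contractLeft_algebraMap _ _ r
  | ι w => rw [incl_ι]; refine (CliffordAlgebra.contractLeft_ι _ _ _).trans ?_; simp
  | mul a b ha hb => rw [map_mul, contractGen_mul, ha, hb, zero_mul, mul_zero, add_zero]
  | add a b ha hb => rw [map_add, map_add, ha, hb, add_zero]

theorem contractGenDual_incl (j : Fin m) (a : FormAlg V) : contractGenDual j (incl a) = 0 := by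
  induction a using ExteriorAlgebra.induction with
  | algebraMap r => rw [AlgHom.commutes]; exact CliffordAlgebra.contractLeft_algebraMap _ _ r
  | ι w => rw [incl_ι]; refine (CliffordAlgebra.contractLeft_ι _ _ _).trans ?_; simp
  | mul a b ha hb => rw [map_mul, contractGenDual_mul, ha, hb, zero_mul, mul_zero, add_zero]
  | add a b ha hb => rw [map_add, map_add, ha, hb, add_zero]

theorem parity_incl (a : FormAlg V) : parity (incl (m := m) a) = incl (parity a) :=
  (parity_map _ a).symm

theorem parity_gen (j : Fin m) : parity (gen (V := V) j) = -gen j := parity_ι _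

theorem parity_genDual (j : Fin m) : parity (genDual (V := V) j) = -genDual j := parity_ι _

/-- The contraction with `e_j` followed by the contraction with `e_j^*`. -/
abbrev contractPair (j : Fin m) : BigAlg V m →ₗ[ℂ] BigAlg V m :=
  contractGenDual j * contractGen j

theorem contractPair_incl_mul (j : Fin m) (a : FormAlg V) (x : BigAlg V m) :
    contractPair j (incl a * x) = incl a * contractPair j x := by
  rw [Module.End.mul_apply, contractGen_mul, contractGen_incl, zero_mul, zero_add,
    contractGenDual_mul, parity_incl, contractGenDual_incl, zero_mul, zero_add, parity_incl,
    parity_parity]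
  rfl

theorem berezin_apply (x : BigAlg V m) :
    berezin x = ExteriorAlgebra.map (LinearMap.fst ℂ (V →L[ℝ] ℂ) ((Fin m → ℂ) × (Fin m → ℂ)))
      (((List.finRange m).map contractPair).prod x) := rfl

/-- Contractions annihilate forms, and contracting in pairs cancels the parity signs; so forms on X
can be pulled out on the left. -/
theorem berezin_incl_mul (a : FormAlg V) (x : BigAlg V m) :
    berezin (incl a * x) = a * berezin x := by
  have h : ∀ l : List (Fin m), (l.map contractPair).prod (incl a * x) =
      incl a * (l.map contractPair).prod x := fun l => by
    induction l with
    | nil => rfl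
    | cons j l ih =>
      rw [List.map_cons, List.prod_cons, Module.End.mul_apply, ih, contractPair_incl_mul]
      rfl
  rw [berezin_apply, h, map_mul, berezin_apply]
  congr 1
  have h2 : (ExteriorAlgebra.map (LinearMap.fst ℂ (V →L[ℝ] ℂ)
      ((Fin m → ℂ) × (Fin m → ℂ)))).comp (incl (m := m)) = AlgHom.id ℂ _ := by
    rw [incl, ExteriorAlgebra.map_comp_map]
    exact ExteriorAlgebra.map_id
  exact congrArg (fun φ : FormAlg V →ₐ[ℂ] FormAlg V => φ a) h2

theorem contractGen_comm_pair (i j : Fin m) (x : BigAlg V m) :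
    contractGen i (contractPair j x) = contractPair j (contractGen i x) := by
  have h1 : contractGen i (contractGenDual j (contractGen j x)) =
      -contractGenDual j (contractGen i (contractGen j x)) :=
    CliffordAlgebra.contractLeft_comm _ _ _
  have h2 : contractGen i (contractGen j x) = -contractGen j (contractGen i x) :=
    CliffordAlgebra.contractLeft_comm _ _ _
  rw [Module.End.mul_apply, h1, h2, map_neg, neg_neg]
  rfl

/-- The contraction with e_j commutes with every pair of contractions, so when its pair is reached
it may be taken to act on `x` itself. -/
theorem berezin_eq_zero {x : BigAlg V m} (j : Fin m) (h : contractGen j x = 0) :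
    berezin x = 0 := by
  have hc : ∀ l : List (Fin m), contractGen j ((l.map contractPair).prod x) = 0 := fun l => by
    induction l with
    | nil => exact h
    | cons i l ih =>
      rw [List.map_cons, List.prod_cons, Module.End.mul_apply, contractGen_comm_pair, ih, map_zero]
  have hl : ∀ l : List (Fin m), j ∈ l → (l.map contractPair).prod x = 0 := fun l hjl => by
    induction l with
    | nil => simp at hjl
    | cons i l ih =>
      rw [List.map_cons, List.prod_cons, Module.End.mul_apply]
      rcases List.mem_cons.mp hjl with rfl | h'
      · rw [Module.End.mul_apply, hc, map_zero]
      · rw [ih h', map_zero]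
  rw [berezin_apply, hl _ (List.mem_finRange j), map_zero]

/-! ### The exponential series -/

theorem expSeries_eq_sum (s : ℕ) {x : BigAlg V m} {N : ℕ} (h : x ^ N = 0) :
    expSeries s x = ∑ l ∈ Finset.range N, ((Nat.factorial (l + s) : ℂ)⁻¹) • x ^ l := by
  rw [expSeries]
  refine finsum_eq_sum_of_support_subset _ fun l hl => ?_
  rw [Finset.coe_range, Set.mem_Iio]
  by_contra hN
  exact hl (by simp only [pow_eq_zero_of_le (not_lt.mp hN) h, smul_zero])

theorem expSeries_zero_eq_exp {x : BigAlg V m} (h : IsNilpotent x) :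
    expSeries 0 x = IsNilpotent.exp x := by
  obtain ⟨N, hN⟩ := h
  rw [expSeries_eq_sum 0 hN, IsNilpotent.exp_eq_sum hN]
  refine Finset.sum_congr rfl fun l _ => ?_
  rw [add_zero]
  rw [← algebraMap_smul ℂ ((Nat.factorial l : ℚ)⁻¹)]
  simp

/-! ### Elements associated with matrices -/

/-- The element `∑ A_jk ∧ e_j ∧ e_k^*` associated with a form-valued endomorphism. -/
def tilde : Matrix (Fin m) (Fin m) (FormAlg V) →ₗ[ℂ] BigAlg V m where
  toFun a := ∑ j, ∑ k, incl (a j k) * gen j * genDual k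
  map_add' a b := by
    simp only [Matrix.add_apply, map_add, add_mul, Finset.sum_add_distrib]
  map_smul' c a := by
    simp only [Matrix.smul_apply, map_smul, smul_mul_assoc, Finset.smul_sum, RingHom.id_apply]

theorem tilde_apply (a : Matrix (Fin m) (Fin m) (FormAlg V)) :
    tilde a = ∑ j, ∑ k, incl (a j k) * gen j * genDual k := rfl

theorem tilde_one : tilde (1 : Matrix (Fin m) (Fin m) (FormAlg V)) = idTilde := by
  rw [tilde_apply, idTilde]
  refine Finset.sum_congr rfl fun j _ => ?_
  rw [Finset.sum_eq_single j]
  · rw [Matrix.one_apply_eq, map_one, one_mul]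
  · intro k _ hk
    rw [Matrix.one_apply_ne hk.symm, map_zero, zero_mul, zero_mul]
  · simp

theorem gen_sq (j : Fin m) : gen (V := V) j * gen j = 0 := ExteriorAlgebra.ι_sq_zero _

/-- The even element `a ∧ e_j ∧ e_k^*`. -/
def evenTerm (a : evenSub (FormAlg V)) (j k : Fin m) : evenSub (BigAlg V m) :=
  ⟨incl (a : FormAlg V) * gen j * genDual k, by
    change parity _ = _
    rw [map_mul, map_mul, parity_incl, parity_coe, parity_gen, parity_genDual, mul_neg,
      mul_neg, neg_mul, neg_neg]
    rfl⟩

theorem evenTerm_eq (a : evenSub (FormAlg V)) (j k : Fin m) :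
    evenTerm a j k = evenMap incl (fun x => (parity_incl x).symm) a * evenTerm 1 j k :=
  Subtype.ext (by
    change incl (a : FormAlg V) * gen j * genDual k =
      incl (a : FormAlg V) * (incl (1 : FormAlg V) * gen j * genDual k)
    rw [map_one, one_mul, mul_assoc])

/-- Only the dual generators are exchanged, and they anticommute. This rule among commuting elements
is what produces the signs of a determinant. -/
theorem evenTerm_one_mul (i j k l : Fin m) :
    evenTerm (V := V) 1 i k * evenTerm 1 j l = -(evenTerm 1 i l * evenTerm 1 j k) :=
  Subtype.ext (by
    change incl (1 : FormAlg V) * gen i * genDual k * (incl (1 : FormAlg V) * gen j * genDual l) =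
      -(incl (1 : FormAlg V) * gen i * genDual l * (incl (1 : FormAlg V) * gen j * genDual k))
    rw [map_one, one_mul, one_mul]
    have h1 : ∀ a b : Fin m, genDual (V := V) a * gen b = -(gen b * genDual a) := fun a b =>
      odd_anticomm _ _ (parity_genDual a) (parity_gen b)
    have h2 : genDual (V := V) k * genDual l = -(genDual l * genDual k) :=
      odd_anticomm _ _ (parity_genDual k) (parity_genDual l)
    rw [mul_assoc, ← mul_assoc (genDual k), h1, neg_mul, mul_assoc (gen j), h2, mul_assoc (gen i),
      ← mul_assoc (genDual l), h1, neg_mul, mul_assoc (gen j)]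
    simp only [mul_neg, neg_neg])

theorem evenTerm_one_mul_self (i j k : Fin m) :
    evenTerm (V := V) 1 i k * evenTerm 1 j k = 0 := by
  have h := evenTerm_one_mul (V := V) i j k k
  have h2 : (2 : ℂ) • (evenTerm (V := V) 1 i k * evenTerm 1 j k) = 0 := by
    rw [two_smul]; exact add_eq_zero_iff_eq_neg.mpr h
  exact (smul_eq_zero.mp h2).resolve_left two_ne_zero

theorem coe_sum_evenTerm (N : Matrix (Fin m) (Fin m) (evenSub (FormAlg V))) :
    ((∑ j, ∑ k, evenTerm (N j k) j k : evenSub (BigAlg V m)) : BigAlg V m) = tilde (mco N) := by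
  simp only [AddSubmonoidClass.coe_finsetSum]
  rfl

theorem mul_mul_eq_zero_of_mul_eq_zero {R : Type*} [CommRing R] (a b : R) {x y : R}
    (h : x * y = 0) : a * x * (b * y) = 0 := by
  rw [mul_mul_mul_comm, h, mul_zero]

theorem evenTerm_row_sq (N : Matrix (Fin m) (Fin m) (evenSub (FormAlg V))) (j : Fin m) :
    (∑ k, evenTerm (N j k) j k) * (∑ k, evenTerm (N j k) j k) = 0 := by
  rw [Finset.sum_mul_sum]
  refine Finset.sum_eq_zero fun k _ => Finset.sum_eq_zero fun l _ => ?_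
  rw [evenTerm_eq, evenTerm_eq (N j l)]
  have h : evenTerm (V := V) 1 j k * evenTerm 1 j l = 0 := Subtype.ext (by
    change incl (1 : FormAlg V) * gen j * genDual k *
      (incl (1 : FormAlg V) * gen j * genDual l) = 0
    rw [map_one, one_mul, mul_assoc, ← mul_assoc (genDual k),
      odd_anticomm _ _ (parity_genDual k) (parity_gen j), neg_mul, mul_neg, ← mul_assoc,
      ← mul_assoc, gen_sq, zero_mul, zero_mul, neg_zero])
  exact mul_mul_eq_zero_of_mul_eq_zero _ _ h

theorem isNilpotent_tilde (N : Matrix (Fin m) (Fin m) (evenSub (FormAlg V))) :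
    IsNilpotent (tilde (mco N)) := by
  rw [← coe_sum_evenTerm]
  have h : ∀ j, IsNilpotent (∑ k, evenTerm (N j k) j k) := fun j =>
    ⟨2, by rw [pow_two, evenTerm_row_sq]⟩
  exact (isNilpotent_sum fun j _ => h j).map (evenSub (BigAlg V m)).val

/-- The elements commute, so the exponential is multiplicative, and each factor stops after the
linear term. -/
theorem exp_sum_of_sq_zero {R ι : Type*} [CommRing R] [Module ℚ R] [DecidableEq ι] (s : Finset ι)
    (p : ι → R) (hp : ∀ i, p i * p i = 0) :
    IsNilpotent.exp (∑ i ∈ s, p i) = ∏ i ∈ s, (1 + p i) := by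
  have h2 : ∀ i, p i ^ 2 = 0 := fun i => by rw [pow_two, hp]
  induction s using Finset.induction_on with
  | empty => simp [IsNilpotent.exp_zero]
  | insert a s ha ih =>
    rw [Finset.sum_insert ha, Finset.prod_insert ha, IsNilpotent.exp_add_of_commute
      (Commute.all _ _) ⟨2, h2 a⟩ (isNilpotent_sum fun i _ => ⟨2, h2 i⟩), ih,
      IsNilpotent.exp_eq_sum (h2 a)]
    simp [Finset.sum_range_succ]

end BerezinEval

/-! ### The Berezin integral of an exponential as a determinant. -/

section BerezinExp

open SuperCommAlgebra

variable {V : Type*} [NormedAddCommGroup V] [NormedSpace ℂ V] {m : ℕ}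

theorem prod_comp_swap_eq_neg {R : Type*} [CommRing R] (E : Fin m → Fin m → R)
    (hE : ∀ i j k l, E i k * E j l = -(E i l * E j k)) (τ : Equiv.Perm (Fin m)) {i j : Fin m}
    (hij : i ≠ j) : ∏ k, E k ((τ * Equiv.swap i j) k) = -∏ k, E k (τ k) := by
  have hsplit : ∀ g : Fin m → R, ∏ k, g k = g i * g j * ∏ k ∈ (Finset.univ.erase i).erase j, g k :=
    fun g => by
    rw [mul_assoc, Finset.mul_prod_erase _ _ (by simp [hij.symm]), Finset.mul_prod_erase _ _
      (Finset.mem_univ i)]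
  rw [hsplit, hsplit fun k => E k (τ k), Equiv.Perm.mul_apply, Equiv.Perm.mul_apply,
    Equiv.swap_apply_left, Equiv.swap_apply_right, hE, neg_mul]
  congr 2
  refine Finset.prod_congr rfl fun k hk => ?_
  simp only [Finset.mem_erase, Finset.mem_univ, and_true] at hk
  rw [Equiv.Perm.mul_apply, Equiv.swap_apply_of_ne_of_ne hk.2 hk.1]

theorem prod_comp_perm {R : Type*} [CommRing R] (E : Fin m → Fin m → R)
    (hE : ∀ i j k l, E i k * E j l = -(E i l * E j k)) (τ : Equiv.Perm (Fin m)) :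
    ∏ k, E k (τ k) = ((Equiv.Perm.sign τ : ℤ) : R) * ∏ k, E k k := by
  induction τ using Equiv.Perm.swap_induction_on' with
  | one => simp
  | mul_swap τ i j hij ih =>
    rw [prod_comp_swap_eq_neg E hE τ hij, ih, Equiv.Perm.sign_mul, Equiv.Perm.sign_swap hij]
    push_cast
    ring

theorem prod_comp_eq_zero {R : Type*} [CommRing R] (E : Fin m → Fin m → R)
    (hE : ∀ i j k, E i k * E j k = 0) {κ : Fin m → Fin m} (hκ : ¬Function.Injective κ) :
    ∏ k, E k (κ k) = 0 := by
  simp only [Function.Injective, not_forall] at hκ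
  obtain ⟨i, j, hk, hij⟩ := hκ
  rw [← Finset.mul_prod_erase _ _ (Finset.mem_univ i), ← Finset.mul_prod_erase _ _
    (show j ∈ Finset.univ.erase i by simp [Ne.symm hij]), ← mul_assoc, hk, hE, zero_mul]

/-- A product of row sums is a determinant times the product of the diagonal entries. -/
theorem prod_sum_eq_det {R : Type*} [CommRing R] (N : Matrix (Fin m) (Fin m) R)
    (E : Fin m → Fin m → R) (hE : ∀ i j k l, E i k * E j l = -(E i l * E j k))
    (hE0 : ∀ i j k, E i k * E j k = 0) :
    ∏ j, ∑ k, N j k * E j k = N.det * ∏ j, E j j := by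
  rw [Finset.prod_univ_sum, Fintype.piFinset_univ, ← Matrix.det_transpose, Matrix.det_apply',
    Finset.sum_mul]
  symm
  refine Fintype.sum_of_injective (fun τ : Equiv.Perm (Fin m) => (τ : Fin m → Fin m))
    DFunLike.coe_injective _ _ (fun κ hκ => ?_) fun τ => ?_
  · rw [Finset.prod_mul_distrib, prod_comp_eq_zero E hE0, mul_zero]
    intro hinj
    exact hκ ⟨Equiv.ofBijective κ (Finite.injective_iff_bijective.mp hinj), rfl⟩
  · rw [Finset.prod_mul_distrib, prod_comp_perm E hE]
    simp only [Matrix.transpose_apply]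
    ring

theorem contractGen_evenTerm {i j : Fin m} (hij : i ≠ j) (a : evenSub (FormAlg V)) (k : Fin m) :
    contractGen i (evenTerm a j k : BigAlg V m) = 0 := by
  change contractGen i (incl (a : FormAlg V) * gen j * genDual k) = 0
  rw [contractGen_mul, contractGen_mul, contractGen_incl, contractGen_gen, if_neg hij,
    contractGen_genDual, zero_mul, mul_zero, mul_zero, add_zero, add_zero, zero_mul]

theorem contractPair_evenTerm_mul {i j : Fin m} (hij : i ≠ j) (x : BigAlg V m) :
    contractPair i ((evenTerm (V := V) 1 j j : BigAlg V m) * x) =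
      (evenTerm (V := V) 1 j j : BigAlg V m) * contractPair i x := by
  have h1 : contractGen i (evenTerm (V := V) 1 j j : BigAlg V m) = 0 :=
    contractGen_evenTerm hij 1 j
  have h2 : contractGenDual i (evenTerm (V := V) 1 j j : BigAlg V m) = 0 := by
    change contractGenDual i (incl (1 : FormAlg V) * gen j * genDual j) = 0
    rw [contractGenDual_mul, contractGenDual_mul, contractGenDual_incl, contractGenDual_gen,
      contractGenDual_genDual, if_neg hij, zero_mul, mul_zero, mul_zero, add_zero, add_zero,
      zero_mul]
  rw [Module.End.mul_apply, contractGen_mul, h1, zero_mul, zero_add, parity_coe,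
    contractGenDual_mul, h2, zero_mul, zero_add, parity_coe]
  rfl

theorem contractPair_evenTerm (j : Fin m) :
    contractPair j (evenTerm (V := V) 1 j j : BigAlg V m) = 1 := by
  change contractGenDual j (contractGen j (incl (1 : FormAlg V) * gen j * genDual j)) = 1
  rw [map_one, one_mul, contractGen_mul, contractGen_gen, if_pos rfl, one_mul,
    contractGen_genDual, mul_zero, add_zero, contractGenDual_genDual, if_pos rfl]

theorem berezin_prod_evenTerm :
    berezin ((∏ j, evenTerm (V := V) 1 j j : evenSub (BigAlg V m)) : BigAlg V m) = 1 := by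
  have h0 : ∀ (l : List (Fin m)) (j : Fin m), j ∉ l → ∀ x : BigAlg V m,
      (l.map contractPair).prod ((evenTerm (V := V) 1 j j : BigAlg V m) * x) =
        (evenTerm (V := V) 1 j j : BigAlg V m) * (l.map contractPair).prod x := fun l j hj x => by
    induction l with
    | nil => rfl
    | cons i l ih =>
      rw [List.mem_cons, not_or] at hj
      rw [List.map_cons, List.prod_cons, Module.End.mul_apply, ih hj.2,
        contractPair_evenTerm_mul (Ne.symm hj.1)]
      rfl
  have h1 : ∀ l : List (Fin m), l.Nodup → (l.map contractPair).prod
      ((l.map fun j => (evenTerm (V := V) 1 j j : BigAlg V m)).prod) = 1 := fun l hl => by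
    induction l with
    | nil => rfl
    | cons j l ih =>
      rw [List.nodup_cons] at hl
      rw [List.map_cons, List.map_cons, List.prod_cons, List.prod_cons, Module.End.mul_apply,
        h0 l j hl.1, ih hl.2, mul_one, contractPair_evenTerm]
  have h2 : ((∏ j, evenTerm (V := V) 1 j j : evenSub (BigAlg V m)) : BigAlg V m) =
      ((List.finRange m).map fun j => (evenTerm (V := V) 1 j j : BigAlg V m)).prod := by
    rw [← List.prod_ofFn, List.ofFn_eq_map]
    refine (map_list_prod (evenSub (BigAlg V m)).val _).trans ?_
    rw [List.map_map]
    rfl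
  rw [berezin_apply, h2, h1 _ (List.nodup_finRange m), map_one]

/-- The evaluation of the integral of an exponential. -/
theorem berezin_exp (N : Matrix (Fin m) (Fin m) (evenSub (FormAlg V))) :
    berezin (IsNilpotent.exp (tilde (mco N))) = (N.det : FormAlg V) := by
  set p : Fin m → evenSub (BigAlg V m) := fun j => ∑ k, evenTerm (N j k) j k with hp
  have hp2 : ∀ j, p j * p j = 0 := evenTerm_row_sq N
  have hnil : IsNilpotent (∑ j, p j) := isNilpotent_sum fun j _ => ⟨2, by rw [pow_two, hp2]⟩
  -- Every summand of `p j` contains the generator e_j, so `p j` squares to zero and the exponential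
  -- is a product over rows.
  have h1 : IsNilpotent.exp (tilde (mco N)) = ((∏ j, (1 + p j) : evenSub (BigAlg V m)) :
      BigAlg V m) := by
    rw [← coe_sum_evenTerm, ← exp_sum_of_sq_zero _ p hp2]
    exact (IsNilpotent.map_exp hnil (evenSub (BigAlg V m)).val).symm
  set ψ := evenMap (incl (V := V) (m := m)) (fun x => (parity_incl x).symm)
  have h2 : ∏ j, p j = ψ N.det * ∏ j, evenTerm 1 j j := by
    have h3 : ∏ j, p j = ∏ j, ∑ k, (N.map ψ) j k * evenTerm 1 j k :=
      Finset.prod_congr rfl fun j _ => Finset.sum_congr rfl fun k _ => evenTerm_eq _ _ _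
    rw [h3, prod_sum_eq_det _ _ evenTerm_one_mul evenTerm_one_mul_self]
    congr 1
    exact (AlgHom.map_det ψ N).symm
  -- A product over a proper subset of rows misses some e_i, so it does not contribute to the
  -- integral.
  have h4 : ∀ t : Finset (Fin m), t ≠ Finset.univ →
      berezin ((∏ j ∈ t, p j : evenSub (BigAlg V m)) : BigAlg V m) = 0 := fun t ht => by
    obtain ⟨i, hi⟩ : ∃ i, i ∉ t := by
      by_contra! h
      exact ht (Finset.eq_univ_of_forall h)
    refine berezin_eq_zero i ?_
    refine Finset.prod_induction p
      (fun x : evenSub (BigAlg V m) => contractGen i (x : BigAlg V m) = 0) ?_ ?_ ?_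
    · intro a b ha hb
      change contractGen i ((a : BigAlg V m) * (b : BigAlg V m)) = 0
      rw [contractGen_mul, ha, hb, zero_mul, mul_zero, add_zero]
    · have := contractGen_incl (V := V) i 1
      rwa [map_one] at this
    · intro j hj
      have hij : i ≠ j := fun h => hi (h ▸ hj)
      rw [hp]
      simp only [AddSubmonoidClass.coe_finsetSum, map_sum]
      exact Finset.sum_eq_zero fun k _ => contractGen_evenTerm hij _ _
  rw [h1, Finset.prod_one_add]
  simp only [AddSubmonoidClass.coe_finsetSum, map_sum]
  rw [Finset.sum_eq_single Finset.univ (fun t _ ht => h4 t ht) (fun h => by simp at h), h2]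
  refine (berezin_incl_mul (N.det : FormAlg V) _).trans ?_
  rw [berezin_prod_evenTerm, mul_one]

theorem tilde_add_single (N : Matrix (Fin m) (Fin m) (evenSub (FormAlg V))) (j k : Fin m) :
    tilde (mco (N.updateRow j (N j + Pi.single k 1))) =
      tilde (mco N) + (evenTerm (V := V) 1 j k : BigAlg V m) := by
  have h : N.updateRow j (N j + Pi.single k 1) = N + Matrix.single j k 1 := by
    ext1 i l
    rw [Matrix.updateRow_apply, Matrix.add_apply]
    by_cases hi : i = j
    · subst hi
      by_cases hl : l = k
      · subst hl; simp
      · simp [hl, Ne.symm hl]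
    · simp [hi, Ne.symm hi]
  rw [h, mco_add, map_add]
  congr 1
  rw [tilde_apply, Finset.sum_eq_single j, Finset.sum_eq_single k]
  · simp [evenTerm]
  · intro l _ hl
    simp [Ne.symm hl]
  · simp
  · intro l _ hl
    simp [Ne.symm hl]
  · simp

theorem exp_eq_one_add_of_sq_zero {A : Type*} [Ring A] [Module ℚ A] {a : A} (h : a ^ 2 = 0) :
    IsNilpotent.exp a = 1 + a := by
  rw [IsNilpotent.exp_eq_sum h]
  simp [Finset.sum_range_succ]

/-- Compare `berezin_exp` for `N` and for `N` with its (j, k) entry raised by 1. The exponential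
gains the factor 1 + e_j∧e_k^*, and the determinant gains the corresponding cofactor. -/
theorem berezin_evenTerm_mul_exp (N : Matrix (Fin m) (Fin m) (evenSub (FormAlg V)))
    (j k : Fin m) :
    berezin ((evenTerm (V := V) 1 j k : BigAlg V m) * IsNilpotent.exp (tilde (mco N))) =
      (N.adjugate k j : FormAlg V) := by
  have h1 := berezin_exp (N.updateRow j (N j + Pi.single k 1))
  have hsq : (evenTerm (V := V) 1 j k : BigAlg V m) ^ 2 = 0 := by
    rw [pow_two]
    exact congrArg Subtype.val (evenTerm_one_mul_self j j k)
  rw [tilde_add_single, add_comm, IsNilpotent.exp_add_of_commute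
    (SuperCommAlgebra.even_comm _ _ (parity_coe _)) ⟨2, hsq⟩ (isNilpotent_tilde N),
    exp_eq_one_add_of_sq_zero hsq, Matrix.det_updateRow_add, Matrix.updateRow_eq_self, add_mul,
    one_mul, map_add, berezin_exp] at h1
  rw [Matrix.adjugate_apply]
  exact add_left_cancel h1

theorem berezin_tilde_mul_exp (N : Matrix (Fin m) (Fin m) (evenSub (FormAlg V)))
    (a : Matrix (Fin m) (Fin m) (FormAlg V)) :
    berezin (tilde a * IsNilpotent.exp (tilde (mco N))) = (mco N.adjugate * a).trace := by
  have h : ∀ j k, berezin (incl (a j k) * gen j * genDual k * IsNilpotent.exp (tilde (mco N))) =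
      (N.adjugate k j : FormAlg V) * a j k := fun j k => by
    have h1 : incl (a j k) * gen j * genDual k =
        incl (a j k) * (evenTerm (V := V) 1 j k : BigAlg V m) := by
      change _ = incl (a j k) * (incl (1 : FormAlg V) * gen j * genDual k)
      rw [map_one, one_mul, mul_assoc]
    rw [h1, mul_assoc, berezin_incl_mul, berezin_evenTerm_mul_exp]
    exact (even_comm _ _ (parity_coe _)).symm
  rw [tilde_apply, Finset.sum_mul, map_sum, Matrix.trace]
  simp only [Finset.sum_mul, map_sum, h, Matrix.diag_apply, Matrix.mul_apply, Matrix.map_apply]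
  exact Finset.sum_comm

/-- For each complex t, `berezin_tilde_mul_exp` at N + tB equates tr(adj(N + tB)·a) with the
integral of ã·exp(Ñ)·exp(tB̃), since the exponents commute. Comparing powers t^k and weighting by
1/(k+1) gives the unit integral on one side and turns 1/k! into 1/(k+1)! on the other. -/
theorem berezin_tilde_mul_expSeries (N B : Matrix (Fin m) (Fin m) (evenSub (FormAlg V)))
    (a : Matrix (Fin m) (Fin m) (FormAlg V)) :
    berezin (tilde a * expSeries 0 (tilde (mco N)) * expSeries 1 (tilde (mco B))) =
      (mco (adjIntegral N B) * a).trace := by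
  obtain ⟨N₁, hN₁⟩ := exists_natDegree_lt (pencil N B).adjugate
  obtain ⟨N₂, hN₂⟩ := isNilpotent_tilde B
  set K := N₁ + N₂
  have hW : ∀ i j, ((pencil N B).adjugate i j).natDegree < K := fun i j => by
    have := hN₁ i j; omega
  have hK : tilde (mco B) ^ K = 0 := pow_eq_zero_of_le (Nat.le_add_left _ _) hN₂
  set α : ℕ → FormAlg V := fun k =>
    (mco ((pencil N B).adjugate.map (Polynomial.coeff · k)) * a).trace
  set β : ℕ → FormAlg V := fun k => berezin (tilde a * IsNilpotent.exp (tilde (mco N)) *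
    (((Nat.factorial k : ℂ)⁻¹) • tilde (mco B) ^ k))
  have hcoeff : ∀ k < K, β k - α k = 0 := by
    refine eq_zero_of_forall_sum_pow_smul _ K fun t => ?_
    have h1 := berezin_tilde_mul_exp (N + t • B) a
    have hcomm : Commute (tilde (mco N)) (t • tilde (mco B)) := by
      refine Commute.smul_right ?_ t
      rw [← coe_sum_evenTerm]
      exact even_comm _ _ (parity_coe _)
    have htK : (t • tilde (mco B)) ^ K = 0 := by rw [smul_pow, hK, smul_zero]
    rw [mco_add, mco_smul, map_add, map_smul, IsNilpotent.exp_add_of_commute hcomm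
      (isNilpotent_tilde N) ⟨K, htK⟩, ← expSeries_zero_eq_exp ⟨K, htK⟩, expSeries_eq_sum 0 htK,
      ← mul_assoc, Finset.mul_sum, map_sum] at h1
    have h2 : (N + t • B).adjugate = (pencil N B).adjugate.map
        (Polynomial.eval (algebraMap ℂ _ t)) := by
      have h3 : N + t • B = (Polynomial.evalRingHom (algebraMap ℂ _ t)).mapMatrix (pencil N B) := by
        ext1 i j
        have h4 : (t • B) i j = algebraMap ℂ _ t * B i j := Algebra.smul_def t (B i j)
        rw [Matrix.add_apply, h4, RingHom.mapMatrix_apply, Matrix.map_apply, pencil,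
          Matrix.add_apply, Matrix.smul_apply, Matrix.map_apply, Matrix.map_apply, smul_eq_mul]
        simp only [map_add, map_mul, Polynomial.coe_evalRingHom, Polynomial.eval_C,
          Polynomial.eval_X]
      rw [h3, ← RingHom.map_adjugate]
      rfl
    rw [h2, trace_mco_map hW a (fun k => t ^ k) _ fun p hp => eval_algebraMap_eq_sum t hp] at h1
    simp only [smul_sub, Finset.sum_sub_distrib]
    rw [← h1, sub_eq_zero]
    refine Finset.sum_congr rfl fun k _ => ?_
    rw [add_zero, smul_pow, ← map_smul, ← mul_smul_comm]
    congr 2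
    rw [smul_comm]
  rw [expSeries_zero_eq_exp (isNilpotent_tilde N), expSeries_eq_sum 1 hK, adjIntegral,
    trace_mco_map hW a _ _ fun p hp => unitIntegral_eq_sum p hp, Finset.mul_sum, map_sum]
  refine Finset.sum_congr rfl fun k hk => ?_
  have h4 := sub_eq_zero.mp (hcoeff k (Finset.mem_range.mp hk))
  change _ = _ • α k
  rw [← h4, ← map_smul, ← mul_smul_comm, smul_smul, Nat.factorial_succ]
  congr 3
  push_cast
  rw [mul_inv]

/-- The constant `c` is the sign for moving e_j past the coefficients of the second factor: 1 for
the functions σ_k, -1 for the one-forms ∂̄σ_k. The latter absorbs the minus sign in front of ℵ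
Df∧∂̄σ. -/
theorem row_mul_row (ξ η : Fin m → FormAlg V) (c : ℂ)
    (hη : ∀ k (j : Fin m), gen j * incl (η k) = c • (incl (η k) * gen j)) :
    (∑ j, incl (ξ j) * gen j) * (∑ k, incl (η k) * genDual k) =
      c • tilde (Matrix.of fun j k => ξ j * η k) := by
  rw [Finset.sum_mul_sum, tilde_apply, Finset.smul_sum]
  refine Finset.sum_congr rfl fun j _ => ?_
  rw [Finset.smul_sum]
  refine Finset.sum_congr rfl fun k _ => ?_
  rw [← mul_assoc, mul_assoc (incl (ξ j)), hη, mul_smul_comm, smul_mul_assoc, Matrix.of_apply,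
    map_mul]
  simp only [mul_assoc]

theorem of_mul_eq {A l n : Type*} [Ring A] (ξ : Matrix l Unit A) (η : Matrix Unit n A) :
    (Matrix.of fun j k => ξ j () * η () k) = ξ * η := by
  ext i j
  simp [Matrix.mul_apply]

/-- The Berezin integral defining the Berndtsson form in terms of matrices of forms. -/
theorem berezin_eq_berndtsson (Θ : Matrix (Fin m) (Fin m) (FormAlg V))
    (ξ : Matrix (Fin m) Unit (FormAlg V)) (σ η : Matrix Unit (Fin m) (FormAlg V))
    (hΘ : MEven Θ) (hξ : MOdd ξ) (hσ : MEven σ) (hη : MOdd η) :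
    berezin ((aleph • ∑ j, incl (ξ j ()) * gen j) * (∑ k, incl (σ () k) * genDual k) *
      expSeries 0 (idTilde + aleph • tilde Θ) *
      expSeries 1 (-(aleph • ((∑ j, incl (ξ j ()) * gen j) * ∑ k, incl (η () k) * genDual k)))) =
      berndtsson Θ ξ σ η := by
  have h1 : ∀ k (j : Fin m), gen (V := V) j * incl (σ () k) = (1 : ℂ) • (incl (σ () k) * gen j) :=
    fun k j => by
    rw [one_smul]
    exact (even_comm _ _ (by rw [parity_incl, hσ.apply])).symm
  have h2 : ∀ k (j : Fin m), gen (V := V) j * incl (η () k) = (-1 : ℂ) • (incl (η () k) * gen j) :=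
    fun k j => by
    rw [neg_one_smul]
    exact odd_anticomm _ _ (parity_gen j) (by rw [parity_incl, hη.apply, map_neg])
  rw [smul_mul_assoc, row_mul_row _ _ 1 h1, one_smul, row_mul_row _ _ (-1) h2, neg_one_smul,
    smul_neg, neg_neg, of_mul_eq, of_mul_eq, ← tilde_one, ← map_smul, ← map_smul, ← map_smul,
    ← map_add, berndtsson, ← berezin_tilde_mul_expSeries, mco_mev, mco_mev]
  · exact (hξ.mul hη).smul _
  · exact mEven_one.add (hΘ.smul _)

end BerezinExp

/-! ## Forms on a manifold in charts -/

section Charts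

open SuperCommAlgebra TopologicalSpace

variable {V : Type*} [NormedAddCommGroup V] [NormedSpace ℂ V]

/-- A complex manifold is a real manifold. -/
theorem isManifold_real (X : Type*) [TopologicalSpace X] [ChartedSpace V X]
    [IsManifold 𝓘(ℂ, V) ω X] : IsManifold 𝓘(ℝ, V) ∞ X := by
  refine isManifold_of_contDiffOn _ _ _ fun e e' he he' => ?_
  have h := (contDiffGroupoid ω 𝓘(ℂ, V)).compatible he he'
  rw [contDiffGroupoid, mem_groupoid_of_pregroupoid] at h
  exact (h.1.restrict_scalars ℝ).of_le le_top

variable {X : Type*} [TopologicalSpace X] [ChartedSpace V X]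

/-- The transition map between the preferred charts at `p` and `q`. -/
def chartTrans (p q : X) : V → V := chartAt V q ∘ (chartAt V p).symm

theorem contDiffAt_chartTrans [IsManifold 𝓘(ℂ, V) ω X] {p q : X} {y : V}
    (hy : y ∈ (chartAt V p).target) (hq : (chartAt V p).symm y ∈ (chartAt V q).source) :
    ContDiffAt ℂ ω (chartTrans p q) y := by
  have h := contDiffWithinAt_ext_coord_change (n := ω) (I := 𝓘(ℂ, V)) q p (y := y)
    (by simpa [PartialEquiv.trans_source] using ⟨hy, hq⟩)
  simpa [chartTrans, contDiffWithinAt_univ] using h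

/-- The tangent space at a point is read in the preferred chart at that point, so the derivative of
the inverse chart at `p` is that of the transition map to the chart at the image point. -/
theorem mfderiv_chart_symm [IsManifold 𝓘(ℂ, V) ω X] {p : X} {y : V}
    (hy : y ∈ (chartAt V p).target) :
    mfderiv 𝓘(ℝ, V) 𝓘(ℝ, V) (extChartAt 𝓘(ℝ, V) p).symm y =
      fderiv ℝ (chartTrans p ((chartAt V p).symm y)) y := by
  have hd : DifferentiableAt ℝ (chartTrans p ((chartAt V p).symm y)) y :=
    ((contDiffAt_chartTrans hy (mem_chart_source V _)).restrict_scalars ℝ).differentiableAt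
      (by simp)
  have hw := hd.hasFDerivAt.hasFDerivWithinAt (s := Set.range 𝓘(ℝ, V))
  generalize fderiv ℝ (chartTrans p ((chartAt V p).symm y)) y = D at hw ⊢
  have hm : HasMFDerivAt 𝓘(ℝ, V) 𝓘(ℝ, V) (extChartAt 𝓘(ℝ, V) p).symm y D :=
    ⟨(chartAt V p).continuousAt_symm hy, hw⟩
  exact hm.mfderiv

omit [NormedSpace ℂ V] in
theorem eventually_mem_chart {p q : X} {y : V} (hy : y ∈ (chartAt V p).target)
    (hq : (chartAt V p).symm y ∈ (chartAt V q).source) :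
    ∀ᶠ z in nhds y, z ∈ (chartAt V p).target ∧ (chartAt V p).symm z ∈ (chartAt V q).source :=
  Filter.Eventually.and ((chartAt V p).open_target.mem_nhds hy)
    ((chartAt V p).continuousAt_symm hy ((chartAt V q).open_source.mem_nhds hq))

omit [NormedSpace ℂ V] in
theorem chartTrans_mem {p q : X} {y : V}
    (hq : (chartAt V p).symm y ∈ (chartAt V q).source) :
    chartTrans p q y ∈ (chartAt V q).target := (chartAt V q).map_source hq

omit [NormedSpace ℂ V] in
theorem chart_symm_chartTrans {p q : X} {y : V}
    (hq : (chartAt V p).symm y ∈ (chartAt V q).source) :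
    (chartAt V q).symm (chartTrans p q y) = (chartAt V p).symm y := (chartAt V q).left_inv hq

omit [NormedSpace ℂ V] in
/-- The cocycle property of the transition maps. -/
theorem chartTrans_comp {p q r : X} {y : V} (hy : y ∈ (chartAt V p).target)
    (hq : (chartAt V p).symm y ∈ (chartAt V q).source) :
    chartTrans p r =ᶠ[nhds y] chartTrans q r ∘ chartTrans p q := by
  filter_upwards [eventually_mem_chart hy hq] with z hz
  change chartAt V r _ = chartAt V r ((chartAt V q).symm (chartTrans p q z))
  rw [chart_symm_chartTrans hz.2]

theorem differentiableAt_chartTrans [IsManifold 𝓘(ℂ, V) ω X] {p q : X} {y : V}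
    (hy : y ∈ (chartAt V p).target) (hq : (chartAt V p).symm y ∈ (chartAt V q).source) :
    DifferentiableAt ℝ (chartTrans p q) y :=
  ((contDiffAt_chartTrans hy hq).restrict_scalars ℝ).differentiableAt (by simp)

theorem fderiv_chartTrans_comp [IsManifold 𝓘(ℂ, V) ω X] {p q r : X} {y : V}
    (hy : y ∈ (chartAt V p).target) (hq : (chartAt V p).symm y ∈ (chartAt V q).source)
    (hr : (chartAt V p).symm y ∈ (chartAt V r).source) :
    fderiv ℝ (chartTrans p r) y =
      (fderiv ℝ (chartTrans q r) (chartTrans p q y)).comp (fderiv ℝ (chartTrans p q) y) := by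
  rw [(chartTrans_comp hy hq).fderiv_eq]
  refine fderiv_comp y (differentiableAt_chartTrans (chartTrans_mem hq) ?_)
    (differentiableAt_chartTrans hy hq)
  rwa [chart_symm_chartTrans hq]

theorem fderiv_chartTrans_self {p : X} {y : V} (hy : y ∈ (chartAt V p).target) :
    fderiv ℝ (chartTrans p p) y = ContinuousLinearMap.id ℝ V := by
  have h : chartTrans p p =ᶠ[nhds y] id := by
    filter_upwards [(chartAt V p).open_target.mem_nhds hy] with z hz
    exact (chartAt V p).right_inv hz
  rw [h.fderiv_eq, fderiv_id]

/-- Pullback of forms by a linear map. -/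
abbrev pullback (L : V →L[ℝ] V) : FormAlg V →ₐ[ℂ] FormAlg V := ExteriorAlgebra.map (precomp L)

theorem pullback_comp (L M : V →L[ℝ] V) (w : FormAlg V) :
    pullback (L.comp M) w = pullback M (pullback L w) := by
  exact congrArg (fun φ : FormAlg V →ₐ[ℂ] FormAlg V => φ w)
    (ExteriorAlgebra.map_comp_map (precomp L) (precomp M)).symm

theorem pullback_id (w : FormAlg V) : pullback (ContinuousLinearMap.id ℝ V) w = w := by
  have : (precomp (ContinuousLinearMap.id ℝ V) : (V →L[ℝ] ℂ) →ₗ[ℂ] (V →L[ℝ] ℂ)) =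
    LinearMap.id := rfl
  rw [pullback, this, ExteriorAlgebra.map_id]
  rfl

theorem localRep_eq [IsManifold 𝓘(ℂ, V) ω X] (η : FormField V X) {p : X} {y : V}
    (hy : y ∈ (chartAt V p).target) :
    localRep η p y = pullback (fderiv ℝ (chartTrans p ((chartAt V p).symm y)) y)
      (η ((chartAt V p).symm y)) := by
  rw [localRep, mfderiv_chart_symm hy]
  rfl

theorem localRep_center [IsManifold 𝓘(ℂ, V) ω X] (η : FormField V X) (p : X) :
    localRep η p (chartAt V p p) = η p := by
  rw [localRep_eq η (mem_chart_target V p), (chartAt V p).left_inv (mem_chart_source V p),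
    fderiv_chartTrans_self (mem_chart_target V p), pullback_id]

/-- The change of charts for the local representations of a form. -/
theorem localRep_chartTrans [IsManifold 𝓘(ℂ, V) ω X] (η : FormField V X) {p q : X} {y : V}
    (hy : y ∈ (chartAt V p).target) (hq : (chartAt V p).symm y ∈ (chartAt V q).source) :
    localRep η p y = pullback (fderiv ℝ (chartTrans p q) y) (localRep η q (chartTrans p q y)) := by
  rw [localRep_eq η hy, localRep_eq η (chartTrans_mem hq), chart_symm_chartTrans hq,
    fderiv_chartTrans_comp hy hq (mem_chart_source V _), pullback_comp]

/-- The covector `P(dg)` for real linear maps commuting with the complex structure. -/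
theorem precomp_comm_proj {L : V →L[ℂ] V} {P : (V →L[ℝ] ℂ) →ₗ[ℂ] (V →L[ℝ] ℂ)}
    (hP : P = LinearMap.id ∨ P = proj10 ∨ P = proj01) (α : V →L[ℝ] ℂ) :
    P (precomp (L.restrictScalars ℝ) α) = precomp (L.restrictScalars ℝ) (P α) := by
  have h : precomp mulI (precomp (L.restrictScalars ℝ) α) =
      precomp (L.restrictScalars ℝ) (precomp mulI α) := by
    ext v
    exact congrArg α (L.map_smul Complex.I v)
  rcases hP with rfl | rfl | rfl
  · rfl
  · simp only [proj10, LinearMap.smul_apply, LinearMap.sub_apply, LinearMap.id_apply, map_smul,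
      map_sub, h]
  · simp only [proj01, LinearMap.smul_apply, LinearMap.add_apply, LinearMap.id_apply, map_smul,
      map_add, h]

theorem fderiv_chartTrans_real [IsManifold 𝓘(ℂ, V) ω X] {p q : X} {y : V}
    (hy : y ∈ (chartAt V p).target) (hq : (chartAt V p).symm y ∈ (chartAt V q).source) :
    fderiv ℝ (chartTrans p q) y = (fderiv ℂ (chartTrans p q) y).restrictScalars ℝ :=
  ((((contDiffAt_chartTrans hy hq).differentiableAt (by simp)).hasFDerivAt).restrictScalars
    ℝ).fderiv


variable [FiniteDimensional ℂ V]

attribute [local instance] formNormedAddCommGroup formNormedSpace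

/-- The antisymmetrization of a bilinear form, as an element of the algebra of forms. -/
def antisymm (B : V →L[ℝ] V →L[ℝ] ℂ) : FormAlg V :=
  ∑ i, ExteriorAlgebra.ι ℂ (coordCovector i) * ExteriorAlgebra.ι ℂ (B (Module.finBasis ℝ V i))

theorem sum_coordCovector_smul (B : V →L[ℝ] V →L[ℝ] ℂ) (v : V) :
    ∑ j, coordCovector j v • B (Module.finBasis ℝ V j) = B v := by
  conv_rhs => rw [← (Module.finBasis ℝ V).sum_repr v, map_sum]
  refine Finset.sum_congr rfl fun j _ => ?_
  rw [map_smul]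
  ext w
  simp [coordCovector]

/-- Expand `L v` and the pulled back coordinate covectors in the basis: both sides become the same
double sum, in opposite orders. -/
theorem antisymm_pullback (B : V →L[ℝ] V →L[ℝ] ℂ) (L : V →L[ℝ] V) {C : V →L[ℝ] V →L[ℝ] ℂ}
    (hC : ∀ v, C v = (B (L v)).comp L) : antisymm C = pullback L (antisymm B) := by
  have h1 : ∀ v, C v = ∑ j, coordCovector j (L v) • precomp L (B (Module.finBasis ℝ V j)) :=
    fun v => by
    rw [hC, ← sum_coordCovector_smul B (L v)]
    change precomp L _ = _
    rw [map_sum]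
    exact Finset.sum_congr rfl fun j _ => map_smul _ _ _
  have h2 : ∀ j, precomp L (coordCovector j) =
      ∑ i, coordCovector j (L (Module.finBasis ℝ V i)) • coordCovector i := fun j =>
    (sum_coordCovector (precomp L (coordCovector j))).symm
  rw [antisymm, antisymm, map_sum]
  simp only [map_mul, ExteriorAlgebra.map_apply_ι, h1, h2, map_sum, map_smul, Finset.mul_sum,
    Finset.sum_mul, smul_mul_assoc, mul_smul_comm]
  exact Finset.sum_comm

theorem antisymm_eq_zero (B : V →L[ℝ] V →L[ℝ] ℂ) (hB : ∀ v w, B v w = B w v) :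
    antisymm B = 0 := by
  have h1 : antisymm B = ∑ i, ∑ j, B (Module.finBasis ℝ V i) (Module.finBasis ℝ V j) •
      (ExteriorAlgebra.ι ℂ (coordCovector i) *
        ExteriorAlgebra.ι ℂ (coordCovector (V := V) j)) := by
    refine Finset.sum_congr rfl fun i _ => ?_
    conv_lhs => rw [← sum_coordCovector (B (Module.finBasis ℝ V i))]
    simp only [map_sum, map_smul, Finset.mul_sum, mul_smul_comm]
  have h2 : antisymm B = -antisymm B := by
    conv_lhs => rw [h1, Finset.sum_comm]
    rw [h1, ← Finset.sum_neg_distrib]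
    refine Finset.sum_congr rfl fun i _ => ?_
    rw [← Finset.sum_neg_distrib]
    refine Finset.sum_congr rfl fun j _ => ?_
    rw [hB, odd_anticomm _ _ (parity_ι _) (parity_ι _), smul_neg]
  have h3 : (2 : ℂ) • antisymm B = 0 := by
    rw [two_smul]; exact add_eq_zero_iff_eq_neg.mpr h2
  exact (smul_eq_zero.mp h3).resolve_left two_ne_zero

/-- The inclusion of covectors in the algebra of forms, as a continuous linear map. -/
def ιCLM : (V →L[ℝ] ℂ) →L[ℝ] FormAlg V :=
  (LinearMap.toContinuousLinearMap
    (ExteriorAlgebra.ι ℂ : (V →L[ℝ] ℂ) →ₗ[ℂ] FormAlg V)).restrictScalars ℝ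

theorem flatD_covector {γ : V → V →L[ℝ] ℂ} {y : V} (hγ : DifferentiableAt ℝ γ y) :
    flatD LinearMap.id (fun z => (ExteriorAlgebra.ι ℂ (γ z) : FormAlg V)) y =
      antisymm (fderiv ℝ γ y) := by
  have h : HasFDerivAt (fun z => (ExteriorAlgebra.ι ℂ (γ z) : FormAlg V))
      ((ιCLM (V := V)).comp (fderiv ℝ γ y)) y :=
    (ιCLM (V := V)).hasFDerivAt.comp y hγ.hasFDerivAt
  rw [flatD_eq LinearMap.id h.differentiableAt, antisymm]
  refine Finset.sum_congr rfl fun i _ => ?_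
  rw [h.fderiv]
  rfl

/-- The exterior derivative of a one-form commutes with pullback: the product rule yields an extra
term with the second derivative of `τ`, which is symmetric and so disappears on antisymmetrization.
-/
theorem flatD_pullback_covector {β : V → V →L[ℝ] ℂ} {τ : V → V} {c : V}
    (hβ : DifferentiableAt ℝ β (τ c)) (hτ : ContDiffAt ℝ 2 τ c) :
    flatD LinearMap.id
      (fun z => (ExteriorAlgebra.ι ℂ ((β (τ z)).comp (fderiv ℝ τ z)) : FormAlg V)) c =
      pullback (fderiv ℝ τ c)
        (flatD LinearMap.id (fun z => (ExteriorAlgebra.ι ℂ (β z) : FormAlg V)) (τ c)) := by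
  have hτ1 : DifferentiableAt ℝ τ c := hτ.differentiableAt (by simp)
  have hτ2 : DifferentiableAt ℝ (fderiv ℝ τ) c :=
    (hτ.fderiv_right (m := 1) (by norm_num)).differentiableAt one_ne_zero
  have h := (hβ.hasFDerivAt.comp c hτ1.hasFDerivAt).clm_comp hτ2.hasFDerivAt
  have hsymm := hτ.isSymmSndFDerivAt (by simp)
  have h0 : antisymm (((ContinuousLinearMap.compL ℝ V V ℂ) (β (τ c))).comp
      (fderiv ℝ (fderiv ℝ τ) c)) = 0 := antisymm_eq_zero _ fun v w => by
    change β (τ c) _ = β (τ c) _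
    exact congrArg _ (hsymm.eq v w)
  rw [flatD_covector hβ, flatD_covector (γ := fun z => (β (τ z)).comp (fderiv ℝ τ z))
    h.differentiableAt]
  refine Eq.trans (congrArg antisymm h.fderiv) ?_
  have hadd : ∀ B C : V →L[ℝ] V →L[ℝ] ℂ, antisymm (B + C) = antisymm B + antisymm C :=
    fun B C => by
    simp only [antisymm, add_apply, map_add, mul_add, Finset.sum_add_distrib]
  refine (hadd _ _).trans ?_
  refine (congrArg₂ (· + ·) h0 rfl).trans ?_
  rw [zero_add]
  exact antisymm_pullback _ _ fun v => rfl

/-- `w` is the expression of the form `η` in the chart at `p`. -/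
def Represents (p : X) {Ω : Opens V} (η : FormField V X) (w : SmoothForm Ω) : Prop :=
  ∀ y : Ω, localRep η p y = ev y w

variable [IsManifold 𝓘(ℂ, V) ω X] {p : X} {Ω : Opens V}

omit [FiniteDimensional ℂ V] in
theorem pullback_fderiv_chartTrans {q : X} {y : V} (hy : y ∈ (chartAt V p).target)
    (hq : (chartAt V p).symm y ∈ (chartAt V q).source) (w : FormAlg V) :
    pullback (fderiv ℝ (chartTrans p q) y)
      (pullback (fderiv ℝ (chartTrans q p) (chartTrans p q y)) w) = w := by
  rw [← pullback_comp, ← fderiv_chartTrans_comp hy hq ((chartAt V p).map_target hy),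
    fderiv_chartTrans_self hy, pullback_id]

/-- The exterior derivative of a form of degree one may be computed in any chart. -/
theorem represents_extd (hΩ : (Ω : Set V) ⊆ (chartAt V p).target) {η : FormField V X}
    {w : SmoothForm Ω} (h : Represents p η w)
    (hη : ∀ z ∈ Ω, ∃ α : V →L[ℝ] ℂ, η ((chartAt V p).symm z) = ExteriorAlgebra.ι ℂ α) :
    Represents p (extd η) (flatDeriv LinearMap.id w) := by
  intro y
  have hy := hΩ y.2
  set q := (chartAt V p).symm y with hq
  have hqs : (chartAt V p).symm (y : V) ∈ (chartAt V q).source := mem_chart_source V q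
  have hqp : q ∈ (chartAt V p).source := (chartAt V p).map_target hy
  have hc : chartTrans p q (y : V) = chartAt V q q := rfl
  have hcy : chartTrans q p (chartAt V q q) = y := by
    change chartAt V p ((chartAt V q).symm (chartAt V q q)) = y
    rw [(chartAt V q).left_inv hqs, (chartAt V p).right_inv hy]
  have hcp : (chartAt V q).symm (chartAt V q q) ∈ (chartAt V p).source := by
    rwa [(chartAt V q).left_inv hqs]
  -- As η has degree one, `ιInv` recovers its covector field in the chart at `p`, so that
  -- `flatD_pullback_covector` can be used.
  set β : V → V →L[ℝ] ℂ := fun z => ExteriorAlgebra.ιInv (rep w z) with hβ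
  have hβι : ∀ z : Ω, ExteriorAlgebra.ι ℂ (β z) = ev z w := fun z => by
    have h1 := h z
    obtain ⟨α, hα⟩ := hη z z.2
    rw [localRep_eq _ (hΩ z.2), hα] at h1
    rw [hβ]
    simp only
    rw [rep_apply, ← h1, ExteriorAlgebra.map_apply_ι]
    congr 1
    exact ExteriorAlgebra.ι_leftInverse _
  have hβd : DifferentiableAt ℝ β (chartTrans q p (chartAt V q q)) := by
    rw [hcy]
    exact (formCLM ExteriorAlgebra.ιInv).differentiableAt.comp _ (differentiableAt_rep w y)
  have hτ : ContDiffAt ℝ 2 (chartTrans q p) (chartAt V q q) :=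
    ((contDiffAt_chartTrans (mem_chart_target V q) hcp).restrict_scalars ℝ).of_le le_top
  -- `extd` at `q` is computed in the chart at `q`, where η is the pullback of β under the
  -- transition map to the chart at `p`.
  have hloc : localRep η q =ᶠ[nhds (chartAt V q q)]
      fun z => ExteriorAlgebra.ι ℂ ((β (chartTrans q p z)).comp (fderiv ℝ (chartTrans q p) z)) := by
    have hΩn : ∀ᶠ z in nhds (chartAt V q q), chartTrans q p z ∈ Ω :=
      hτ.continuousAt.eventually_mem (by rw [hcy]; exact Ω.isOpen.mem_nhds y.2)
    filter_upwards [eventually_mem_chart (mem_chart_target V q) hcp, hΩn] with z hz hzΩ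
    rw [localRep_chartTrans _ hz.1 hz.2, h ⟨_, hzΩ⟩, ← hβι ⟨_, hzΩ⟩, ExteriorAlgebra.map_apply_ι]
    rfl
  rw [localRep_eq _ hy, ← hq]
  have h1 : extd η q =
      pullback (fderiv ℝ (chartTrans q p) (chartTrans p q (y : V)))
        (ev y (flatDeriv LinearMap.id w)) := by
    change flatD _ _ (chartAt V q q) = _
    rw [flatD_congr _ hloc, flatD_pullback_covector hβd hτ, hcy, hc,
      ev_flatDeriv LinearMap.id w (W := fun z => ExteriorAlgebra.ι ℂ (β z)) hβι]
  rw [h1]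
  exact pullback_fderiv_chartTrans hy hqs _

/-- The operators `d`, `∂`, `∂̄` on functions may be computed in any chart. -/
theorem represents_formD_fn (hΩ : (Ω : Set V) ⊆ (chartAt V p).target)
    {P : (V →L[ℝ] ℂ) →ₗ[ℂ] (V →L[ℝ] ℂ)} (hP : P = LinearMap.id ∨ P = proj10 ∨ P = proj01)
    {g : X → ℂ} (hg : ContDiffOn ℝ ∞ (g ∘ (chartAt V p).symm) Ω) :
    Represents p (formD P (fn g)) (flatDeriv P (funForm _ hg)) := by
  intro y
  have hy := hΩ y.2
  set q := (chartAt V p).symm y with hq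
  have hqs : (chartAt V p).symm (y : V) ∈ (chartAt V q).source := mem_chart_source V q
  have hqp : q ∈ (chartAt V p).source := (chartAt V p).map_target hy
  have hc : chartTrans p q (y : V) = chartAt V q q := rfl
  have hcy : chartTrans q p (chartAt V q q) = y := by
    change chartAt V p ((chartAt V q).symm (chartAt V q q)) = y
    rw [(chartAt V q).left_inv hqs, (chartAt V p).right_inv hy]
  have hcp : (chartAt V q).symm (chartAt V q q) ∈ (chartAt V p).source := by
    rwa [(chartAt V q).left_inv hqs]
  have hgd : DifferentiableAt ℝ (g ∘ (chartAt V p).symm) (chartTrans q p (chartAt V q q)) := by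
    rw [hcy]
    exact (hg.contDiffAt (Ω.isOpen.mem_nhds y.2)).differentiableAt (by simp)
  have hτ := differentiableAt_chartTrans (mem_chart_target V q) hcp
  have hloc : localRep (fn g) q =ᶠ[nhds (chartAt V q q)]
      fun z => algebraMap ℂ (FormAlg V) ((g ∘ (chartAt V p).symm) (chartTrans q p z)) := by
    filter_upwards [eventually_mem_chart (mem_chart_target V q) hcp] with z hz
    rw [localRep_eq _ hz.1, fn, AlgHom.commutes, Function.comp_apply, chart_symm_chartTrans hz.2]
  have hcomp : HasFDerivAt (fun z => (g ∘ (chartAt V p).symm) (chartTrans q p z))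
      ((fderiv ℝ (g ∘ (chartAt V p).symm) (chartTrans q p (chartAt V q q))).comp
        (fderiv ℝ (chartTrans q p) (chartAt V q q))) (chartAt V q q) :=
    HasFDerivAt.comp _ hgd.hasFDerivAt hτ.hasFDerivAt
  have h1 : formD P (fn g) q = pullback (fderiv ℝ (chartTrans q p) (chartTrans p q (y : V)))
      (ev y (flatDeriv P (funForm _ hg))) := by
    change flatD _ _ (chartAt V q q) = _
    rw [flatD_congr _ hloc, flatD_fun P hcomp.differentiableAt, hcomp.fderiv, hc,
      ev_flatDeriv P _ (W := fun z => algebraMap ℂ (FormAlg V) ((g ∘ (chartAt V p).symm) z))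
        (fun _ => rfl), flatD_fun P (hcy ▸ hgd), ExteriorAlgebra.map_apply_ι,
      fderiv_chartTrans_real (mem_chart_target V q) hcp, hcy]
    -- Transition maps are holomorphic, so their derivatives are complex linear and preserve the
    -- types of covectors.
    exact congrArg _ (precomp_comm_proj hP _)
  rw [localRep_eq _ hy, ← hq, h1]
  exact pullback_fderiv_chartTrans hy hqs _

end Charts

/-! ## Matrices of functions on a manifold -/

section ChartSmooth

open SuperCommAlgebra TopologicalSpace

variable {V : Type*} [NormedAddCommGroup V]
  {X : Type*} [TopologicalSpace X] [ChartedSpace V X] {k l m n : Type*}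

/-- The entries of the matrix `g` are of class `C^N` on `U` in all preferred charts. -/
def ChartSmooth (V : Type*) [NormedAddCommGroup V] {X : Type*} [TopologicalSpace X]
    [ChartedSpace V X] (𝕜 : Type*) [NontriviallyNormedField 𝕜] [NormedSpace 𝕜 V]
    [NormedAlgebra 𝕜 ℂ] (N : ℕ∞ω) (U : Set X) (g : X → Matrix m n ℂ) : Prop :=
  ∀ (p : X) (i : m) (j : n), ContDiffOn 𝕜 N (fun z => g ((chartAt V p).symm z) i j)
    ((chartAt V p).target ∩ (chartAt V p).symm ⁻¹' U)

section General

variable {𝕜 : Type*} [NontriviallyNormedField 𝕜] [NormedSpace 𝕜 V] [NormedAlgebra 𝕜 ℂ]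
  {N : ℕ∞ω} {U : Set X}

theorem ChartSmooth.mono {g : X → Matrix m n ℂ} (h : ChartSmooth V 𝕜 N U g) {U' : Set X}
    (hU : U' ⊆ U) : ChartSmooth V 𝕜 N U' g := fun p i j =>
  (h p i j).mono (Set.inter_subset_inter_right _ (Set.preimage_mono hU))

theorem ChartSmooth.congr {g g' : X → Matrix m n ℂ} (h : ChartSmooth V 𝕜 N U g)
    (hg : ∀ x ∈ U, g' x = g x) : ChartSmooth V 𝕜 N U g' := fun p i j =>
  (h p i j).congr fun z hz => by rw [hg _ hz.2]

theorem ChartSmooth.mul [Fintype m] {g : X → Matrix l m ℂ} {g' : X → Matrix m n ℂ}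
    (h : ChartSmooth V 𝕜 N U g) (h' : ChartSmooth V 𝕜 N U g') :
    ChartSmooth V 𝕜 N U fun x => g x * g' x := fun p i j => by
  simp only [Matrix.mul_apply]
  exact ContDiffOn.sum fun k _ => (h p i k).mul (h' p k j)

theorem contDiffOn_det [Fintype m] [DecidableEq m] {E : Type*} [NormedAddCommGroup E]
    [NormedSpace 𝕜 E] {s : Set E} {g : E → Matrix m m ℂ}
    (h : ∀ i j, ContDiffOn 𝕜 N (fun z => g z i j) s) : ContDiffOn 𝕜 N (fun z => (g z).det) s := by
  simp only [Matrix.det_apply']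
  exact ContDiffOn.sum fun τ _ => contDiffOn_const.mul (contDiffOn_prod fun i _ => h _ _)

theorem ChartSmooth.inv [CompleteSpace 𝕜] [Fintype m] [DecidableEq m] {g : X → Matrix m m ℂ}
    (h : ChartSmooth V 𝕜 N U g) (hdet : ∀ x ∈ U, (g x).det ≠ 0) :
    ChartSmooth V 𝕜 N U fun x => (g x)⁻¹ := fun p i j => by
  simp only [Matrix.inv_def, Ring.inverse_eq_inv', Matrix.smul_apply, smul_eq_mul,
    Matrix.adjugate_apply]
  refine (contDiffOn_det (h p)).inv (fun z hz => hdet _ hz.2) |>.mul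
    (contDiffOn_det fun i' j' => ?_)
  simp only [Matrix.updateRow_apply]
  split_ifs with hi
  · exact contDiffOn_const
  · exact h p i' j'

theorem chartSmooth_of_contMDiffOn [IsManifold 𝓘(𝕜, V) N X] {g : X → Matrix m n ℂ}
    (h : ∀ i j, ContMDiffOn 𝓘(𝕜, V) 𝓘(𝕜, ℂ) N (fun x => g x i j) U) :
    ChartSmooth V 𝕜 N U g := fun p i j => by
  have := (contMDiffOn_iff.mp (h i j)).2 p 0
  refine this.mono fun z hz => ?_
  simp only [mfld_simps]
  exact ⟨hz.1, hz.2, Set.mem_univ (g ((chartAt V p).symm z) i j)⟩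

/-- The property `ChartSmooth` is local. -/
theorem chartSmooth_of_local {g : X → Matrix m n ℂ}
    (h : ∀ x ∈ U, ∃ U', IsOpen U' ∧ x ∈ U' ∧ ChartSmooth V 𝕜 N U' g) : ChartSmooth V 𝕜 N U g :=
  fun p i j z hz => by
  obtain ⟨U', hU', hx, hg⟩ := h _ hz.2
  have h1 := hg p i j z ⟨hz.1, hx⟩
  refine (h1.contDiffAt ?_).contDiffWithinAt
  exact ((chartAt V p).isOpen_inter_preimage_symm hU').mem_nhds ⟨hz.1, hx⟩

end General

variable [NormedSpace ℂ V] {U : Set X}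

theorem ChartSmooth.real {g : X → Matrix m n ℂ} (h : ChartSmooth V ℂ ω U g) :
    ChartSmooth V ℝ ∞ U g := fun p i j => ((h p i j).restrict_scalars ℝ).of_le le_top

theorem ChartSmooth.conjTranspose {g : X → Matrix m n ℂ} (h : ChartSmooth V ℝ ∞ U g) :
    ChartSmooth V ℝ ∞ U fun x => (g x).conjTranspose := fun p i j =>
  Complex.conjCLE.contDiff.comp_contDiffOn (h p j i)

/-- The image of an open set in a chart. -/
def chartOpens (p : X) (hU : IsOpen U) : Opens V :=
  ⟨(chartAt V p).target ∩ (chartAt V p).symm ⁻¹' U, (chartAt V p).isOpen_inter_preimage_symm hU⟩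

variable {hU : IsOpen U} {p : X}

omit [NormedSpace ℂ V] in
theorem chartOpens_subset : (chartOpens (V := V) p hU : Set V) ⊆ (chartAt V p).target :=
  Set.inter_subset_left

/-- The centre of the chart at a point. -/
def center {x : X} (hx : x ∈ U) : chartOpens (V := V) x hU :=
  ⟨chartAt V x x, mem_chart_target V x, by
    change (chartAt V x).symm _ ∈ U
    rwa [(chartAt V x).left_inv (mem_chart_source V x)]⟩

variable [FiniteDimensional ℂ V]

/-- A matrix of functions in a chart. -/
def funMat (p : X) (hU : IsOpen U) (g : X → Matrix m n ℂ) (hg : ChartSmooth V ℝ ∞ U g) :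
    Matrix m n (SmoothForm (chartOpens (V := V) p hU)) :=
  Matrix.of fun i j => funForm (fun z => g ((chartAt V p).symm z) i j) (hg p i j)

theorem ev_funMat {g : X → Matrix m n ℂ} (hg : ChartSmooth V ℝ ∞ U g) (i : m) (j : n)
    (y : chartOpens (V := V) p hU) : ev y (funMat p hU g hg i j) =
      algebraMap ℂ (FormAlg V) (g ((chartAt V p).symm (y : V)) i j) := rfl

theorem funMat_congr {g g' : X → Matrix m n ℂ} (hg : ChartSmooth V ℝ ∞ U g)
    (hg' : ChartSmooth V ℝ ∞ U g') (h : ∀ x ∈ U, g x = g' x) :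
    funMat p hU g hg = funMat p hU g' hg' := by
  ext1 i j
  exact SmoothForm.ext fun y => by rw [ev_funMat, ev_funMat, h _ y.2.2]

theorem funMat_mul [Fintype m] {g : X → Matrix l m ℂ} {g' : X → Matrix m n ℂ}
    (h : ChartSmooth V ℝ ∞ U g) (h' : ChartSmooth V ℝ ∞ U g') :
    funMat p hU g h * funMat p hU g' h' = funMat p hU (fun x => g x * g' x) (h.mul h') := by
  ext1 i j
  exact SmoothForm.ext fun y => by
    rw [Matrix.mul_apply, map_sum, ev_funMat, Matrix.mul_apply, map_sum]
    exact Finset.sum_congr rfl fun k _ => by rw [map_mul, map_mul, ev_funMat, ev_funMat]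

theorem funMat_eq_one [DecidableEq m] {g : X → Matrix m m ℂ} (hg : ChartSmooth V ℝ ∞ U g)
    (h : ∀ x ∈ U, g x = 1) : funMat p hU g hg = 1 := by
  ext1 i j
  exact SmoothForm.ext fun y => by
    rw [ev_funMat, h _ y.2.2, Matrix.one_apply, Matrix.one_apply]
    split_ifs
    · rw [map_one, map_one]
    · rw [map_zero, map_zero]

theorem isFun_funMat {g : X → Matrix m n ℂ} (hg : ChartSmooth V ℝ ∞ U g) :
    (dolbeault _).IsFun (funMat p hU g hg) where
  even := by
    ext1 i j
    exact SmoothForm.ext fun y => by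
      rw [Matrix.map_apply, ev_parity, ev_funMat, AlgHom.commutes]
  map_u := by
    ext1 i j
    exact SmoothForm.ext fun y => by
      rw [Matrix.map_apply]
      refine (ev_pointwise _ _ _).trans ?_
      rw [ev_funMat, AlgHom.commutes]

theorem ev_flatDeriv_funMat (P : (V →L[ℝ] ℂ) →ₗ[ℂ] (V →L[ℝ] ℂ)) {g : X → Matrix m n ℂ}
    (hg : ChartSmooth V ℝ ∞ U g) (i : m) (j : n) (y : chartOpens (V := V) p hU) :
    ev y (flatDeriv P (funMat p hU g hg i j)) = ExteriorAlgebra.ι ℂ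
      (P (fderiv ℝ (fun z => g ((chartAt V p).symm z) i j) (y : V))) := by
  rw [ev_flatDeriv P _ (W := fun z => algebraMap ℂ (FormAlg V) (g ((chartAt V p).symm z) i j))
    (fun _ => rfl), flatD_fun]
  exact ((hg p i j).contDiffAt ((chartOpens p hU).isOpen.mem_nhds y.2)).differentiableAt (by simp)

theorem delbar_funMat {g : X → Matrix m n ℂ} (hg : ChartSmooth V ℂ ω U g) :
    mD (flatDeriv proj01) (funMat p hU g hg.real) = 0 := by
  ext1 i j
  refine SmoothForm.ext fun y => ?_
  have hd : DifferentiableAt ℂ (fun z => g ((chartAt V p).symm z) i j) (y : V) :=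
    ((hg p i j).contDiffAt ((chartOpens p hU).isOpen.mem_nhds y.2)).differentiableAt (by simp)
  rw [mD_apply, ev_flatDeriv_funMat, hd.fderiv_restrictScalars ℝ]
  have h0 : proj01 ((fderiv ℂ (fun z => g ((chartAt V p).symm z) i j) (y : V)).restrictScalars ℝ) =
      0 := by
    ext v
    simp [proj01, precomp, mulI, ← mul_assoc]
  rw [h0, map_zero, Matrix.zero_apply, map_zero]

theorem del_funMat_conjTranspose {g : X → Matrix m n ℂ} (hg : ChartSmooth V ℂ ω U g) :
    mD (flatDeriv proj10) (funMat p hU (fun x => (g x).conjTranspose) hg.real.conjTranspose) =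
      0 := by
  ext1 i j
  refine SmoothForm.ext fun y => ?_
  have hd : DifferentiableAt ℂ (fun z => g ((chartAt V p).symm z) j i) (y : V) :=
    ((hg p j i).contDiffAt ((chartOpens p hU).isOpen.mem_nhds y.2)).differentiableAt (by simp)
  have hd' : HasFDerivAt (fun z => (g ((chartAt V p).symm z)).conjTranspose i j)
      ((Complex.conjCLE : ℂ →L[ℝ] ℂ).comp
        ((fderiv ℂ (fun z => g ((chartAt V p).symm z) j i) (y : V)).restrictScalars ℝ)) (y : V) :=
    (Complex.conjCLE : ℂ →L[ℝ] ℂ).hasFDerivAt.comp (y : V) (hd.hasFDerivAt.restrictScalars ℝ)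
  rw [mD_apply, ev_flatDeriv_funMat, hd'.fderiv]
  have h0 : proj10 ((Complex.conjCLE : ℂ →L[ℝ] ℂ).comp
      ((fderiv ℂ (fun z => g ((chartAt V p).symm z) j i) (y : V)).restrictScalars ℝ)) = 0 := by
    ext v
    simp [proj10, precomp, mulI, ← mul_assoc]
  rw [h0, map_zero, Matrix.zero_apply, map_zero]

/-! ### Expressions of matrices of forms in charts -/

/-- `W` is the expression of the matrix `M` of forms in the chart at `p`. -/
def RepMat (p : X) {Ω : Opens V} (M : X → Matrix m n (FormAlg V)) (W : Matrix m n (SmoothForm Ω)) :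
    Prop := ∀ i j, Represents p (fun x => M x i j) (W i j)

variable [IsManifold 𝓘(ℂ, V) ω X] {Ω : Opens V}

/-- At a fixed point, passing to the chart is a single algebra homomorphism applied to all entries;
sums, products and every natural construction on matrices are thereby transported. -/
theorem RepMat.map_eq (hΩ : (Ω : Set V) ⊆ (chartAt V p).target) {M : X → Matrix m n (FormAlg V)}
    {W : Matrix m n (SmoothForm Ω)} (h : RepMat p M W) (y : Ω) :
    (M ((chartAt V p).symm (y : V))).map
      (pullback (fderiv ℝ (chartTrans p ((chartAt V p).symm (y : V))) (y : V))) = W.map (ev y) := by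
  ext1 i j
  rw [Matrix.map_apply, Matrix.map_apply, ← h i j y, localRep_eq _ (hΩ y.2)]

theorem repMat_of_map_eq (hΩ : (Ω : Set V) ⊆ (chartAt V p).target)
    {M : X → Matrix m n (FormAlg V)} {W : Matrix m n (SmoothForm Ω)}
    (h : ∀ y : Ω, (M ((chartAt V p).symm (y : V))).map
      (pullback (fderiv ℝ (chartTrans p ((chartAt V p).symm (y : V))) (y : V))) = W.map (ev y)) :
    RepMat p M W := fun i j y => by
  have := congrFun (congrFun (h y) i) j
  rwa [Matrix.map_apply, Matrix.map_apply, ← localRep_eq (fun x => M x i j) (hΩ y.2)] at this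

omit [IsManifold 𝓘(ℂ, V) ω X] in
theorem RepMat.congr {M M' : X → Matrix m n (FormAlg V)} {W : Matrix m n (SmoothForm Ω)}
    (h : RepMat p M W) (hM : ∀ x, M x = M' x) : RepMat p M' W := fun i j y => by
  rw [← h i j y, localRep, localRep, hM]

theorem RepMat.mul [Fintype m] (hΩ : (Ω : Set V) ⊆ (chartAt V p).target)
    {M : X → Matrix l m (FormAlg V)} {M' : X → Matrix m n (FormAlg V)}
    {W : Matrix l m (SmoothForm Ω)} {W' : Matrix m n (SmoothForm Ω)} (h : RepMat p M W)
    (h' : RepMat p M' W') : RepMat p (fun x => M x * M' x) (W * W') :=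
  repMat_of_map_eq hΩ fun y => by
    rw [Matrix.map_mul, Matrix.map_mul, h.map_eq hΩ y, h'.map_eq hΩ y]

theorem RepMat.add (hΩ : (Ω : Set V) ⊆ (chartAt V p).target) {M M' : X → Matrix m n (FormAlg V)}
    {W W' : Matrix m n (SmoothForm Ω)} (h : RepMat p M W) (h' : RepMat p M' W') :
    RepMat p (fun x => M x + M' x) (W + W') :=
  repMat_of_map_eq hΩ fun y => by
    rw [Matrix.map_add _ (map_add _), Matrix.map_add _ (map_add _), h.map_eq hΩ y,
      h'.map_eq hΩ y]

omit [FiniteDimensional ℂ V] in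
theorem parity_pullback (L : V →L[ℝ] V) (w : FormAlg V) :
    pullback L (parity w) = parity (pullback L w) := parity_map _ w

theorem RepMat.represents_chern [Fintype m] [DecidableEq m]
    (hΩ : (Ω : Set V) ⊆ (chartAt V p).target)
    {M : X → Matrix m m (FormAlg V)} {W : Matrix m m (SmoothForm Ω)} (h : RepMat p M W) :
    Represents p (fun x => chern (M x)) (chern W) := fun y => by
  rw [localRep_eq _ (hΩ y.2), ← chern_map _ (parity_pullback _), h.map_eq hΩ y,
    chern_map _ fun x => ev_parity x y]

theorem RepMat.represents_berndtsson [Fintype m] [DecidableEq m]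
    (hΩ : (Ω : Set V) ⊆ (chartAt V p).target)
    {Θ : X → Matrix m m (FormAlg V)} {ξ : X → Matrix m Unit (FormAlg V)}
    {σ η : X → Matrix Unit m (FormAlg V)} {Θ' : Matrix m m (SmoothForm Ω)}
    {ξ' : Matrix m Unit (SmoothForm Ω)} {σ' η' : Matrix Unit m (SmoothForm Ω)}
    (h1 : RepMat p Θ Θ') (h2 : RepMat p ξ ξ') (h3 : RepMat p σ σ') (h4 : RepMat p η η') :
    Represents p (fun x => berndtsson (Θ x) (ξ x) (σ x) (η x)) (berndtsson Θ' ξ' σ' η') :=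
  fun y => by
  rw [localRep_eq _ (hΩ y.2), ← berndtsson_map _ (parity_pullback _), h1.map_eq hΩ y,
    h2.map_eq hΩ y, h3.map_eq hΩ y, h4.map_eq hΩ y, berndtsson_map _ fun x => ev_parity x y]

theorem Represents.apply_center {x : X} {hx : x ∈ U} {η : FormField V X}
    {w : SmoothForm (chartOpens (V := V) x hU)} (h : Represents x η w) :
    η x = ev (center hx) w := (localRep_center η x).symm.trans (h (center hx))

theorem RepMat.apply_center {x : X} (hx : x ∈ U) {M : X → Matrix m n (FormAlg V)}
    {W : Matrix m n (SmoothForm (chartOpens (V := V) x hU))} (h : RepMat x M W) :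
    M x = W.map (ev (center hx)) := by
  ext1 i j
  exact (h i j).apply_center

theorem RepMat.mEven {x : X} (hx : x ∈ U) {M : X → Matrix m n (FormAlg V)}
    {W : Matrix m n (SmoothForm (chartOpens (V := V) x hU))} (h : RepMat x M W) (hW : MEven W) :
    MEven (M x) := by
  rw [h.apply_center hx]
  ext1 i j
  rw [Matrix.map_apply, Matrix.map_apply, ← ev_parity, hW.apply]

theorem RepMat.mOdd {x : X} (hx : x ∈ U) {M : X → Matrix m n (FormAlg V)}
    {W : Matrix m n (SmoothForm (chartOpens (V := V) x hU))} (h : RepMat x M W) (hW : MOdd W) :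
    MOdd (M x) := by
  rw [h.apply_center hx]
  ext1 i j
  rw [Matrix.map_apply, Matrix.map_apply, Matrix.neg_apply, Matrix.map_apply, ← ev_parity,
    hW.apply, map_neg]

theorem repMat_fun {g : X → Matrix m n ℂ} (hg : ChartSmooth V ℝ ∞ U g) :
    RepMat p (fun x => (g x).map (algebraMap ℂ (FormAlg V))) (funMat p hU g hg) := fun i j y => by
  rw [ev_funMat, localRep_eq _ (chartOpens_subset y.2)]
  exact AlgHom.commutes _ _

theorem repMat_formD {P : (V →L[ℝ] ℂ) →ₗ[ℂ] (V →L[ℝ] ℂ)}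
    (hP : P = LinearMap.id ∨ P = proj10 ∨ P = proj01) {g : X → Matrix m n ℂ}
    (hg : ChartSmooth V ℝ ∞ U g) :
    RepMat p (fun x => Matrix.of fun i j => formD P (fn fun y => g y i j) x)
      (mD (flatDeriv P) (funMat p hU g hg)) := fun i j =>
  represents_formD_fn chartOpens_subset hP (g := fun x => g x i j) (hg p i j)

omit [IsManifold 𝓘(ℂ, V) ω X] in
/-- The derivative of a function is a form of degree one. -/
theorem formD_fn_eq_ι (P : (V →L[ℝ] ℂ) →ₗ[ℂ] (V →L[ℝ] ℂ)) (hU : IsOpen U) {g : X → Matrix m n ℂ}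
    (hg : ChartSmooth V ℝ ∞ U g) {x : X} (hx : x ∈ U) (i : m) (j : n) :
    ∃ α : V →L[ℝ] ℂ, formD P (fn fun y => g y i j) x = ExteriorAlgebra.ι ℂ α := by
  have h : localRep (fn fun y => g y i j) x =
      fun z => algebraMap ℂ (FormAlg V) (g ((chartAt V x).symm z) i j) :=
    funext fun z => AlgHom.commutes _ _
  refine ⟨_, (congrArg (fun W => flatD P W (chartAt V x x)) h).trans (flatD_fun P ?_)⟩
  exact ((hg x i j).contDiffAt ((chartOpens x hU).isOpen.mem_nhds
    (center (hU := hU) hx).2)).differentiableAt (by simp)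

end ChartSmooth

/-! ### The Chern connection in charts -/

section ChernInCharts

open SuperCommAlgebra TopologicalSpace

variable {V : Type*} [NormedAddCommGroup V] [NormedSpace ℂ V] [FiniteDimensional ℂ V]
  {X : Type*} [TopologicalSpace X] [ChartedSpace V X] [IsManifold 𝓘(ℂ, V) ω X] {U : Set X}
  {hU : IsOpen U} {p : X} {m : ℕ} {G : X → Matrix (Fin m) (Fin m) ℂ}

/-- The matrix of the connection forms. -/
abbrev connMat (G : X → Matrix (Fin m) (Fin m) ℂ) (x : X) : Matrix (Fin m) (Fin m) (FormAlg V) :=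
  Matrix.of fun i j => connForm G i j x

/-- The matrix of the curvature forms. -/
abbrev curvMat (G : X → Matrix (Fin m) (Fin m) ℂ) (x : X) : Matrix (Fin m) (Fin m) (FormAlg V) :=
  Matrix.of fun i j => curvForm G i j x

variable (hG : ChartSmooth V ℝ ∞ U G) (hGi : ChartSmooth V ℝ ∞ U fun x => (G x)⁻¹)

include hG hGi

theorem repMat_connMat :
    RepMat p (connMat G) (conn (dolbeault _) (funMat p hU G hG) (funMat p hU _ hGi)) := by
  have h := (repMat_fun (p := p) (hU := hU) hGi).mul chartOpens_subset
    (repMat_formD (p := p) (hU := hU) (P := proj10) (by simp) hG)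
  have h1 : (fun x => ((G x)⁻¹).map (algebraMap ℂ (FormAlg V)) *
      Matrix.of fun i j => formD proj10 (fn fun y => G y i j) x) = connMat (V := V) G := by
    funext x
    ext1 i j
    rw [Matrix.mul_apply]
    exact Finset.sum_congr rfl fun l _ =>
      (Algebra.smul_def ((G x)⁻¹ i l) (del (V := V) (fn fun y => G y l j) x)).symm
  rwa [h1] at h

theorem repMat_curvMat :
    RepMat p (curvMat G) (curv (dolbeault _).d
      (conn (dolbeault _) (funMat p hU G hG) (funMat p hU _ hGi))) := by
  have h0 := repMat_connMat (p := p) (hU := hU) hG hGi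
  have h1 : RepMat p (fun x => Matrix.of fun i j => extd (connForm (V := V) G i j) x)
      (mD (dolbeault _).d (conn (dolbeault _) (funMat p hU G hG) (funMat p hU _ hGi))) :=
    -- The degree-one hypothesis holds since connection forms are combinations of the one-forms ∂G.
    fun i j => represents_extd chartOpens_subset (h0 i j) fun z hz => by
      choose α hα using fun l => formD_fn_eq_ι proj10 hU hG hz.2 l j
      refine ⟨∑ l, (G ((chartAt V p).symm z))⁻¹ i l • α l, ?_⟩
      rw [map_sum]
      exact Finset.sum_congr rfl fun l _ => by
        rw [map_smul, ← hα]
        rfl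
  have h2 := h1.add chartOpens_subset (h0.mul chartOpens_subset h0)
  have h3 : (fun x => (Matrix.of fun i j => extd (connForm (V := V) G i j) x) +
      connMat G x * connMat G x) = curvMat (V := V) G := by
    funext x
    ext1 i j
    rw [Matrix.add_apply, Matrix.mul_apply]
    simp [curvForm]
  rwa [h3] at h2

theorem mEven_curvMat (hU : IsOpen U) {x : X} (hx : x ∈ U) : MEven (curvMat (V := V) G x) :=
  (repMat_curvMat (hU := hU) hG hGi).mEven hx
    (((isFun_funMat hGi).even.mul_odd (isFun_funMat hG).even.mD).curv)

-- The ordered products in `localChernForm` become ordinary ones in the commutative even subalgebra,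
-- where the Leibniz formula is the determinant.
omit [IsManifold 𝓘(ℂ, V) ω X] hG hGi in
theorem localChernForm_eq {x : X} (h : MEven (curvMat (V := V) G x)) :
    localChernForm G x = chern (curvMat (V := V) G x) := by
  have h1 : MEven (1 + aleph • curvMat (V := V) G x) := mEven_one.add (h.smul _)
  rw [chern, detE, Matrix.det_apply, localChernForm, AddSubmonoidClass.coe_finsetSum]
  refine Finset.sum_congr rfl fun τ _ => ?_
  have h2 : ∀ z : evenSub (FormAlg V), ((Equiv.Perm.sign τ • z : evenSub (FormAlg V)) :
      FormAlg V) = (Equiv.Perm.sign τ : ℤ) • (z : FormAlg V) := fun z =>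
    map_zsmul (evenSub (FormAlg V)).val (Equiv.Perm.sign τ : ℤ) z
  rw [h2, ← List.prod_ofFn]
  congr 1
  refine Eq.trans ?_ (map_list_prod (evenSub (FormAlg V)).val _).symm
  rw [List.map_ofFn]
  congr 2
  funext i
  refine Eq.trans ?_ (coe_evenPart (h1.apply (τ i) i)).symm
  rw [Matrix.add_apply, Matrix.one_apply]
  rfl

theorem represents_localChernForm :
    Represents p (fun x => chern (curvMat (V := V) G x)) (chern (curv (dolbeault _).d
      (conn (dolbeault _) (funMat p hU G hG) (funMat p hU _ hGi)))) :=
  (repMat_curvMat hG hGi).represents_chern chartOpens_subset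

theorem localChernForm_eq_ev {x : X} (hx : x ∈ U) :
    localChernForm G x = ev (center (hU := hU) hx) (chern (curv (dolbeault _).d
      (conn (dolbeault _) (funMat x hU G hG) (funMat x hU _ hGi)))) := by
  rw [localChernForm_eq (mEven_curvMat hG hGi hU hx)]
  exact (represents_localChernForm hG hGi).apply_center

end ChernInCharts

/-! ## Holomorphic frames -/

section Frames

open SuperCommAlgebra TopologicalSpace

variable {V : Type*} [NormedAddCommGroup V] [NormedSpace ℂ V]
  {X : Type*} [TopologicalSpace X] [ChartedSpace V X]
  {F : Type*} [NormedAddCommGroup F] [NormedSpace ℂ F]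
  {E : X → Type*} [TopologicalSpace (Bundle.TotalSpace F E)]
  [∀ x, AddCommGroup (E x)] [∀ x, Module ℂ (E x)] [∀ x, TopologicalSpace (E x)]
  [FiberBundle F E]

/-! ### Gram matrices at a point. -/

section Metric

variable (h : HermitianMetric V F E) {x : X} {m : ℕ}

/-- The Gram matrix of a family of vectors. -/
abbrev gramAt (v : Fin m → E x) : Matrix (Fin m) (Fin m) ℂ :=
  Matrix.of fun k j => h.inner x (v k) (v j)

theorem inner_sum_sum (v : Fin m → E x) (a b : Fin m → ℂ) :
    h.inner x (∑ k, a k • v k) (∑ j, b j • v j) =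
      ∑ k, starRingEnd ℂ (a k) * ∑ j, gramAt h v k j * b j := by
  simp only [map_sum, LinearMap.sum_apply, map_smulₛₗ, LinearMap.smul_apply, smul_eq_mul,
    RingHom.id_apply, Matrix.of_apply]
  simp only [Finset.mul_sum]
  rw [Finset.sum_comm]
  exact Finset.sum_congr rfl fun k _ => Finset.sum_congr rfl fun j _ => by ring

/-- A kernel vector of the Gram matrix would give a combination of the vectors with norm zero, hence
a linear relation. -/
theorem det_gramAt_ne_zero {v : Fin m → E x} (hv : LinearIndependent ℂ v) :
    (gramAt h v).det ≠ 0 := by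
  intro h0
  obtain ⟨c, hc, hc0⟩ := Matrix.exists_mulVec_eq_zero_iff.mpr h0
  have h1 : h.inner x (∑ k, c k • v k) (∑ k, c k • v k) = 0 := by
    rw [inner_sum_sum]
    refine Finset.sum_eq_zero fun k _ => ?_
    have := congrFun hc0 k
    rw [Matrix.mulVec, dotProduct] at this
    rw [this, Pi.zero_apply, mul_zero]
  have h2 : ∑ k, c k • v k = 0 := by
    by_contra hne
    exact h.self_ne_zero hne h1
  exact hc (funext fun k => Fintype.linearIndependent_iff.mp hv c h2 k)

end Metric

theorem chartSmooth_gram [IsManifold 𝓘(ℂ, V) ω X] (h : HermitianMetric V F E) {m : ℕ} {U : Set X}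
    (hU : IsOpen U) {e : Fin m → ∀ x, E x} (he : ∀ j, IsHolomorphicOn (V := V) F (e j) U) :
    ChartSmooth V ℝ ∞ U (gram h e) := by
  have := isManifold_real (V := V) X
  exact chartSmooth_of_contMDiffOn fun k j => h.smooth U (e k) (e j) hU (he k) (he j)

omit [NormedSpace ℂ V] in
theorem ChartSmooth.continuousOn {𝕜 : Type*} [NontriviallyNormedField 𝕜] [NormedSpace 𝕜 V]
    [NormedAlgebra 𝕜 ℂ] {N : ℕ∞ω} {m n : Type*} {U : Set X} (hU : IsOpen U)
    {g : X → Matrix m n ℂ} (hg : ChartSmooth V 𝕜 N U g) (i : m) (j : n) :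
    ContinuousOn (fun x => g x i j) U := by
  intro x hx
  refine ContinuousAt.continuousWithinAt ?_
  have h1 : ContinuousAt (fun z => g ((chartAt V x).symm z) i j) (chartAt V x x) :=
    (hg x i j).continuousOn.continuousAt
      ((chartOpens x hU).isOpen.mem_nhds (center (hU := hU) hx).2)
  have h2 := ContinuousAt.comp (f := chartAt V x) (x := x) h1
    ((chartAt V x).continuousAt (mem_chart_source V x))
  refine h2.congr ?_
  filter_upwards [(chartAt V x).open_source.mem_nhds (mem_chart_source V x)] with z hz
  simp [(chartAt V x).left_inv hz]

variable [IsManifold 𝓘(ℂ, V) ω X] [VectorBundle ℂ F E] [ContMDiffVectorBundle ω F E 𝓘(ℂ, V)]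
  [FiniteDimensional ℂ F] {m : ℕ} {U : Set X} {e : Fin m → ∀ x, E x}

omit [IsManifold 𝓘(ℂ, V) ω X] [VectorBundle ℂ F E] [ContMDiffVectorBundle ω F E 𝓘(ℂ, V)]
  [FiniteDimensional ℂ F] in
theorem coeff_frame (he : IsLocalFrameOn 𝓘(ℂ, V) F ω e U) {x : X} (hx : x ∈ U) (i j : Fin m) :
    he.coeff i x (e j x) = if i = j then 1 else 0 := by
  rw [he.coeff_apply_of_mem hx (e j), ← he.toBasisAt_coe hx j, Module.Basis.repr_self,
    Finsupp.single_apply]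
  simp only [eq_comm]

/-- The coefficients of holomorphic sections in a holomorphic frame are holomorphic. -/
theorem chartSmooth_coeff (he : IsLocalFrameOn 𝓘(ℂ, V) F ω e U) {W : Set X} (hW : IsOpen W)
    (hWU : W ⊆ U) {n : Type*} {s : n → ∀ x, E x}
    (hs : ∀ j, IsHolomorphicOn (V := V) F (s j) W) :
    ChartSmooth V ℂ ω W fun x => Matrix.of fun i j => he.coeff i x (s j x) := by
  have : ContMDiffVectorBundle 1 F E 𝓘(ℂ, V) := ContMDiffVectorBundle.of_le (n := ω) le_top
  refine chartSmooth_of_local fun x hx => ?_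
  set t := trivializationAt F E x
  have hxt : x ∈ t.baseSet := FiberBundle.mem_baseSet_trivializationAt' x
  let b : Module.Basis (Fin m) ℂ F := (he.toBasisAt (hWU hx)).map (t.linearEquivAt ℂ x hxt)
  have hWt : IsOpen (W ∩ t.baseSet) := hW.inter t.open_baseSet
  refine ⟨W ∩ t.baseSet, hWt, ⟨hx, hxt⟩, ?_⟩
  have hcs : ∀ s : ∀ x, E x, IsHolomorphicOn (V := V) F s W → ∀ i,
      ContMDiffOn 𝓘(ℂ, V) 𝓘(ℂ, ℂ) ω (fun y => t.localFrameCoeff 𝓘(ℂ, V) b i y (s y))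
        (W ∩ t.baseSet) := fun s hs i =>
    contMDiffOn_localFrameCoeff b hWt Set.inter_subset_right (hs.mono Set.inter_subset_left) i
  -- In a local trivialization the frame has a matrix M and the sections a matrix S, both
  -- holomorphic; the coefficients C satisfy MC = S, so C = M⁻¹S.
  have hmul : ∀ s : ∀ x, E x, ∀ y ∈ U, ∀ i, ∑ k, t.localFrameCoeff 𝓘(ℂ, V) b i y (e k y) *
      he.coeff k y (s y) = t.localFrameCoeff 𝓘(ℂ, V) b i y (s y) := fun s y hy i => by
    conv_rhs => rw [he.coeff_sum_eq s hy, map_sum]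
    refine Finset.sum_congr rfl fun k _ => ?_
    rw [map_smul, smul_eq_mul, mul_comm]
  have hM : ChartSmooth V ℂ ω (W ∩ t.baseSet) fun y => Matrix.of fun i j =>
      t.localFrameCoeff 𝓘(ℂ, V) b i y (e j y) :=
    chartSmooth_of_contMDiffOn fun i j => hcs (e j) ((he.contMDiffOn j).mono hWU) i
  have hdet : ∀ y ∈ W ∩ t.baseSet,
      (Matrix.of fun i j => t.localFrameCoeff 𝓘(ℂ, V) b i y (e j y)).det ≠ 0 := fun y hy => by
    have h1 : (Matrix.of fun i j => t.localFrameCoeff 𝓘(ℂ, V) b i y (e j y)) *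
        (Matrix.of fun i j => he.coeff i y (t.localFrame b j y)) = 1 := by
      ext i j
      rw [Matrix.mul_apply, Matrix.one_apply]
      exact (hmul (t.localFrame b j) y (hWU hy.1) i).trans
        (coeff_frame (t.isLocalFrameOn_localFrame_baseSet 𝓘(ℂ, V) ω b) hy.2 i j)
    exact (Matrix.isUnit_det_of_right_inverse h1).ne_zero
  have hS : ChartSmooth V ℂ ω (W ∩ t.baseSet) fun y => Matrix.of fun i j =>
      t.localFrameCoeff 𝓘(ℂ, V) b i y (s j y) :=
    chartSmooth_of_contMDiffOn fun i j => hcs (s j) (hs j) i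
  refine ((hM.inv hdet).mul hS).congr fun y hy => ?_
  have h2 : (Matrix.of fun i j => t.localFrameCoeff 𝓘(ℂ, V) b i y (s j y)) =
      (Matrix.of fun i j => t.localFrameCoeff 𝓘(ℂ, V) b i y (e j y)) *
        (Matrix.of fun i j => he.coeff i y (s j y)) := by
    ext i j
    exact (hmul (s j) y (hWU hy.1) i).symm
  rw [h2, ← Matrix.mul_assoc, Matrix.nonsing_inv_mul _ (isUnit_iff_ne_zero.mpr (hdet y hy)),
    Matrix.one_mul]

end Frames

/-! ## The Chern and Berndtsson forms in holomorphic frames -/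

section FrameForms

open SuperCommAlgebra TopologicalSpace

variable {V : Type*} [NormedAddCommGroup V] [NormedSpace ℂ V]
  {X : Type*} [TopologicalSpace X] [ChartedSpace V X]
  {F : Type*} [NormedAddCommGroup F] [NormedSpace ℂ F]
  {E : X → Type*} [TopologicalSpace (Bundle.TotalSpace F E)]
  [∀ x, AddCommGroup (E x)] [∀ x, Module ℂ (E x)] [∀ x, TopologicalSpace (E x)]
  [FiberBundle F E]
  {h : HermitianMetric V F E} {f : ∀ x, E x} {m : ℕ} {U U' : Set X}
  {e e' : Fin m → ∀ x, E x}

/-! ### Coefficient matrices and their behaviour under change of frame. -/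

section Pointwise

variable (he : IsLocalFrameOn 𝓘(ℂ, V) F ω e U) (he' : IsLocalFrameOn 𝓘(ℂ, V) F ω e' U')

/-- The column of coefficients of a section. -/
def coeffMat (f : ∀ x, E x) (x : X) : Matrix (Fin m) Unit ℂ :=
  Matrix.of fun j _ => he.coeff j x (f x)

/-- The matrix of coefficients of a frame in another frame. -/
def transMat (e' : Fin m → ∀ x, E x) (x : X) : Matrix (Fin m) (Fin m) ℂ :=
  Matrix.of fun i j => he.coeff i x (e' j x)

variable (h f) in
/-- The inverse `|f|⁻²` of the square of the norm, as a matrix. -/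
def normInv (x : X) : Matrix Unit Unit ℂ :=
  ((coeffMat he f x).conjTranspose * gram h e x * coeffMat he f x)⁻¹

variable (h f e) in
/-- The row of coefficients of `σ`. -/
def dualMat (x : X) : Matrix Unit (Fin m) ℂ := Matrix.of fun _ k => dualSection h f x (e k x)

variable {x : X}

theorem conjTranspose_coeffMat_mul_gram (hx : x ∈ U) (k : Fin m) :
    ((coeffMat he f x).conjTranspose * gram h e x) () k = h.inner x (f x) (e k x) := by
  conv_rhs => rw [he.coeff_sum_eq f hx]
  simp only [map_sum, LinearMap.sum_apply, map_smulₛₗ, LinearMap.smul_apply, smul_eq_mul]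
  rfl

theorem norm_coeffMat (hx : x ∈ U) :
    ((coeffMat he f x).conjTranspose * gram h e x * coeffMat he f x) () () =
      h.inner x (f x) (f x) := by
  rw [Matrix.mul_apply]
  simp only [conjTranspose_coeffMat_mul_gram he hx]
  conv_rhs => rw [he.coeff_sum_eq (s := e) f hx, map_sum, ← he.coeff_sum_eq f hx]
  refine Finset.sum_congr rfl fun k _ => ?_
  rw [map_smul, smul_eq_mul, mul_comm]
  rfl

theorem det_norm_ne_zero (hx : x ∈ U) (hf : f x ≠ 0) :
    ((coeffMat he f x).conjTranspose * gram h e x * coeffMat he f x).det ≠ 0 := by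
  rw [Matrix.det_unique]
  exact (norm_coeffMat he hx).trans_ne (h.self_ne_zero hf)

theorem normInv_mul (hx : x ∈ U) :
    normInv h f he x * ((coeffMat he f x).conjTranspose * gram h e x) = dualMat h f e x := by
  ext i k
  have h1 : normInv h f he x () () = (h.inner x (f x) (f x))⁻¹ := by
    rw [normInv, Matrix.inv_subsingleton, Matrix.diagonal_apply_eq, Ring.inverse_eq_inv',
      norm_coeffMat he hx]
  rw [Matrix.mul_apply, Finset.univ_unique, Finset.sum_singleton]
  refine (congrArg₂ (· * ·) h1 (conjTranspose_coeffMat_mul_gram he hx k)).trans ?_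
  rfl

theorem det_gram_ne_zero (he : IsLocalFrameOn 𝓘(ℂ, V) F ω e U) (hx : x ∈ U) :
    (gram h e x).det ≠ 0 :=
  det_gramAt_ne_zero h (he.linearIndependent hx)

theorem transMat_mul_transMat (hx : x ∈ U) (hx' : x ∈ U') :
    transMat he' e x * transMat he e' x = 1 := by
  ext i j
  rw [Matrix.mul_apply, Matrix.one_apply, ← coeff_frame he' hx' i j]
  conv_rhs => rw [he.coeff_sum_eq (e' j) hx, map_sum]
  refine Finset.sum_congr rfl fun l _ => ?_
  rw [map_smul, smul_eq_mul, mul_comm]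
  rfl

theorem gram_change (hx : x ∈ U) : gram h e' x =
    (transMat he e' x).conjTranspose * gram h e x * transMat he e' x := by
  ext a b
  have h1 : h.inner x (e' a x) (e' b x) = h.inner x (∑ i, he.coeff i x (e' a x) • e i x)
      (∑ i, he.coeff i x (e' b x) • e i x) := by
    rw [← he.coeff_sum_eq (e' a) hx, ← he.coeff_sum_eq (e' b) hx]
  refine h1.trans ((inner_sum_sum h _ _ _).trans ?_)
  rw [Matrix.mul_assoc, Matrix.mul_apply]
  rfl

theorem gram_inv_change (he : IsLocalFrameOn 𝓘(ℂ, V) F ω e U)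
    (he' : IsLocalFrameOn 𝓘(ℂ, V) F ω e' U') (hx : x ∈ U) (hx' : x ∈ U') : (gram h e' x)⁻¹ =
    transMat he' e x * (gram h e x)⁻¹ * (transMat he' e x).conjTranspose := by
  refine Matrix.inv_eq_right_inv ?_
  have h1 := transMat_mul_transMat he' he hx' hx
  have h2 : (transMat he e' x).conjTranspose * (transMat he' e x).conjTranspose = 1 := by
    rw [← Matrix.conjTranspose_mul, transMat_mul_transMat he he' hx hx', Matrix.conjTranspose_one]
  rw [gram_change he hx]
  simp only [Matrix.mul_assoc]
  rw [← Matrix.mul_assoc (transMat he e' x) (transMat he' e x), h1, Matrix.one_mul,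
    ← Matrix.mul_assoc (gram h e x), Matrix.mul_nonsing_inv _
    (isUnit_iff_ne_zero.mpr (det_gram_ne_zero he hx)), Matrix.one_mul, h2]

theorem coeffMat_change (hx : x ∈ U) :
    coeffMat he' f x = transMat he' e x * coeffMat he f x := by
  ext i j
  rw [Matrix.mul_apply]
  refine (congrArg (he'.coeff i x) (he.coeff_sum_eq f hx)).trans ?_
  rw [map_sum]
  refine Finset.sum_congr rfl fun l _ => ?_
  rw [map_smul, smul_eq_mul, mul_comm]
  rfl

theorem normInv_change (hx : x ∈ U) (hx' : x ∈ U') : normInv h f he' x = normInv h f he x := by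
  rw [normInv, normInv]
  congr 1
  ext i j
  exact (norm_coeffMat he' hx').trans (norm_coeffMat he hx).symm

end Pointwise

variable [IsManifold 𝓘(ℂ, V) ω X]

theorem chartSmooth_gram_inv (he : IsLocalFrameOn 𝓘(ℂ, V) F ω e U) (hU : IsOpen U) :
    ChartSmooth V ℝ ∞ U fun x => (gram h e x)⁻¹ :=
  (chartSmooth_gram h hU he.contMDiffOn).inv fun _ hx => det_gram_ne_zero he hx

variable [FiniteDimensional ℂ V] [VectorBundle ℂ F E] [ContMDiffVectorBundle ω F E 𝓘(ℂ, V)]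
  [FiniteDimensional ℂ F]

set_option linter.unusedSectionVars false

variable {W : Set X} {hW : IsOpen W} {p : X}

theorem isGram_funMat {G : X → Matrix (Fin m) (Fin m) ℂ} (hG : ChartSmooth V ℝ ∞ W G)
    (hGi : ChartSmooth V ℝ ∞ W fun x => (G x)⁻¹) (hdet : ∀ x ∈ W, (G x).det ≠ 0) :
    IsGram (dolbeault _) (funMat p hW G hG) (funMat p hW _ hGi) where
  isFun := isFun_funMat hG
  isFun_inv := isFun_funMat hGi
  mul_inv := by
    rw [funMat_mul]
    exact funMat_eq_one _ fun x hx =>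
      Matrix.mul_nonsing_inv _ (isUnit_iff_ne_zero.mpr (hdet x hx))
  inv_mul := by
    rw [funMat_mul]
    exact funMat_eq_one _ fun x hx =>
      Matrix.nonsing_inv_mul _ (isUnit_iff_ne_zero.mpr (hdet x hx))

section Gauge

variable (he : IsLocalFrameOn 𝓘(ℂ, V) F ω e U) (he' : IsLocalFrameOn 𝓘(ℂ, V) F ω e' U')
  (hg : ChartSmooth V ℂ ω W (transMat he e')) (hk : ChartSmooth V ℂ ω W (transMat he' e))

theorem isGauge_funMat (hWU : W ⊆ U) (hWU' : W ⊆ U') :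
    IsGauge (dolbeault _) (funMat p hW _ hg.real) (funMat p hW _ hk.real)
      (funMat p hW _ hg.real.conjTranspose) (funMat p hW _ hk.real.conjTranspose) where
  even := (isFun_funMat _).even
  even_inv := (isFun_funMat _).even
  even_conj := (isFun_funMat _).even
  mul_inv := by
    rw [funMat_mul]
    exact funMat_eq_one _ fun x hx => transMat_mul_transMat he' he (hWU' hx) (hWU hx)
  inv_mul := by
    rw [funMat_mul]
    exact funMat_eq_one _ fun x hx => transMat_mul_transMat he he' (hWU hx) (hWU' hx)
  conj_mul := by
    rw [funMat_mul]
    exact funMat_eq_one _ fun x hx => by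
      rw [← Matrix.conjTranspose_mul, transMat_mul_transMat he' he (hWU' hx) (hWU hx),
        Matrix.conjTranspose_one]
  delbar_eq := delbar_funMat hg
  del_conj := del_funMat_conjTranspose hg

end Gauge

/-- The Chern form does not depend on the frame. -/
theorem localChernForm_gram_eq (hU : IsOpen U) (he : IsLocalFrameOn 𝓘(ℂ, V) F ω e U)
    (hU' : IsOpen U') (he' : IsLocalFrameOn 𝓘(ℂ, V) F ω e' U') {x : X} (hx : x ∈ U)
    (hx' : x ∈ U') :
    localChernForm (V := V) (gram h e') x = localChernForm (gram h e) x := by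
  have hW : IsOpen (U ∩ U') := hU.inter hU'
  have h1 : U ∩ U' ⊆ U := Set.inter_subset_left
  have h2 : U ∩ U' ⊆ U' := Set.inter_subset_right
  have hG := (chartSmooth_gram h hU he.contMDiffOn).mono h1
  have hGi := (chartSmooth_gram_inv (h := h) he hU).mono h1
  have hG' := (chartSmooth_gram h hU' he'.contMDiffOn).mono h2
  have hGi' := (chartSmooth_gram_inv (h := h) he' hU').mono h2
  have hg : ChartSmooth V ℂ ω (U ∩ U') (transMat he e') :=
    chartSmooth_coeff he hW h1 fun j => (he'.contMDiffOn j).mono h2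
  have hk : ChartSmooth V ℂ ω (U ∩ U') (transMat he' e) :=
    chartSmooth_coeff he' hW h2 fun j => (he.contMDiffOn j).mono h1
  have hgram := isGram_funMat (p := x) (hW := hW) hG hGi fun y hy => det_gram_ne_zero he (h1 hy)
  have k1 : funMat x hW _ hG' = funMat x hW _ hg.real.conjTranspose * funMat x hW _ hG *
      funMat x hW _ hg.real := by
    rw [funMat_mul, funMat_mul]
    exact funMat_congr _ _ fun y hy => gram_change he (h1 hy)
  have k2 : funMat x hW _ hGi' = funMat x hW _ hk.real * funMat x hW _ hGi *
      funMat x hW _ hk.real.conjTranspose := by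
    rw [funMat_mul, funMat_mul]
    exact funMat_congr _ _ fun y hy => gram_inv_change he he' (h1 hy) (h2 hy)
  have k3 := (isGauge_funMat (p := x) (hW := hW) he he' hg hk h1 h2).chern_eq hgram
  rw [← k1, ← k2] at k3
  exact (localChernForm_eq_ev hG' hGi' (hU := hW) ⟨hx, hx'⟩).trans
    ((congrArg _ k3).trans (localChernForm_eq_ev hG hGi (hU := hW) ⟨hx, hx'⟩).symm)

/-! ### The Berndtsson form -/

variable (h f) in
/-- The set `W` is contained in the domain of the frame and in the complement of the zero set of
`f`, and all the relevant matrices of functions are smooth there. -/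
structure Admissible (he : IsLocalFrameOn 𝓘(ℂ, V) F ω e U) (W : Set X) : Prop where
  subset : W ⊆ U
  ne_zero : ∀ x ∈ W, f x ≠ 0
  gram : ChartSmooth V ℝ ∞ W (gram h e)
  gram_inv : ChartSmooth V ℝ ∞ W fun x => (PoincareLelong.gram h e x)⁻¹
  coeff : ChartSmooth V ℂ ω W (coeffMat he f)
  normInv : ChartSmooth V ℝ ∞ W (normInv h f he)
  dual : ChartSmooth V ℝ ∞ W (dualMat h f e)

/-- All the matrices arise from the Gram matrix and the coefficients of `f` by products, conjugate
transposes and inverses; |f|² is invertible since `f` has no zeros on `W`. -/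
theorem admissible (hU : IsOpen U) (he : IsLocalFrameOn 𝓘(ℂ, V) F ω e U) (hW : IsOpen W)
    (hWU : W ⊆ U) (hf : IsHolomorphicOn (V := V) F f W) (hf0 : ∀ x ∈ W, f x ≠ 0) :
    Admissible h f he W := by
  have hG := (chartSmooth_gram h hU he.contMDiffOn).mono hWU
  have hc : ChartSmooth V ℂ ω W (coeffMat he f) :=
    chartSmooth_coeff (n := Unit) he hW hWU fun _ => hf
  have hfG := hc.real.conjTranspose.mul hG
  have hs : ChartSmooth V ℝ ∞ W (normInv h f he) :=
    (hfG.mul hc.real).inv fun x hx => det_norm_ne_zero he (hWU hx) (hf0 x hx)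
  exact ⟨hWU, hf0, hG, (chartSmooth_gram_inv he hU).mono hWU, hc, hs,
    (hs.mul hfG).congr fun x hx => (normInv_mul he (hWU hx)).symm⟩

namespace Admissible

variable {he : IsLocalFrameOn 𝓘(ℂ, V) F ω e U} (A : Admissible h f he W)

/-- The Berndtsson form in a chart. -/
def form (p : X) (hW : IsOpen W) : SmoothForm (chartOpens (V := V) p hW) :=
  bernd (dolbeault _) (funMat p hW _ A.gram) (funMat p hW _ A.gram_inv)
    (funMat p hW _ A.coeff.real) (funMat p hW _ A.coeff.real.conjTranspose)
    (funMat p hW _ A.normInv)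

/-- The Chern form in a chart. -/
def chernForm (p : X) (hW : IsOpen W) : SmoothForm (chartOpens (V := V) p hW) :=
  chern (curv (dolbeault _).d (conn (dolbeault _) (funMat p hW _ A.gram)
    (funMat p hW _ A.gram_inv)))

include A

theorem isGram : IsGram (dolbeault _) (funMat p hW _ A.gram) (funMat p hW _ A.gram_inv) :=
  isGram_funMat _ _ fun _ hx => det_gram_ne_zero he (A.subset hx)

theorem norm_mul_normInv {x : X} (hx : x ∈ W) :
    (coeffMat he f x).conjTranspose * PoincareLelong.gram h e x * coeffMat he f x *
      PoincareLelong.normInv h f he x = 1 :=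
  Matrix.mul_nonsing_inv _ (isUnit_iff_ne_zero.mpr
    (det_norm_ne_zero he (A.subset hx) (A.ne_zero x hx)))

theorem normInv_mul_norm {x : X} (hx : x ∈ W) :
    PoincareLelong.normInv h f he x *
      ((coeffMat he f x).conjTranspose * PoincareLelong.gram h e x * coeffMat he f x) = 1 :=
  Matrix.nonsing_inv_mul _ (isUnit_iff_ne_zero.mpr
    (det_norm_ne_zero he (A.subset hx) (A.ne_zero x hx)))

theorem isSection : IsSection (dolbeault _) (funMat p hW _ A.gram) (funMat p hW _ A.coeff.real)
    (funMat p hW _ A.coeff.real.conjTranspose) (funMat p hW _ A.normInv) where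
  isFun := isFun_funMat _
  isFun_conj := isFun_funMat _
  isFun_inv := isFun_funMat _
  delbar_eq := delbar_funMat A.coeff
  del_conj := del_funMat_conjTranspose A.coeff
  inv_mul := by
    simp only [funMat_mul]
    exact funMat_eq_one _ fun x hx => A.normInv_mul_norm hx
  mul_inv := by
    simp only [funMat_mul]
    exact funMat_eq_one _ fun x hx => A.norm_mul_normInv hx

theorem dualSec_eq : dualSec (funMat p hW _ A.gram) (funMat p hW _ A.coeff.real.conjTranspose)
    (funMat p hW _ A.normInv) = funMat p hW _ A.dual := by
  rw [dualSec, funMat_mul, funMat_mul]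
  exact funMat_congr _ _ fun x hx => normInv_mul he (A.subset hx)

end Admissible

variable (h f) in
/-- The components of `Df`. -/
def covMat (he : IsLocalFrameOn 𝓘(ℂ, V) F ω e U) (x : X) : Matrix (Fin m) Unit (FormAlg V) :=
  Matrix.of fun j _ => extd (fn fun y => he.coeff j y (f y)) x +
    ∑ k, he.coeff k x (f x) • connForm (gram h e) j k x

variable (h f e) in
/-- The components of `∂̄σ`. -/
def delbarDualMat (x : X) : Matrix Unit (Fin m) (FormAlg V) :=
  Matrix.of fun _ k => delbar (fn fun y => dualSection h f y (e k y)) x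

namespace Admissible

variable {he : IsLocalFrameOn 𝓘(ℂ, V) F ω e U} (A : Admissible h f he W)

include A

theorem repMat_covMat : RepMat p (covMat h f he)
    (covD (dolbeault _) (funMat p hW _ A.gram) (funMat p hW _ A.gram_inv)
      (funMat p hW _ A.coeff.real)) := by
  have h1 := (repMat_formD (p := p) (hU := hW) (P := LinearMap.id) (by simp) A.coeff.real).add
    chartOpens_subset ((repMat_connMat (p := p) (hU := hW) A.gram A.gram_inv).mul chartOpens_subset
      (repMat_fun A.coeff.real))
  refine h1.congr fun x => ?_
  funext i j
  refine congrArg₂ (fun a b : FormAlg V => a + b) rfl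
    (Matrix.mul_apply.trans (Finset.sum_congr rfl fun k _ => ?_))
  exact ((Algebra.smul_def (he.coeff k x (f x)) (connForm (V := V)
    (PoincareLelong.gram h e) i k x)).trans (Algebra.commutes _ _)).symm

theorem repMat_delbarDualMat : RepMat p (delbarDualMat h f e)
    (mD (dolbeault _).delbar (funMat p hW _ A.dual)) :=
  repMat_formD (P := proj01) (by simp) A.dual

theorem localBerndtssonForm_eq (hW : IsOpen W) {x : X} (hx : x ∈ W) :
    localBerndtssonForm h f he x = berndtsson (curvMat (PoincareLelong.gram h e) x)
      (covMat h f he x) ((dualMat h f e x).map (algebraMap ℂ (FormAlg V)))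
      (delbarDualMat h f e x) := by
  rw [← berezin_eq_berndtsson _ _ _ _ (mEven_curvMat A.gram A.gram_inv hW hx)
    ((A.repMat_covMat (hW := hW)).mOdd hx (covD_odd A.isGram A.isSection))
    ((repMat_fun (hU := hW) A.dual).mEven hx (isFun_funMat A.dual).even)
    ((A.repMat_delbarDualMat (hW := hW)).mOdd hx (isFun_funMat A.dual).even.mD)]
  have h1 : sigmaTilde (V := V) h f e x = ∑ k, incl
      (((dualMat h f e x).map (algebraMap ℂ (FormAlg V))) () k) * genDual k :=
    Finset.sum_congr rfl fun k _ => by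
      rw [Matrix.map_apply, AlgHom.commutes]
      exact Algebra.smul_def (dualSection h f x (e k x)) (genDual (V := V) k)
  rw [localBerndtssonForm, h1]
  rfl

/-- The pointwise formula `localBerndtssonForm_eq` involves only matrices whose expressions in the
chart are known, and `berndtsson` is natural under pullback. -/
theorem represents : Represents p (localBerndtssonForm h f he) (A.form p hW) := by
  have h1 := (repMat_curvMat (p := p) (hU := hW) A.gram A.gram_inv).represents_berndtsson
    chartOpens_subset (A.repMat_covMat (hW := hW)) (repMat_fun A.dual)
    (A.repMat_delbarDualMat (hW := hW))
  intro y
  refine Eq.trans ?_ ((h1 y).trans ?_)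
  · rw [localRep_eq _ (chartOpens_subset y.2), localRep_eq _ (chartOpens_subset y.2),
      A.localBerndtssonForm_eq hW y.2.2]
  · rw [form, bernd, A.dualSec_eq]

theorem localBerndtssonForm_eq_ev {x : X} (hx : x ∈ W) :
    localBerndtssonForm h f he x = ev (center (hU := hW) hx) (A.form x hW) :=
  A.represents.apply_center

theorem localChernForm_eq_ev {x : X} (hx : x ∈ W) : localChernForm (PoincareLelong.gram h e) x =
    ev (center (hU := hW) hx) (A.chernForm x hW) :=
  PoincareLelong.localChernForm_eq_ev A.gram A.gram_inv hx

end Admissible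

/-- The Berndtsson form does not depend on the frame. -/
theorem localBerndtssonForm_eq_of_frames (hW : IsOpen W)
    {he : IsLocalFrameOn 𝓘(ℂ, V) F ω e U} {he' : IsLocalFrameOn 𝓘(ℂ, V) F ω e' U'}
    (A : Admissible h f he W) (A' : Admissible h f he' W) {x : X} (hx : x ∈ W) :
    localBerndtssonForm h f he' x = localBerndtssonForm h f he x := by
  have h1 := A.subset
  have h2 := A'.subset
  have hg : ChartSmooth V ℂ ω W (transMat he e') :=
    chartSmooth_coeff he hW h1 fun j => (he'.contMDiffOn j).mono h2
  have hk : ChartSmooth V ℂ ω W (transMat he' e) :=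
    chartSmooth_coeff he' hW h2 fun j => (he.contMDiffOn j).mono h1
  have k0 : funMat x hW _ A'.gram = funMat x hW _ hg.real.conjTranspose *
      funMat x hW _ A.gram * funMat x hW _ hg.real := by
    rw [funMat_mul, funMat_mul]
    exact funMat_congr _ _ fun y hy => gram_change he (h1 hy)
  have k1 : funMat x hW _ A'.gram_inv = funMat x hW _ hk.real * funMat x hW _ A.gram_inv *
      funMat x hW _ hk.real.conjTranspose := by
    rw [funMat_mul, funMat_mul]
    exact funMat_congr _ _ fun y hy => gram_inv_change he he' (h1 hy) (h2 hy)
  have k2 : funMat x hW _ A'.coeff.real = funMat x hW _ hk.real * funMat x hW _ A.coeff.real := by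
    rw [funMat_mul]
    exact funMat_congr _ _ fun y hy => coeffMat_change he he' (h1 hy)
  have k3 : funMat x hW _ A'.coeff.real.conjTranspose =
      funMat x hW _ A.coeff.real.conjTranspose * funMat x hW _ hk.real.conjTranspose := by
    rw [funMat_mul]
    exact funMat_congr _ _ fun y hy => by
      rw [coeffMat_change he he' (h1 hy), Matrix.conjTranspose_mul]
  have k4 : funMat x hW _ A'.normInv = funMat x hW _ A.normInv :=
    funMat_congr _ _ fun y hy => normInv_change he he' (h1 hy) (h2 hy)
  have k5 := (isGauge_funMat (p := x) (hW := hW) he he' hg hk h1 h2).bernd_eq A.isGram A.isSection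
  rw [← k0, ← k1, ← k2, ← k3, ← k4] at k5
  exact (A'.localBerndtssonForm_eq_ev (hW := hW) hx).trans
    ((congrArg _ (k5.trans (by rw [k4]; rfl))).trans
    (A.localBerndtssonForm_eq_ev (hW := hW) hx).symm)

end FrameForms

/-! ## The quotient bundle -/

section Quotient

open SuperCommAlgebra TopologicalSpace

variable {V : Type*} [NormedAddCommGroup V] [NormedSpace ℂ V]
  {X : Type*} [TopologicalSpace X] [ChartedSpace V X]
  {F : Type*} [NormedAddCommGroup F] [NormedSpace ℂ F]
  {E : X → Type*} [TopologicalSpace (Bundle.TotalSpace F E)]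
  [∀ x, AddCommGroup (E x)] [∀ x, Module ℂ (E x)] [∀ x, TopologicalSpace (E x)]
  [FiberBundle F E]
  {h : HermitianMetric V F E} {f : ∀ x, E x} {m r : ℕ} {U : Set X}

/-- A frame of the quotient bundle lifts locally to a frame of `E` whose first element is `f`. -/
theorem exists_adapted_frame (hf : IsHolomorphicOn (V := V) F f Set.univ)
    {q : Fin r → ∀ x, QuotFiber f x} (hU : IsOpen U) (hf0 : ∀ y ∈ U, f y ≠ 0)
    (hq : IsQuotFrameOn V F f q U) {x : X} (hx : x ∈ U) :
    ∃ (W : Set X) (e : Fin (r + 1) → ∀ x, E x), IsOpen W ∧ x ∈ W ∧ W ⊆ U ∧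
      IsLocalFrameOn 𝓘(ℂ, V) F ω e W ∧ e 0 = f ∧
      ∀ y ∈ W, ∀ i, q i y = Submodule.Quotient.mk (e i.succ y) := by
  choose W' s hW' hxW hs hqs using hq.holomorphic x hx
  have hW : IsOpen (U ∩ ⋂ i, W' i) := hU.inter (isOpen_iInter_of_finite hW')
  have hWi : ∀ i, U ∩ ⋂ i, W' i ⊆ W' i := fun i => fun y hy => Set.mem_iInter.mp hy.2 i
  have hmk : ∀ y ∈ U ∩ ⋂ i, W' i, ∀ i, q i y = Submodule.Quotient.mk (s i y) := fun y hy i =>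
    hqs i y ⟨hWi i hy, hy.1⟩
  refine ⟨U ∩ ⋂ i, W' i, Fin.cons f s, hW, ⟨hx, Set.mem_iInter.mpr hxW⟩, Set.inter_subset_left,
    ⟨fun {y} hy => ?_, fun {y} hy => ?_, fun i => ?_⟩, rfl, fun y hy i => hmk y hy i⟩
  -- In the quotient the term with `f` drops out, so the other coefficients vanish; then so does
  -- that of `f`, which is nonzero.
  · refine Fintype.linearIndependent_iff.mpr fun c hc => ?_
    rw [Fin.sum_univ_succ] at hc
    simp only [Fin.cons_zero, Fin.cons_succ] at hc
    have h1 : ∑ i : Fin r, c i.succ • q i y = 0 := by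
      have := congrArg (Submodule.mkQ (Submodule.span ℂ {f y})) hc
      rw [map_add, map_smul, map_sum, map_zero] at this
      have hf1 : Submodule.mkQ (Submodule.span ℂ {f y}) (f y) = 0 :=
        (Submodule.Quotient.mk_eq_zero _).mpr (Submodule.mem_span_singleton_self _)
      rw [hf1, smul_zero, zero_add] at this
      rw [← this]
      refine Finset.sum_congr rfl fun i _ => ?_
      rw [hmk y hy, map_smul]
      rfl
    have h2 := Fintype.linearIndependent_iff.mp (hq.linearIndependent y hy.1) _ h1
    have h3 : c 0 • f y = 0 := by simpa [h2] using hc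
    refine Fin.cases ?_ h2
    exact (smul_eq_zero.mp h3).resolve_right (hf0 y hy.1)
  · intro v _
    have h1 := hq.generating y hy.1 (Submodule.mem_top (x := Submodule.Quotient.mk v))
    obtain ⟨c, hc⟩ := (Submodule.mem_span_range_iff_exists_fun ℂ).mp h1
    have h2 : Submodule.mkQ (Submodule.span ℂ {f y}) (v - ∑ i, c i • s i y) = 0 := by
      rw [map_sub, map_sum, sub_eq_zero]
      refine hc.symm.trans (Finset.sum_congr rfl fun i _ => ?_)
      rw [hmk y hy, map_smul]
      rfl
    obtain ⟨a, ha⟩ := Submodule.mem_span_singleton.mp ((Submodule.Quotient.mk_eq_zero _).mp h2)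
    refine (Submodule.mem_span_range_iff_exists_fun ℂ).mpr ⟨Fin.cons a c, ?_⟩
    rw [Fin.sum_univ_succ]
    simp only [Fin.cons_zero, Fin.cons_succ]
    rw [ha, sub_add_cancel]
  · refine Fin.cases ?_ (fun i => ?_) i
    · exact hf.mono (Set.subset_univ _)
    · exact (hs i).mono (hWi i)

/-- The Gram matrix of the quotient metric is a Schur complement. -/
theorem quotGram_eq {q : Fin r → ∀ x, QuotFiber f x} {e : Fin (r + 1) → ∀ x, E x} {y : X}
    (hf0 : f y ≠ 0) (he0 : e 0 = f) (hq : ∀ i, q i y = Submodule.Quotient.mk (e i.succ y))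
    (i j : Fin r) : quotGram h f q y i j = gram h e y i.succ j.succ -
      gram h e y i.succ 0 * dualMat h f e y () j.succ := by
  have hlift : ∀ i, orthLift h f y (q i y) =
      e i.succ y - dualSection h f y (e i.succ y) • f y := fun i => by
    rw [hq]
    rfl
  have hN := h.self_ne_zero hf0
  have hσ : ∀ u, dualSection h f y u * h.inner y (f y) (f y) = h.inner y (f y) u := fun u => by
    simp only [dualSection, LinearMap.smul_apply, smul_eq_mul]
    field_simp
  change h.inner y (orthLift h f y (q i y)) (orthLift h f y (q j y)) =
    h.inner y (e i.succ y) (e j.succ y) -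
      h.inner y (e i.succ y) (e 0 y) * dualSection h f y (e j.succ y)
  rw [hlift, hlift, he0]
  simp only [map_sub, LinearMap.sub_apply, map_smulₛₗ, LinearMap.smul_apply, smul_eq_mul,
    RingHom.id_apply]
  rw [← hσ (e j.succ y)]
  ring

theorem orthLift_injective (h : HermitianMetric V F E) (f : ∀ x, E x) (y : X) :
    Function.Injective (orthLift h f y) := by
  rw [← LinearMap.ker_eq_bot, LinearMap.ker_eq_bot']
  intro w hw
  obtain ⟨v, rfl⟩ := Submodule.Quotient.mk_surjective _ w
  have h1 : v - dualSection h f y v • f y = 0 := hw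
  rw [Submodule.Quotient.mk_eq_zero, Submodule.mem_span_singleton]
  exact ⟨_, (sub_eq_zero.mp h1).symm⟩

theorem det_quotGram_ne_zero {q : Fin r → ∀ x, QuotFiber f x} {y : X}
    (hq : LinearIndependent ℂ fun i => q i y) : (quotGram h f q y).det ≠ 0 :=
  det_gramAt_ne_zero h (v := fun i => orthLift h f y (q i y))
    (hq.map' _ (LinearMap.ker_eq_bot.mpr (orthLift_injective h f y)))

variable {e : Fin m → ∀ x, E x}

/-- The images of all but one elements of a frame form a frame of the quotient bundle where the
corresponding coefficient of `f` does not vanish. -/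
theorem isQuotFrameOn_succAbove {e : Fin (r + 1) → ∀ x, E x} {W : Set X} (hW : IsOpen W)
    (hWU : W ⊆ U) (he : IsLocalFrameOn 𝓘(ℂ, V) F ω e U) (j : Fin (r + 1))
    (hj : ∀ y ∈ W, he.coeff j y (f y) ≠ 0) :
    IsQuotFrameOn V F f (fun i y => Submodule.Quotient.mk (e (j.succAbove i) y)) W where
  linearIndependent y hy := by
    refine Fintype.linearIndependent_iff.mpr fun c hc => ?_
    have h1 : Submodule.mkQ (Submodule.span ℂ {f y}) (∑ i, c i • e (j.succAbove i) y) = 0 := by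
      rw [map_sum, ← hc]
      rfl
    obtain ⟨a, ha⟩ := Submodule.mem_span_singleton.mp ((Submodule.Quotient.mk_eq_zero _).mp h1)
    have h2 := congrArg (he.coeff j y) ha
    rw [map_smul, map_sum, Finset.sum_eq_zero fun i _ => by
      rw [map_smul, coeff_frame he (hWU hy), if_neg (Fin.succAbove_ne j i).symm, smul_zero],
      smul_eq_mul] at h2
    have h3 : a = 0 := (mul_eq_zero.mp h2).resolve_right (hj y hy)
    rw [h3, zero_smul] at ha
    exact Fintype.linearIndependent_iff.mp
      ((he.linearIndependent (hWU hy)).comp _ Fin.succAbove_right_injective) c ha.symm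
  generating y hy := by
    set S := Submodule.span ℂ (Set.range fun i : Fin r =>
      (Submodule.Quotient.mk (e (j.succAbove i) y) : QuotFiber f y)) with hS
    have hmem : ∀ i : Fin r, (Submodule.Quotient.mk (e (j.succAbove i) y) : QuotFiber f y) ∈ S :=
      fun i => Submodule.subset_span ⟨i, rfl⟩
    -- As `f` is zero in the quotient and its `j`-th coefficient is not, the expansion of `f` can be
    -- solved for the class of `e j`.
    have hmemj : (Submodule.Quotient.mk (e j y) : QuotFiber f y) ∈ S := by
      have h1 : Submodule.mkQ (Submodule.span ℂ {f y}) (f y) = 0 :=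
        (Submodule.Quotient.mk_eq_zero _).mpr (Submodule.mem_span_singleton_self _)
      have h4 := congrArg (Submodule.mkQ (Submodule.span ℂ {f y})) (he.coeff_sum_eq f (hWU hy))
      rw [h1, map_sum, Fin.sum_univ_succAbove _ j, map_smul] at h4
      have h2 : he.coeff j y (f y) • (Submodule.Quotient.mk (e j y) : QuotFiber f y) ∈ S := by
        refine (Submodule.add_mem_iff_left S ?_).mp (h4 ▸ S.zero_mem)
        exact Submodule.sum_mem _ fun i _ => by
          rw [map_smul]
          exact Submodule.smul_mem _ _ (hmem i)
      exact (Submodule.smul_mem_iff _ (hj y hy)).mp h2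
    intro w _
    obtain ⟨v, rfl⟩ := Submodule.Quotient.mk_surjective _ w
    have h3 := congrArg (Submodule.mkQ (Submodule.span ℂ {f y}))
      ((he.toBasisAt (hWU hy)).sum_repr v)
    rw [map_sum] at h3
    refine Set.mem_of_eq_of_mem (h3 : _ = Submodule.Quotient.mk v).symm
      (Submodule.sum_mem _ fun i _ => ?_)
    rw [map_smul, he.toBasisAt_coe]
    refine Submodule.smul_mem _ _ ?_
    rcases Fin.eq_self_or_eq_succAbove j i with rfl | ⟨k, rfl⟩
    · exact hmemj
    · exact hmem k
  holomorphic x hx i := ⟨W, e (j.succAbove i), hW, hx, (he.contMDiffOn _).mono hWU, fun _ _ => rfl⟩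

variable [IsManifold 𝓘(ℂ, V) ω X] [VectorBundle ℂ F E] [ContMDiffVectorBundle ω F E 𝓘(ℂ, V)]
  [FiniteDimensional ℂ F]

/-- A coefficient of `f` which does not vanish at a point does not vanish in a neighbourhood. -/
theorem exists_coeff_ne_zero (hf : IsHolomorphicOn (V := V) F f Set.univ) (hU : IsOpen U)
    (he : IsLocalFrameOn 𝓘(ℂ, V) F ω e U) {x : X} (hx : x ∈ U) (hfx : f x ≠ 0) :
    ∃ (W : Set X) (j : Fin m), IsOpen W ∧ x ∈ W ∧ W ⊆ U ∧ ∀ y ∈ W, he.coeff j y (f y) ≠ 0 := by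
  obtain ⟨j, hj⟩ : ∃ j, he.coeff j x (f x) ≠ 0 := by
    by_contra! h0
    refine hfx ((he.coeff_sum_eq f hx).trans (Finset.sum_eq_zero fun j _ => ?_))
    rw [h0, zero_smul]
  have h1 : ChartSmooth V ℂ ω U (coeffMat he f) :=
    chartSmooth_coeff (n := Unit) he hU subset_rfl fun _ => hf.mono (Set.subset_univ _)
  exact ⟨_, j, (h1.continuousOn hU j ()).isOpen_inter_preimage hU isOpen_compl_singleton,
    ⟨hx, hj⟩, Set.inter_subset_left, fun y hy => hy.2⟩

theorem exists_isQuotFrameOn (hf : IsHolomorphicOn (V := V) F f Set.univ) (hU : IsOpen U)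
    (he : IsLocalFrameOn 𝓘(ℂ, V) F ω e U) {x : X} (hx : x ∈ U) (hfx : f x ≠ 0) :
    ∃ (r : ℕ) (W : Set X) (q : Fin r → ∀ x, QuotFiber f x),
      IsOpen W ∧ x ∈ W ∧ (∀ y ∈ W, f y ≠ 0) ∧ IsQuotFrameOn V F f q W := by
  obtain ⟨W, j, hW, hxW, hWU, hj⟩ := exists_coeff_ne_zero hf hU he hx hfx
  cases m with
  | zero => exact j.elim0
  | succ r =>
    refine ⟨r, W, _, hW, hxW, fun y hy h0 => hj y hy ?_, isQuotFrameOn_succAbove hW hWU he j hj⟩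
    rw [h0, map_zero]

omit [IsManifold 𝓘(ℂ, V) ω X] in
variable (V F E) in
/-- Local holomorphic frames exist. -/
theorem exists_isLocalFrameOn (x : X) :
    ∃ (U : Set X) (e : Fin (Module.finrank ℂ F) → ∀ x, E x), IsOpen U ∧ x ∈ U ∧
      IsLocalFrameOn 𝓘(ℂ, V) F ω e U :=
  ⟨_, _, (trivializationAt F E x).open_baseSet, FiberBundle.mem_baseSet_trivializationAt' x,
    (trivializationAt F E x).isLocalFrameOn_localFrame_baseSet 𝓘(ℂ, V) ω (Module.finBasis ℂ F)⟩

theorem isOpen_ne_zero (hf : IsHolomorphicOn (V := V) F f Set.univ) : IsOpen {x | f x ≠ 0} := by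
  refine isOpen_iff_forall_mem_open.mpr fun x hx => ?_
  obtain ⟨U, e, hU, hxU, he⟩ := exists_isLocalFrameOn V F E x
  obtain ⟨W, j, hW, hxW, -, hj⟩ := exists_coeff_ne_zero hf hU he hxU hx
  refine ⟨W, fun y hy h0 => hj y hy ?_, hW, hxW⟩
  rw [h0, map_zero]

variable [FiniteDimensional ℂ V]

/-- The transgression formula in a frame whose first element is `f`. -/
theorem ev_d_form {q : Fin r → ∀ x, QuotFiber f x} {e : Fin (r + 1) → ∀ x, E x}
    {he : IsLocalFrameOn 𝓘(ℂ, V) F ω e U} {W : Set X} (A : Admissible h f he W) (hW : IsOpen W)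
    (hq : ∀ y ∈ W, LinearIndependent ℂ fun i => q i y) (he0 : e 0 = f)
    (hqe : ∀ y ∈ W, ∀ i, q i y = Submodule.Quotient.mk (e i.succ y)) {x : X} (hx : x ∈ W) :
    ev (center (hU := hW) hx) (flatDeriv LinearMap.id (A.form x hW)) =
        localChernForm (gram h e) x - localChernForm (quotGram h f q) x ∧
      flatDeriv proj01 (A.form x hW) = flatDeriv LinearMap.id (A.form x hW) := by
  -- Smoothness of the quotient metric is read off from the Schur complement formula.
  have hH : ChartSmooth V ℝ ∞ W (quotGram h f q) := fun p i j =>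
    ((A.gram p i.succ j.succ).sub ((A.gram p i.succ 0).mul (A.dual p () j.succ))).congr
      fun z hz => quotGram_eq (A.ne_zero _ hz.2) he0 (hqe _ hz.2) i j
  have hdet : ∀ y ∈ W, (quotGram h f q y).det ≠ 0 := fun y hy =>
    det_quotGram_ne_zero (hq y hy)
  have hHi := hH.inv hdet
  have hschur : schur (funMat x hW _ A.gram) (dualSec (funMat x hW _ A.gram)
      (funMat x hW _ A.coeff.real.conjTranspose) (funMat x hW _ A.normInv)) =
      funMat x hW _ hH := by
    rw [A.dualSec_eq]
    ext1 i j
    refine SmoothForm.ext fun y => ?_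
    rw [ev_funMat, quotGram_eq (A.ne_zero _ y.2.2) he0 (hqe _ y.2.2), schur, Matrix.of_apply,
      map_sub, map_mul, ev_funMat, ev_funMat, ev_funMat, map_sub, map_mul]
  have hf0 : ∀ i u, funMat x hW _ A.coeff.real i u = if i = 0 then 1 else 0 := fun i u => by
    refine SmoothForm.ext fun y => ?_
    have h1 : coeffMat he f ((chartAt V x).symm (y : V)) i u = if i = 0 then 1 else 0 := by
      refine Eq.trans ?_ (coeff_frame he (A.subset y.2.2) i 0)
      rw [he0]
      rfl
    rw [ev_funMat, h1]
    split_ifs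
    · rw [map_one, map_one]
    · rw [map_zero, map_zero]
  have h1 := d_bernd_adapted (Hi := funMat x hW _ hHi) A.isGram A.isSection hf0
    (hschur.symm ▸ isGram_funMat hH hHi hdet)
  rw [hschur] at h1
  refine ⟨?_, h1.2⟩
  rw [A.localChernForm_eq_ev (hW := hW) hx, localChernForm_eq_ev hH hHi (hU := hW) hx, ← map_sub]
  exact congrArg _ h1.1

end Quotient

/-! ## The global forms -/

section Global

open TopologicalSpace

variable {V : Type*} [NormedAddCommGroup V] [NormedSpace ℂ V] [FiniteDimensional ℂ V]
  {X : Type*} [TopologicalSpace X] [ChartedSpace V X]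

attribute [local instance] formNormedAddCommGroup formNormedSpace

theorem Represents.isSmoothAt {p : X} {Ω : Opens V} {η : FormField V X} {w : SmoothForm Ω}
    (hw : Represents p η w) (hp : chartAt V p p ∈ Ω) : IsSmoothAt η p := fun l =>
  (((formCLM l).contDiff.contDiffAt.comp (chartAt V p p)
    (contDiffAt_rep w ⟨_, hp⟩)).congr_of_eventuallyEq
      ((eventuallyEq_rep w hw ⟨_, hp⟩).fun_comp l) :)

/-- At the centre of its own chart the operator is by definition the flat one, so no change of
charts is needed for forms of higher degree. -/
theorem Represents.formD_eq {p : X} {Ω : Opens V} {η : FormField V X} {w : SmoothForm Ω}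
    (hw : Represents p η w) (P : (V →L[ℝ] ℂ) →ₗ[ℂ] (V →L[ℝ] ℂ)) (y : Ω)
    (hy : (y : V) = chartAt V p p) : formD P η p = ev y (flatDeriv P w) := by
  rw [ev_flatDeriv P w hw y, hy]
  rfl

variable {F : Type*} [NormedAddCommGroup F] [NormedSpace ℂ F] [FiniteDimensional ℂ F]
  {E : X → Type*} [TopologicalSpace (Bundle.TotalSpace F E)]
  [∀ x, AddCommGroup (E x)] [∀ x, Module ℂ (E x)] [∀ x, TopologicalSpace (E x)]
  [FiberBundle F E] [VectorBundle ℂ F E] [ContMDiffVectorBundle ω F E 𝓘(ℂ, V)]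
  (h : HermitianMetric V F E) (f : ∀ x, E x)

-- This allows a frame of unspecified length to be compared with `someFrame` after substituting the
-- rank.
omit [FiniteDimensional ℂ V] in
theorem rank_frame {m : ℕ} {U : Set X} {e : Fin m → ∀ x, E x}
    (he : IsLocalFrameOn 𝓘(ℂ, V) F ω e U) {x : X} (hx : x ∈ U) : m = Module.finrank ℂ F := by
  obtain ⟨U', e', -, hx', he'⟩ := exists_isLocalFrameOn V F E x
  have h1 := Module.finrank_eq_card_basis (he.toBasisAt hx)
  have h2 := Module.finrank_eq_card_basis (he'.toBasisAt hx')
  simpa using h1.symm.trans h2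

variable (V F E) in
/-- The domain of a local holomorphic frame around `x`. -/
def frameDomain (x : X) : Set X := (exists_isLocalFrameOn V F E x).choose

variable (V F E) in
/-- A local holomorphic frame around `x`. -/
def someFrame (x : X) : Fin (Module.finrank ℂ F) → ∀ x, E x :=
  (exists_isLocalFrameOn V F E x).choose_spec.choose

omit [FiniteDimensional ℂ V] in
theorem isOpen_frameDomain (x : X) : IsOpen (frameDomain V F E x) :=
  (exists_isLocalFrameOn V F E x).choose_spec.choose_spec.1

omit [FiniteDimensional ℂ V] in
theorem mem_frameDomain (x : X) : x ∈ frameDomain V F E x :=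
  (exists_isLocalFrameOn V F E x).choose_spec.choose_spec.2.1

omit [FiniteDimensional ℂ V] in
theorem isLocalFrameOn_someFrame (x : X) :
    IsLocalFrameOn 𝓘(ℂ, V) F ω (someFrame V F E x) (frameDomain V F E x) :=
  (exists_isLocalFrameOn V F E x).choose_spec.choose_spec.2.2

/-- The Chern form of `E`. -/
def chernForm : FormField V X := fun x => localChernForm (gram h (someFrame V F E x)) x

/-- The form `a`. -/
def berndtssonForm : FormField V X := fun x =>
  localBerndtssonForm h f (isLocalFrameOn_someFrame (V := V) (F := F) (E := E) x) x

/-- The Chern form of `Q`, defined by the transgression formula. -/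
def quotChernForm : FormField V X := chernForm h - extd (berndtssonForm h f)

variable [IsManifold 𝓘(ℂ, V) ω X]

theorem isChernForm_chernForm : IsChernForm h (chernForm h) := fun m U e hU he x hx => by
  obtain rfl := rank_frame he hx
  exact localChernForm_gram_eq hU he (isOpen_frameDomain x) (isLocalFrameOn_someFrame x) hx
    (mem_frameDomain x)

variable {h f} (hf : IsHolomorphicOn (V := V) F f Set.univ)

include hf

theorem isBerndtssonForm_berndtssonForm : IsBerndtssonForm h f (berndtssonForm h f) :=
  fun m U e hU he x hx hfx => by
  obtain rfl := rank_frame he hx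
  have hU' := isOpen_frameDomain (V := V) (F := F) (E := E) x
  have hW : IsOpen (U ∩ frameDomain V F E x ∩ {x | f x ≠ 0}) :=
    (hU.inter hU').inter (isOpen_ne_zero hf)
  have hfW := hf.mono (Set.subset_univ (U ∩ frameDomain V F E x ∩ {x | f x ≠ 0}))
  exact localBerndtssonForm_eq_of_frames hW
    (admissible hU he hW (fun y hy => hy.1.1) hfW fun y hy => hy.2)
    (admissible hU' (isLocalFrameOn_someFrame x) hW (fun y hy => hy.1.2) hfW fun y hy => hy.2)
    ⟨⟨hx, mem_frameDomain x⟩, hfx⟩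

theorem represents_berndtssonForm {m : ℕ} {U W : Set X} {e : Fin m → ∀ x, E x} (hU : IsOpen U)
    {he : IsLocalFrameOn 𝓘(ℂ, V) F ω e U} (A : Admissible h f he W) (hW : IsOpen W) (p : X) :
    Represents p (berndtssonForm h f) (A.form p hW) := fun y => by
  have hy := chartOpens_subset y.2
  rw [← A.represents y, localRep_eq _ hy, localRep_eq _ hy,
    isBerndtssonForm_berndtssonForm hf m U e hU he _ (A.subset y.2.2) (A.ne_zero _ y.2.2)]

theorem isSmoothAt_berndtssonForm {x : X} (hx : f x ≠ 0) : IsSmoothAt (berndtssonForm h f) x := by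
  obtain ⟨U, e, hU, hxU, he⟩ := exists_isLocalFrameOn V F E x
  have hW : IsOpen (U ∩ {x | f x ≠ 0}) := hU.inter (isOpen_ne_zero hf)
  have A : Admissible h f he (U ∩ {x | f x ≠ 0}) :=
    admissible hU he hW Set.inter_subset_left (hf.mono (Set.subset_univ _)) fun y hy => hy.2
  exact (represents_berndtssonForm hf hU A hW x).isSmoothAt (center (hU := hW) ⟨hxU, hx⟩).2

/-- The transgression formula. -/
theorem extd_berndtssonForm {r : ℕ} {U : Set X} {q : Fin r → ∀ x, QuotFiber f x} (hU : IsOpen U)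
    (hf0 : ∀ y ∈ U, f y ≠ 0) (hq : IsQuotFrameOn V F f q U) {x : X} (hx : x ∈ U) :
    extd (berndtssonForm h f) x = chernForm h x - localChernForm (quotGram h f q) x ∧
      delbar (berndtssonForm h f) x = extd (berndtssonForm h f) x := by
  -- Since the Berndtsson form is independent of the frame, it may be computed in a frame starting
  -- with `f` that lifts the given frame of Q.
  obtain ⟨W, e, hW, hxW, hWU, he, he0, hqe⟩ := exists_adapted_frame hf hU hf0 hq hx
  have A : Admissible h f he W := admissible hW he hW subset_rfl (hf.mono (Set.subset_univ _))
    fun y hy => hf0 y (hWU hy)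
  have hR := represents_berndtssonForm hf hW A hW x
  have hqW : ∀ y ∈ W, LinearIndependent ℂ fun i => q i y := fun y hy =>
    hq.linearIndependent y (hWU hy)
  obtain ⟨h1, h2⟩ := ev_d_form A hW hqW he0 hqe hxW
  have h3 : ∀ P, formD P (berndtssonForm h f) x =
      ev (center (hU := hW) hxW) (flatDeriv P (A.form x hW)) := fun P => hR.formD_eq P _ rfl
  refine ⟨(h3 _).trans ?_, (h3 _).trans (h2 ▸ (h3 _).symm)⟩
  rw [h1, isChernForm_chernForm h _ W e hW he x hxW]

/-- The transgression formula holds for every frame of Q, while c(D_E) - da refers to none; hence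
all local Chern forms of Q agree with it. -/
theorem isQuotChernForm_quotChernForm : IsQuotChernForm h f (quotChernForm h f) := by
  refine ⟨fun x hx => ?_, fun r U q hU hf0 hq x hx => ?_⟩
  · obtain ⟨U, e, hU, hxU, he⟩ := exists_isLocalFrameOn V F E x
    exact exists_isQuotFrameOn hf hU he hxU hx
  · rw [quotChernForm, Pi.sub_apply, (extd_berndtssonForm hf hU hf0 hq hx).1, sub_sub_cancel]

end Global

end PoincareLelong

end

theorem proposition5p2
    {V : Type*} [NormedAddCommGroup V] [NormedSpace ℂ V] [FiniteDimensional ℂ V]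
    {X : Type*} [TopologicalSpace X] [ChartedSpace V X] [IsManifold 𝓘(ℂ, V) ω X]
    {F : Type*} [NormedAddCommGroup F] [NormedSpace ℂ F] [FiniteDimensional ℂ F]
    {E : X → Type*} [TopologicalSpace (Bundle.TotalSpace F E)]
    [∀ x, AddCommGroup (E x)] [∀ x, Module ℂ (E x)] [∀ x, TopologicalSpace (E x)]
    [FiberBundle F E] [VectorBundle ℂ F E] [ContMDiffVectorBundle ω F E 𝓘(ℂ, V)]
    (h : PoincareLelong.HermitianMetric V F E)
    (f : ∀ x, E x) (hf : PoincareLelong.IsHolomorphicOn (V := V) F f Set.univ) :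
    ∃ a cE cQ : PoincareLelong.FormField V X,
      PoincareLelong.IsBerndtssonForm h f a ∧
      PoincareLelong.IsChernForm h cE ∧
      PoincareLelong.IsQuotChernForm h f cQ ∧
      ∀ x, f x ≠ 0 →
        PoincareLelong.IsSmoothAt a x ∧
        PoincareLelong.delbar a x = PoincareLelong.extd a x ∧
        PoincareLelong.extd a x = cE x - cQ x := by
  -- With `quotChernForm` as `cQ`, the formula for da holds by definition; the content lies in `hQ`,
  -- which identifies `cQ` with the curvature determinant in every frame of Q.
  have hQ := PoincareLelong.isQuotChernForm_quotChernForm (h := h) hf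
  refine ⟨PoincareLelong.berndtssonForm h f, PoincareLelong.chernForm h,
    PoincareLelong.quotChernForm h f, PoincareLelong.isBerndtssonForm_berndtssonForm hf,
    PoincareLelong.isChernForm_chernForm h, hQ, fun x hx =>
      ⟨PoincareLelong.isSmoothAt_berndtssonForm hf hx, ?_, (sub_sub_cancel _ _).symm⟩⟩
  obtain ⟨r, U, q, hU, hxU, hf0, hq⟩ := hQ.1 x hx
  exact (PoincareLelong.extd_berndtssonForm hf hU hf0 hq hxU).2
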